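/- **Setting.** Let $I$ be a finite set of $n$ agents; agent $i$ has a finite nonempty action set $A_i$ and a utility $U_i:\prod_j A_j\to[0,1]$. Call $a\in\prod_jA_j$ an equilibrium if $U_i(b_i,a_{-i})\le U_i(a)$ for all $i$ and all $b_i\neq a_i$. The game is *interdependent* if for every profile $a$ and every $\emptyset\subsetneq J\subsetneq I$ there are $i\notin J$ and actions $a'_J$ with $U_i(a'_J,a_{-J})\ne U_i(a)$. Let $V=\{U_i(a)\}$ be the set of utilities. Let $F$ and $G$ be real functions such that $F$ is non-increasing on $V$ and, for $\bar u<u$ in $V$, $G(\bar u,u)$ is non-decreasing in $\bar u$ and non-increasing in $u$. Fix $c\in(0,1)$. **ITEL process.** An agent is either discontent (D), or content (C), hopeful (H) or watchful (W) with a benchmark $(\bar a,\bar u)$, $\bar u$ being a value of $U_i$. Given $\varepsilon\in(0,1)$, at each step the agents independently choose actions: a D agent plays uniformly at random; a C agent with $\bar u<1$ plays $\bar a$ with probability $1-\varepsilon$ and otherwise a uniformly chosen action $\ne\bar a$ (if $\bar a$ is its only action it plays $\bar a$); a C agent with $\bar u=1$ and H and W agents play $\bar a$. If agent $i$ has played $a$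 and observes $u$, the value of $U_i$ at the joint action, it then updates its state, independently of the others: - D: becomes C with benchmark $(a,u)$ with probability $\min(\varepsilon^{F(u)},c)$, else stays D. - C, $a\ne\bar a$: if $u>\bar u$, becomes C with benchmark $(a,u)$ with probability $\varepsilon^{G(\bar u,u)}$; otherwise its state is unchanged. - C, $a=\bar a$: keeps its benchmark and becomes H, stays C, or becomes W according as $u>\bar u$, $u=\bar u$, $u<\bar u$. - H: becomes C with benchmark $(a,u)$ if $u>\bar u$; becomes C with its old benchmark if $u=\bar u$; becomes W with its old benchmark if $u<\bar u$. - W: becomes H with its old benchmark if $u>\bar u$; becomes C with its old benchmark if $u=\bar u$; becomes D if $u<\bar u$. This is a Markov chain $(X^\varepsilon_k)_{k\ge0}$ on a finite set $\mathcal X$ of joint states. The *aligned* state $x_a$ of a profile $a$ is the one in which every agent $i$ is content with benchmark $(a_i,U_i(a))$. It is an *equilibrium state* if $a$ is an equilibrium, and *optimal* if $U_i(a)=1$ for all $i$. Put $$\tilde W(x_a)=1-\sum_iF(U_i(a)),\qquad \tilde S(x_a)=1-\min\{G(U_i(a),U_i(b_i,a_{-i})) : i\in I,\ b_i\neq a_i,\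 U_i(b_i,a_{-i})>U_i(a)\},$$ the latter when $a$ is not an equilibrium. The set of *stochastically stable states* is the smallest $\mathcal S\subset\mathcal X$ such that $\lim_{\varepsilon\to0^+}\liminf_{k\to\infty}\mathbb P(X^\varepsilon_k\in\mathcal S)=1$ for all initial distributions. **Theorem (ITEL convergence).** Assume that the game is interdependent and that there are constants $F_0,G_0$ with $F_0+G_0\le1$ such that $0\le F(u)\le F_0/n$ for all $u\in V$ and $0\le G(\bar u,u)<G_0$ for all $\bar u<u$ in $V$. Then: 1. If an optimal state exists, then for every $\varepsilon\in(0,1)$ and every initial distribution, the ITEL process converges almost surely to an optimal state (it is eventually constant, equal to an optimal state). 2. If there is no optimal state but there is an equilibrium state, the set of stochastically stable states is the set of equilibrium states that maximize $\tilde W$ among the equilibrium states. 3. If there is no equilibrium state, the set of stochastically stable states is the set of aligned states that maximize $\tilde W-\tilde S$ among the aligned states. -/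

import Mathlib

open Filter Topology MeasureTheory

namespace ITEL

/-! ### Markov chains on a finite state space and stochastic stability -/

/-- `X` is a homogeneous Markov chain on `(Ω, ℙ)` with transition matrix `P` (and arbitrary initial
law), expressed through its finite-dimensional laws. -/
def IsMarkovChain {X : Type*} {Ω : Type*} [MeasurableSpace Ω] (P : Matrix X X ℝ)
    (ℙ : Measure Ω) (Y : ℕ → Ω → X) : Prop :=
  (∀ k x, MeasurableSet {ω | Y k ω = x}) ∧
  ∀ (n : ℕ) (p : ℕ → X),
    ℙ.real {ω | ∀ k ≤ n, Y k ω = p k} =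
      ℙ.real {ω | Y 0 ω = p 0} * ∏ k ∈ Finset.range n, P (p k) (p (k + 1))

/-- The probability that the chain with initial law `μ` and transition matrix `P` lies in `S` at
time `k`; the law at time `k` is the row vector `μ P ^ k`. -/
noncomputable def probAt {X : Type*} [Fintype X] [DecidableEq X] (μ : X → ℝ)
    (P : Matrix X X ℝ) (k : ℕ) (S : Set X) : ℝ :=
  ∑ x, S.indicator (Matrix.vecMul μ (P ^ k)) x

/-- For all initial laws (possibly depending on `ε`), `lim_{ε → 0⁺} liminf_k ℙ(X_k^ε ∈ S) = 1`. -/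
def Captures {X : Type*} [Fintype X] [DecidableEq X] (P : ℝ → Matrix X X ℝ) (S : Set X) : Prop :=
  ∀ μ : ℝ → X → ℝ, (∀ ε, μ ε ∈ stdSimplex ℝ X) →
    Tendsto (fun ε => liminf (fun k : ℕ => probAt (μ ε) (P ε) k S) atTop) (𝓝[>] 0) (𝓝 1)

/-- `S` is the set of stochastically stable states of the perturbed process `P`: the smallest
set of states (for inclusion) that captures the process. -/
def IsStochasticallyStableSet {X : Type*} [Fintype X] [DecidableEq X] (P : ℝ → Matrix X X ℝ)
    (S : Set X) : Prop :=
  IsLeast {T : Set X | Captures P T} S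

/-! ### Games -/

section Game

variable {I : Type*} {A : I → Type*} [DecidableEq I]

/-- Nash equilibrium. -/
def IsEquilibrium (U : I → (∀ j, A j) → ℝ) (a : ∀ j, A j) : Prop :=
  ∀ (i : I) (b : A i), b ≠ a i → U i (Function.update a i b) ≤ U i a

/-- Interdependence: every nonempty proper set `J` of agents can, from any action profile, change
the utility of some agent outside `J`. -/
def Interdependent (U : I → (∀ j, A j) → ℝ) : Prop :=
  ∀ (a : ∀ j, A j) (J : Finset I), J.Nonempty → (∃ i, i ∉ J) →
    ∃ i, i ∉ J ∧ ∃ b : ∀ j, A j, U i (J.piecewise b a) ≠ U i a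

/-- The finite set of all utilities that the game can produce. -/
def utilities (U : I → (∀ j, A j) → ℝ) : Set ℝ :=
  {u | ∃ i a, U i a = u}

/-- Virtual welfare `1 - ∑ i, F (u i)` of the aligned state with benchmark action profile `a`, whose
benchmark utilities are `u i = U i a`. -/
noncomputable def virtualWelfare [Fintype I] (U : I → (∀ j, A j) → ℝ) (F : ℝ → ℝ)
    (a : ∀ j, A j) : ℝ :=
  1 - ∑ i, F (U i a)

/-- Virtual stability of the aligned state with benchmark action profile `a`. The infimum is over
a finite set, which is nonempty exactly when `a` is not an equilibrium; it is then a minimum. -/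
noncomputable def virtualStability (U : I → (∀ j, A j) → ℝ) (G : ℝ → ℝ → ℝ)
    (a : ∀ j, A j) : ℝ :=
  1 - sInf {g | ∃ (i : I) (b : A i), b ≠ a i ∧ U i a < U i (Function.update a i b) ∧
    g = G (U i a) (U i (Function.update a i b))}

end Game

/-! ### Resistance functions -/

/-- On the set `V` of utilities, `F` is non-increasing, and `G u₀ u` (which only matters for
`u₀ < u`) is non-decreasing in the benchmark `u₀` and non-increasing in the observation `u`. -/
def MonotoneResistances (V : Set ℝ) (F : ℝ → ℝ) (G : ℝ → ℝ → ℝ) : Prop :=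
  AntitoneOn F V ∧
  (∀ u₀ ∈ V, ∀ u₁ ∈ V, ∀ u ∈ V, u₀ ≤ u₁ → u₁ < u → G u₀ u ≤ G u₁ u) ∧
  (∀ u₀ ∈ V, ∀ u ∈ V, ∀ v ∈ V, u₀ < u → u ≤ v → G u₀ v ≤ G u₀ u)

/-- The bounds on the resistance functions, for `n` agents. -/
def BoundedResistances (n : ℕ) (V : Set ℝ) (F : ℝ → ℝ) (G : ℝ → ℝ → ℝ) : Prop :=
  ∃ F₀ G₀ : ℝ,
    (∀ u ∈ V, 0 ≤ F u ∧ F u ≤ F₀ / n) ∧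
    (∀ u₀ ∈ V, ∀ u ∈ V, u₀ < u → 0 ≤ G u₀ u ∧ G u₀ u < G₀) ∧
    F₀ + G₀ ≤ 1

/-! ### The states of the algorithm -/

/-- State of one agent with action set `α` and set of possible utilities `R`: a mood, together with
a benchmark action and a benchmark utility unless the agent is discontent. -/
inductive AgentState (α : Type*) (R : Set ℝ)
  | discontent : AgentState α R
  | content (a : α) (u : R) : AgentState α R
  | hopeful (a : α) (u : R) : AgentState α R
  | watchful (a : α) (u : R) : AgentState α R

namespace AgentState

variable {α : Type*} {R : Set ℝ}

noncomputable instance : DecidableEq (AgentState α R) := Classical.decEq _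

/-- Encoding of agent states, used only to see that there are finitely many of them. -/
def code : AgentState α R → Option (Fin 3 × α × R)
  | discontent => none
  | content a u => some (0, a, u)
  | hopeful a u => some (1, a, u)
  | watchful a u => some (2, a, u)

theorem code_injective : Function.Injective (code : AgentState α R → _) := by
  rintro (_ | ⟨a, u⟩ | ⟨a, u⟩ | ⟨a, u⟩) (_ | ⟨b, v⟩ | ⟨b, v⟩ | ⟨b, v⟩) h <;> simp_all [code]

instance [Finite α] [Finite R] : Finite (AgentState α R) :=
  Finite.of_injective code code_injective

noncomputable instance [Finite α] [Finite R] : Fintype (AgentState α R) := Fintype.ofFinite _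

/-- The law that gives `s` with probability `p` and `t` with probability `1 - p`. -/
noncomputable def mix (p : ℝ) (s t : AgentState α R) : AgentState α R → ℝ :=
  p • Pi.single s 1 + (1 - p) • Pi.single t 1

open Classical in
/-- Action policy: `actionProb ε s a` is the probability that an agent in state `s` plays `a`.
A content agent whose benchmark utility is below `1` explores an action other than its benchmark,
uniformly, with total probability `ε` (if it has another action at all). -/
noncomputable def actionProb [Fintype α] (ε : ℝ) : AgentState α R → α → ℝ
  | discontent, _ => 1 / (Fintype.card α : ℝ)
  | content a₀ u₀, a =>
      if (u₀ : ℝ) < 1 ∧ Nontrivial α then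
        if a = a₀ then 1 - ε else ε / ((Fintype.card α : ℝ) - 1)
      else if a = a₀ then 1 else 0
  | hopeful a₀ _, a => if a = a₀ then 1 else 0
  | watchful a₀ _, a => if a = a₀ then 1 else 0

open Classical in
/-- Update policy: the law of the next state of an agent in a given state that has played `a` and
observed `u`. Accepting leads to `content a u`, reverting to `content a₀ u₀`, rejecting to
`discontent`, where `a₀, u₀` is the benchmark of the present state. -/
noncomputable def updateLaw (F : ℝ → ℝ) (G : ℝ → ℝ → ℝ) (c : ℝ) (ε : ℝ) :
    AgentState α R → α → R → AgentState α R → ℝ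
  | discontent, a, u => mix (min (ε ^ F u) c) (content a u) discontent
  | content a₀ u₀, a, u =>
      if a ≠ a₀ then
        if (u₀ : ℝ) < u then mix (ε ^ G u₀ u) (content a u) (content a₀ u₀)
        else Pi.single (content a₀ u₀) 1
      else if (u₀ : ℝ) < u then Pi.single (hopeful a₀ u₀) 1
      else if u = u₀ then Pi.single (content a₀ u₀) 1
      else Pi.single (watchful a₀ u₀) 1
  | hopeful a₀ u₀, a, u =>
      if (u₀ : ℝ) < u then Pi.single (content a u) 1
      else if u = u₀ then Pi.single (content a₀ u₀) 1
      else Pi.single (watchful a₀ u₀) 1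
  | watchful a₀ u₀, _, u =>
      if (u₀ : ℝ) < u then Pi.single (hopeful a₀ u₀) 1
      else if u = u₀ then Pi.single (content a₀ u₀) 1
      else Pi.single discontent 1

end AgentState

section Dynamics

variable {I : Type*} {A : I → Type*}

/-- Joint states: one state per agent; benchmark utilities of agent `i` range over the values
of `U i`. -/
abbrev State (U : I → (∀ j, A j) → ℝ) : Type _ :=
  ∀ i, AgentState (A i) (Set.range (U i))

/-- Transition matrix of ITEL with perturbation `ε`: the agents independently choose actions,
observe the utilities of the resulting action profile, and independently update their states. -/
noncomputable def transition [Fintype I] [DecidableEq I] [∀ i, Fintype (A i)]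
    (U : I → (∀ j, A j) → ℝ) (F : ℝ → ℝ) (G : ℝ → ℝ → ℝ) (c : ℝ) (ε : ℝ) :
    Matrix (State U) (State U) ℝ :=
  fun x y => ∑ a : ∀ j, A j, ∏ i,
    ((x i).actionProb ε (a i) *
      (x i).updateLaw F G c ε (a i) ⟨U i a, Set.mem_range_self a⟩ (y i))

/-- The aligned state with benchmark action profile `a`: all agents are content and the benchmark
utilities are those resulting from `a`. -/
def alignedState (U : I → (∀ j, A j) → ℝ) (a : ∀ j, A j) : State U :=
  fun i => AgentState.content (a i) ⟨U i a, Set.mem_range_self a⟩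

/-- Equilibrium states: aligned states whose benchmark action profile is a Nash equilibrium. -/
def equilibriumStates [DecidableEq I] (U : I → (∀ j, A j) → ℝ) : Set (State U) :=
  {x | ∃ a, x = alignedState U a ∧ IsEquilibrium U a}

/-- Optimal states: aligned states in which all benchmark utilities are `1`. -/
def optimalStates (U : I → (∀ j, A j) → ℝ) : Set (State U) :=
  {x | ∃ a, x = alignedState U a ∧ ∀ i, U i a = 1}

end Dynamics

end ITEL

namespace ITEL

/-! ### Finite Markov chains -/

section Chain

variable {X : Type*} [Fintype X] [DecidableEq X] {P : Matrix X X ℝ}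

open Matrix

/-! Suppose first that there are at least two agents. The hub of the dynamics is the state `D` of
universal discontent. In an interdependent game discontent is contagious, so any state with a
discontent agent reaches `D` in a bounded number of steps with probability bounded below
(`exists_le_pow_allDiscontent`). From `D` the aligned state `x_a` is reached in one step with
probability at least of order `ε ^ Φ(a)`, where `Φ(a) = ∑ i, F (U i a)` is its `potential`.

Conversely, a single non-accepted exploration only perturbs `x_a` for a moment: the next undisturbed
step restores it (`basin`). A lasting exit has probability of order `ε ^ E(a)`, with `E = exitCost`.
If `a` is not an equilibrium, the cheapest exit is one exploration and one acceptance, so `E(a) = 1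
+ min G`. If `a` is a suboptimal equilibrium, two explorations are needed, so `E(a) = 2`. Optimal
states are never left.

If there is an optimal state, the optimal states are absorbing and accessible from everywhere, which
gives part 1. Otherwise there is a unique stationary law `π` for small `ε`, and the heart of the
proof is that `π(x_a)` is of order `ε ^ (-(E(a) - Φ(a))) * π(D)`, while the remaining states are
negligible. All these estimates exploit the balance `π(P f) = π(f)` for a well-chosen `f`: a bump
function at `x_a` gives the lower bound (`exists_le_stationary_aligned`); the flow through the
boundary of a set that is hard to enter gives the upper bounds (`exists_stationary_discontent_le`,
`exists_stationary_aligned_le`); a rank that decreases towards alignment disposes of the other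
states (`exists_stationary_rest_le`).

The stable states thus maximize `E - Φ`. On equilibria this is `1` plus the virtual welfare,
elsewhere it is `1` plus virtual welfare minus virtual stability. The bound `F₀ + G₀ ≤ 1` makes
every equilibrium beat every other profile, and makes `E - Φ` positive, which forces `π(D) → 0`.

With at most one agent interdependence says nothing; there equilibrium states are absorbing and
accessible, and the claims follow directly. -/

theorem mulVec_mono_of_rowStochastic (hP : P ∈ rowStochastic ℝ X) {u v : X → ℝ}
    (h : ∀ y, u y ≤ v y) (x : X) : (P *ᵥ u) x ≤ (P *ᵥ v) x :=
  Finset.sum_le_sum fun y _ =>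
    mul_le_mul_of_nonneg_left (h y) (nonneg_of_mem_rowStochastic hP)

theorem mulVec_const_of_rowStochastic (hP : P ∈ rowStochastic ℝ X) (b : ℝ) (x : X) :
    (P *ᵥ fun _ => b) x = b := by
  simp only [mulVec, dotProduct]
  rw [← Finset.sum_mul, sum_row_of_mem_rowStochastic hP, one_mul]

theorem mulVec_le_of_rowStochastic (hP : P ∈ rowStochastic ℝ X) {u : X → ℝ} {b : ℝ}
    (h : ∀ y, u y ≤ b) (x : X) : (P *ᵥ u) x ≤ b :=
  (mulVec_mono_of_rowStochastic hP h x).trans_eq (mulVec_const_of_rowStochastic hP b x)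

theorem le_mulVec_of_rowStochastic (hP : P ∈ rowStochastic ℝ X) {u : X → ℝ} {b : ℝ}
    (h : ∀ y, b ≤ u y) (x : X) : b ≤ (P *ᵥ u) x :=
  (mulVec_const_of_rowStochastic hP b x).symm.trans_le (mulVec_mono_of_rowStochastic hP h x)

/-- If the state `d` has probability at least `δ`, averages of `u ≤ b` stay away from `b`. -/
theorem mulVec_le_sub_of_rowStochastic (hP : P ∈ rowStochastic ℝ X) {u : X → ℝ} {b δ : ℝ} {d : X}
    (hd : ∀ y, δ ≤ P y d) (h : ∀ y, u y ≤ b) (x : X) :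
    (P *ᵥ u) x ≤ b - δ * (b - u d) := by
  have h1 : (P *ᵥ fun y => b - u y) x = b - (P *ᵥ u) x := by
    have := mulVec_const_of_rowStochastic hP b x
    simp only [mulVec, dotProduct] at this ⊢
    simp only [mul_sub, Finset.sum_sub_distrib, this]
  have h2 : P x d * (b - u d) ≤ (P *ᵥ fun y => b - u y) x :=
    Finset.single_le_sum (f := fun y => P x y * (b - u y))
      (fun y _ => mul_nonneg (nonneg_of_mem_rowStochastic hP) (sub_nonneg.2 (h y)))
      (Finset.mem_univ d)
  have h3 := mul_le_mul_of_nonneg_right (hd x) (sub_nonneg.2 (h d))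
  linarith

/-- Doeblin's argument: averaging shrinks the range of a function, and since every row of `P ^ K`
puts mass at least `δ` on the common state `d`, the oscillation shrinks by the factor `1 - δ` every
`K` steps. So the decreasing maxima and the increasing minima have the same limit. -/
theorem exists_tendsto_pow_mulVec (hP : P ∈ rowStochastic ℝ X) {K : ℕ} {d : X} {δ : ℝ}
    (hδ : 0 < δ) (hd : ∀ y, δ ≤ (P ^ K) y d) (v : X → ℝ) :
    ∃ L, ∀ x, Tendsto (fun k => (P ^ k *ᵥ v) x) atTop (𝓝 L) := by
  have : Nonempty X := ⟨d⟩
  set a : ℕ → X → ℝ := fun k => P ^ k *ᵥ v with ha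
  have hsucc : ∀ k, a (k + 1) = P *ᵥ a k := fun k => by
    simp only [ha, pow_succ', mulVec_mulVec]
  have hadd : ∀ k, a (K + k) = P ^ K *ᵥ a k := fun k => by
    simp only [ha, pow_add, mulVec_mulVec]
  have hle : ∀ k x, a k x ≤ ⨆ y, a k y := fun k x => le_ciSup (Set.finite_range _).bddAbove x
  have hge : ∀ k x, ⨅ y, a k y ≤ a k x := fun k x => ciInf_le (Set.finite_range _).bddBelow x
  have hanti : Antitone fun k => ⨆ y, a k y := antitone_nat_of_succ_le fun k =>
    ciSup_le fun x => by rw [hsucc]; exact mulVec_le_of_rowStochastic hP (hle k) x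
  have hmono : Monotone fun k => ⨅ y, a k y := monotone_nat_of_le_succ fun k =>
    le_ciInf fun x => by rw [hsucc]; exact le_mulVec_of_rowStochastic hP (hge k) x
  have hPK := pow_mem hP K
  have hcontr : ∀ k, (⨆ y, a (K + k) y) - (⨅ y, a (K + k) y) ≤
      (1 - δ) * ((⨆ y, a k y) - ⨅ y, a k y) := fun k => by
    have h1 : ⨆ y, a (K + k) y ≤ (⨆ y, a k y) - δ * ((⨆ y, a k y) - a k d) :=
      ciSup_le fun x => by
        rw [hadd]; exact mulVec_le_sub_of_rowStochastic hPK hd (hle k) x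
    have h2 : (⨅ y, a k y) + δ * (a k d - ⨅ y, a k y) ≤ ⨅ y, a (K + k) y :=
      le_ciInf fun x => by
        rw [hadd]
        have := mulVec_le_sub_of_rowStochastic hPK hd (u := -a k) (b := -⨅ y, a k y)
          (fun y => neg_le_neg (hge k y)) x
        rw [mulVec_neg] at this
        simp only [Pi.neg_apply] at this
        linarith
    linarith
  have hbA : BddBelow (Set.range fun k => ⨆ y, a k y) :=
    ⟨⨅ y, a 0 y, by
      rintro _ ⟨k, rfl⟩
      exact (hmono (Nat.zero_le k)).trans ((hge k d).trans (hle k d))⟩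
  have hbB : BddAbove (Set.range fun k => ⨅ y, a k y) :=
    ⟨⨆ y, a 0 y, by
      rintro _ ⟨k, rfl⟩
      exact ((hge k d).trans (hle k d)).trans (hanti (Nat.zero_le k))⟩
  have hA := tendsto_atTop_ciInf hanti hbA
  have hB := tendsto_atTop_ciSup hmono hbB
  set A := ⨅ k, ⨆ y, a k y
  set B := ⨆ k, ⨅ y, a k y
  have hshift : Tendsto (fun k => K + k) atTop atTop :=
    tendsto_atTop_mono (fun k => Nat.le_add_left k K) tendsto_id
  have h1 : A - B ≤ (1 - δ) * (A - B) :=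
    le_of_tendsto_of_tendsto' ((hA.sub hB).comp hshift) ((hA.sub hB).const_mul _) hcontr
  have h2 : B ≤ A := le_of_tendsto_of_tendsto' hB hA fun k => (hge k d).trans (hle k d)
  have h3 : A = B := by nlinarith
  rw [← h3] at hB
  exact ⟨A, fun x => tendsto_of_tendsto_of_tendsto_of_le_of_le hB hA
    (fun k => hge k x) (fun k => hle k x)⟩

/-- A finite Markov chain that reaches some state from everywhere within a common number of steps
converges in law to a stationary law. -/
theorem exists_stationary (hP : P ∈ rowStochastic ℝ X) {K : ℕ} {d : X} {δ : ℝ}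
    (hδ : 0 < δ) (hd : ∀ y, δ ≤ (P ^ K) y d) :
    ∃ π ∈ stdSimplex ℝ X, π ᵥ* P = π ∧ ∀ μ ∈ stdSimplex ℝ X, ∀ S : Set X,
      Tendsto (fun k => probAt μ P k S) atTop (𝓝 (∑ x, S.indicator π x)) := by
  choose π hπ using fun y : X => exists_tendsto_pow_mulVec hP hδ hd (Pi.single y 1)
  simp only [mulVec_single_one] at hπ
  have hπ : ∀ y x, Tendsto (fun k => (P ^ k) x y) atTop (𝓝 (π y)) := hπ
  refine ⟨π, ⟨fun y => ?_, ?_⟩, ?_, ?_⟩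
  · exact ge_of_tendsto' (hπ y d) fun k => nonneg_of_mem_rowStochastic (pow_mem hP k)
  · refine tendsto_nhds_unique (tendsto_finsetSum _ fun y _ => hπ y d) ?_
    simp only [sum_row_of_mem_rowStochastic (pow_mem hP _)]
    exact tendsto_const_nhds
  · funext y
    refine tendsto_nhds_unique ?_ ((hπ y d).comp (tendsto_add_atTop_nat 1))
    have : (fun k => (P ^ k) d y) ∘ (fun k => k + 1) = fun k => ∑ z, (P ^ k) d z * P z y := by
      funext k
      simp [pow_succ, mul_apply]
    rw [this]
    exact tendsto_finsetSum _ fun z _ => (hπ z d).mul_const _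
  · intro μ hμ S
    refine tendsto_finsetSum _ fun x _ => ?_
    by_cases hx : x ∈ S
    · simp only [Set.indicator_of_mem hx]
      have : π x = ∑ z, μ z * π x := by rw [← Finset.sum_mul, hμ.2, one_mul]
      rw [this]
      exact tendsto_finsetSum _ fun z _ => (hπ x z).const_mul _
    · simp only [Set.indicator_of_notMem hx]
      exact tendsto_const_nhds

theorem probAt_eq_sum_mul (μ : X → ℝ) (P : Matrix X X ℝ) (k : ℕ) (S : Set X) :
    probAt μ P k S = ∑ x, μ x * (P ^ k *ᵥ S.indicator 1) x := by
  have h : probAt μ P k S = (μ ᵥ* P ^ k) ⬝ᵥ S.indicator 1 := by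
    refine Finset.sum_congr rfl fun x _ => ?_
    by_cases hx : x ∈ S <;> simp [hx]
  rw [h, ← dotProduct_mulVec]; rfl

/-- A chain from which a set of absorbing states is accessible ends up in that set. -/
theorem tendsto_probAt_absorbing (hP : P ∈ rowStochastic ℝ X) {S : Set X}
    (hS : ∀ x ∈ S, P x x = 1) (hacc : ∀ y, ∃ k, ∃ x ∈ S, 0 < (P ^ k) y x)
    {μ : X → ℝ} (hμ : μ ∈ stdSimplex ℝ X) :
    Tendsto (fun k => probAt μ P k S) atTop (𝓝 1) := by
  set v : X → ℝ := S.indicator 1 with hv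
  have hv0 : ∀ x, 0 ≤ v x := fun x => Set.indicator_nonneg (fun _ _ => zero_le_one) x
  have hv1 : ∀ x, v x ≤ 1 := fun x => Set.indicator_le' (fun _ _ => le_rfl)
    (fun _ _ => zero_le_one) x
  have hPv : ∀ x, v x ≤ (P *ᵥ v) x := fun x => by
    by_cases hx : x ∈ S
    · have : P x x * v x ≤ (P *ᵥ v) x := Finset.single_le_sum (f := fun y => P x y * v y)
        (fun y _ => mul_nonneg (nonneg_of_mem_rowStochastic hP) (hv0 y)) (Finset.mem_univ x)
      rwa [hS x hx, one_mul] at this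
    · rw [hv, Set.indicator_of_notMem hx]
      exact le_mulVec_of_rowStochastic hP hv0 x
  -- Since `S` is absorbing, the probability of being in `S` at time `k` increases with `k`; its
  -- limit `h` is harmonic and equals `1` on `S`.
  have hmono : ∀ x, Monotone fun k => (P ^ k *ᵥ v) x := fun x =>
    monotone_nat_of_le_succ fun k => by
      rw [pow_succ, ← mulVec_mulVec]
      exact mulVec_mono_of_rowStochastic (pow_mem hP k) hPv x
  have hle1 : ∀ k x, (P ^ k *ᵥ v) x ≤ 1 := fun k x =>
    mulVec_le_of_rowStochastic (pow_mem hP k) hv1 x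
  have hlim : ∀ x, ∃ l, Tendsto (fun k => (P ^ k *ᵥ v) x) atTop (𝓝 l) := fun x =>
    ⟨_, tendsto_atTop_ciSup (hmono x) ⟨1, by rintro _ ⟨k, rfl⟩; exact hle1 k x⟩⟩
  choose h hh using hlim
  have hharm : ∀ j x, (P ^ j *ᵥ h) x = h x := fun j x => by
    refine tendsto_nhds_unique ?_ ((hh x).comp
      (tendsto_atTop_mono (fun k => Nat.le_add_left k j) tendsto_id))
    have : (fun k => (P ^ k *ᵥ v) x) ∘ (fun k => j + k) =
        fun k => ∑ z, (P ^ j) x z * (P ^ k *ᵥ v) z := by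
      funext k
      simp only [Function.comp, pow_add, ← mulVec_mulVec]
      rfl
    rw [this]
    exact tendsto_finsetSum _ fun z _ => (hh z).const_mul _
  have hhS : ∀ x ∈ S, h x = 1 := fun x hx => by
    refine le_antisymm (le_of_tendsto' (hh x) fun k => hle1 k x) ?_
    have := ge_of_tendsto' (hh x) fun k => hmono x (Nat.zero_le k)
    simpa [hv, hx] using this
  have hh1 : ∀ x, h x ≤ 1 := fun x => le_of_tendsto' (hh x) fun k => hle1 k x
  -- Minimum principle: at a minimizer `y`, harmonicity forces every accessible state to have the
  -- same value of `h`, and one of them lies in `S`.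
  have hone : ∀ x, h x = 1 := fun x => by
    have : Nonempty X := ⟨x⟩
    obtain ⟨y, hy⟩ := Finite.exists_min h
    obtain ⟨k, z, hz, hpos⟩ := hacc y
    have hsum : (P ^ k) y z * (h z - h y) ≤ ∑ w, (P ^ k) y w * (h w - h y) :=
      Finset.single_le_sum (f := fun w => (P ^ k) y w * (h w - h y))
        (fun w _ => mul_nonneg (nonneg_of_mem_rowStochastic (pow_mem hP k))
          (sub_nonneg.2 (hy w))) (Finset.mem_univ z)
    have hzero : ∑ w, (P ^ k) y w * (h w - h y) = 0 := by
      simp only [mul_sub, Finset.sum_sub_distrib]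
      rw [← Finset.sum_mul, sum_row_of_mem_rowStochastic (pow_mem hP k), one_mul, sub_eq_zero]
      exact hharm k y
    rw [hzero, hhS z hz] at hsum
    have : 1 - h y ≤ 0 := by
      by_contra hc
      exact absurd hsum (not_le.2 (mul_pos hpos (not_le.1 hc)))
    exact le_antisymm (hh1 x) (by linarith [hy x])
  simp only [probAt_eq_sum_mul]
  have : (1 : ℝ) = ∑ x, μ x * h x := by simp [hone, hμ.2]
  rw [this]
  exact tendsto_finsetSum _ fun x _ => (hh x).const_mul _

theorem pow_apply_pos_of_reflTransGen (hP : P ∈ rowStochastic ℝ X) {x y : X}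
    (h : Relation.ReflTransGen (fun x y => 0 < P x y) x y) : ∃ k, 0 < (P ^ k) x y := by
  induction h with
  | refl => exact ⟨0, by simp⟩
  | @tail y z _ hyz ih =>
    obtain ⟨k, hk⟩ := ih
    refine ⟨k + 1, ?_⟩
    rw [pow_succ, mul_apply]
    exact (mul_pos hk hyz).trans_le (Finset.single_le_sum (f := fun w => (P ^ k) x w * P w z)
      (fun w _ => mul_nonneg (nonneg_of_mem_rowStochastic (pow_mem hP k))
        (nonneg_of_mem_rowStochastic hP)) (Finset.mem_univ y))

theorem mul_le_pow_succ_apply (hP : P ∈ rowStochastic ℝ X) (k : ℕ) (x y z : X) :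
    P x y * (P ^ k) y z ≤ (P ^ (k + 1)) x z := by
  rw [pow_succ', mul_apply]
  exact Finset.single_le_sum (f := fun w => P x w * (P ^ k) w z)
      (fun w _ => mul_nonneg (nonneg_of_mem_rowStochastic hP)
        (nonneg_of_mem_rowStochastic (pow_mem hP k))) (Finset.mem_univ y)

/-! ### Stationary flows -/

/-- The stationary flow from `E` to `E'`. -/
noncomputable def flow (π : X → ℝ) (P : Matrix X X ℝ) (E E' : Set X) : ℝ :=
  ∑ y, E.indicator π y * (P *ᵥ E'.indicator 1) y

/-- The balance equation tested against `f`. Every estimate of a stationary weight below comes from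
a suitable choice of `f`. -/
theorem sum_mul_mulVec_of_stationary {X : Type*} [Fintype X] {P : Matrix X X ℝ} {π : X → ℝ}
    (hπ : π ᵥ* P = π) (f : X → ℝ) :
    ∑ y, π y * (P *ᵥ f) y = ∑ y, π y * f y := by
  change π ⬝ᵥ (P *ᵥ f) = π ⬝ᵥ f
  rw [dotProduct_mulVec, hπ]

theorem vecMul_pow_of_stationary {π : X → ℝ} (hπ : π ᵥ* P = π) (k : ℕ) : π ᵥ* P ^ k = π := by
  induction k with
  | zero => simp
  | succ k ih => rw [pow_succ, ← vecMul_vecMul, ih, hπ]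

/-- Balance tested against the indicator of `E`: in the stationary regime as much mass enters `E` as
leaves it. -/
theorem flow_compl (hP : P ∈ rowStochastic ℝ X) {π : X → ℝ} (hπ : π ᵥ* P = π) (E : Set X) :
    flow π P E Eᶜ = flow π P Eᶜ E := by
  have h1 : ∀ y, (P *ᵥ Eᶜ.indicator 1) y = 1 - (P *ᵥ E.indicator 1) y := fun y => by
    have := mulVec_const_of_rowStochastic hP 1 y
    have hc : (Eᶜ.indicator 1 : X → ℝ) = (fun _ => 1) - E.indicator 1 := by
      rw [Set.indicator_compl]; rfl
    rw [hc, mulVec_sub, Pi.sub_apply, this]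
  have h2 := sum_mul_mulVec_of_stationary hπ (E.indicator 1)
  have h3 : ∑ y, π y * E.indicator 1 y = ∑ y, E.indicator π y :=
    Finset.sum_congr rfl fun y _ => by by_cases hy : y ∈ E <;> simp [hy]
  simp only [flow, h1]
  simp only [Set.indicator_compl, Pi.sub_apply, mul_sub, sub_mul,
    Finset.sum_sub_distrib, mul_one]
  rw [h2, h3]

/-- Union bound over time: a path from `E` that is outside `E` at time `k` has crossed the boundary
at some step, and by stationarity each step contributes at most the one-step flow. -/
theorem flow_pow_le (hP : P ∈ rowStochastic ℝ X) {π : X → ℝ} (hπ0 : ∀ x, 0 ≤ π x)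
    (hπ : π ᵥ* P = π) (E : Set X) (k : ℕ) :
    flow π (P ^ k) E Eᶜ ≤ k * flow π P E Eᶜ := by
  induction k with
  | zero =>
    simp only [flow, pow_zero, one_mulVec, CharP.cast_eq_zero, zero_mul]
    refine (Finset.sum_eq_zero fun y _ => ?_).le
    by_cases hy : y ∈ E <;> simp [hy]
  | succ k ih =>
    set g : X → ℝ := P *ᵥ Eᶜ.indicator 1 with hg
    have hi0 : ∀ y, 0 ≤ (Eᶜ.indicator 1 : X → ℝ) y :=
      Set.indicator_nonneg fun _ _ => zero_le_one
    have hg0 : ∀ y, 0 ≤ g y := le_mulVec_of_rowStochastic hP hi0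
    have hg1 : ∀ y, g y ≤ 1 := mulVec_le_of_rowStochastic hP
      (Set.indicator_le' (fun _ _ => le_rfl) fun _ _ => zero_le_one)
    -- At time `k` the path is either still in `E` and jumps out at the last step, or already
    -- outside.
    have hle : ∀ y, (P ^ k *ᵥ g) y ≤
        (P ^ k *ᵥ E.indicator g) y + (P ^ k *ᵥ Eᶜ.indicator 1) y := fun y => by
      rw [← Pi.add_apply, ← mulVec_add]
      refine mulVec_mono_of_rowStochastic (pow_mem hP k) (fun z => ?_) y
      by_cases hz : z ∈ E
      · simp [hz]
      · simpa [hz] using hg1 z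
    have hin : ∀ y, E.indicator π y ≤ π y := Set.indicator_le_self' fun y _ => hπ0 y
    have hin0 : ∀ y, 0 ≤ E.indicator π y := Set.indicator_nonneg fun y _ => hπ0 y
    have h1 : flow π (P ^ (k + 1)) E Eᶜ ≤
        ∑ y, E.indicator π y * (P ^ k *ᵥ E.indicator g) y + flow π (P ^ k) E Eᶜ := by
      rw [flow, flow, ← Finset.sum_add_distrib]
      refine Finset.sum_le_sum fun y _ => ?_
      rw [pow_succ, ← mulVec_mulVec, ← mul_add]
      exact mul_le_mul_of_nonneg_left (hle y) (hin0 y)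
    have h2 : ∑ y, E.indicator π y * (P ^ k *ᵥ E.indicator g) y ≤ flow π P E Eᶜ := by
      calc _ ≤ ∑ y, π y * (P ^ k *ᵥ E.indicator g) y :=
            Finset.sum_le_sum fun y _ => mul_le_mul_of_nonneg_right (hin y)
              (le_mulVec_of_rowStochastic (pow_mem hP k)
                (Set.indicator_nonneg fun y _ => hg0 y) y)
        _ = ∑ y, π y * E.indicator g y :=
            sum_mul_mulVec_of_stationary (vecMul_pow_of_stationary hπ k) _
        _ = _ := Finset.sum_congr rfl fun y _ => by by_cases hy : y ∈ E <;> simp [hy, hg]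
    push_cast
    linarith

/-- A stationary weight in `E` is controlled by the flow into `E`. -/
theorem mul_pow_apply_le_flow (hP : P ∈ rowStochastic ℝ X) {π : X → ℝ} (hπ0 : ∀ x, 0 ≤ π x)
    (hπ : π ᵥ* P = π) {E : Set X} {x z : X} (hx : x ∈ E) (hz : z ∉ E) (k : ℕ) :
    π x * (P ^ k) x z ≤ k * flow π P Eᶜ E := by
  rw [← flow_compl hP hπ]
  refine le_trans ?_ (flow_pow_le hP hπ0 hπ E k)
  have hi0 : ∀ y, 0 ≤ (Eᶜ.indicator 1 : X → ℝ) y := Set.indicator_nonneg fun _ _ => zero_le_one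
  have h1 : (P ^ k) x z ≤ (P ^ k *ᵥ Eᶜ.indicator 1) x := by
    have := Finset.single_le_sum (f := fun y => (P ^ k) x y * (Eᶜ.indicator 1 : X → ℝ) y)
      (fun y _ => mul_nonneg (nonneg_of_mem_rowStochastic (pow_mem hP k)) (hi0 y))
      (Finset.mem_univ z)
    rwa [Set.indicator_of_mem (Set.mem_compl hz), Pi.one_apply, mul_one] at this
  calc π x * (P ^ k) x z ≤ E.indicator π x * (P ^ k *ᵥ Eᶜ.indicator 1) x := by
        rw [Set.indicator_of_mem hx]; exact mul_le_mul_of_nonneg_left h1 (hπ0 x)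
    _ ≤ _ := Finset.single_le_sum
        (f := fun y => E.indicator π y * (P ^ k *ᵥ Eᶜ.indicator 1) y)
        (fun y _ => mul_nonneg (Set.indicator_nonneg (fun y _ => hπ0 y) y)
          (le_mulVec_of_rowStochastic (pow_mem hP k) hi0 y)) (Finset.mem_univ x)

end Chain

section Chain

variable {X : Type*} [Fintype X] [DecidableEq X]

open Matrix

/-! ### Almost sure absorption -/

section Absorption

variable {Ω : Type*} [MeasurableSpace Ω] {ℙ : Measure Ω} [IsProbabilityMeasure ℙ]
  {P : Matrix X X ℝ} {Y : ℕ → Ω → X}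

theorem sum_measureReal_inter_fiber {Q Ω : Type*} [Fintype Q] [MeasurableSpace Ω] {ℙ : Measure Ω}
    [IsFiniteMeasure ℙ] {Z : Ω → Q} (hZ : ∀ q, MeasurableSet {ω | Z ω = q}) (B : Set Ω) :
    ∑ q, ℙ.real (B ∩ {ω | Z ω = q}) = ℙ.real B := by
  classical
  let _ : MeasurableSpace Q := ⊤
  have hm : Measurable Z := measurable_to_countable' hZ
  have h := sum_measureReal_preimage_singleton (μ := ℙ.restrict B) (f := Z) Finset.univ
    (fun q _ => hm (measurableSet_singleton q))
  simp only [Finset.coe_univ, Set.preimage_univ, measureReal_restrict_apply MeasurableSet.univ,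
    Set.univ_inter] at h
  rw [← h]
  refine Finset.sum_congr rfl fun q _ => ?_
  rw [measureReal_restrict_apply (hm (measurableSet_singleton q)), Set.inter_comm]
  rfl

/-- The hypothesis only gives the laws of complete paths, so both events are split according to the
past before time `n`. -/
theorem IsMarkovChain.measureReal_step {X : Type*} [Fintype X] {P : Matrix X X ℝ}
    {Y : ℕ → Ω → X} (h : IsMarkovChain P ℙ Y) (n : ℕ) (x y : X) :
    ℙ.real {ω | Y n ω = x ∧ Y (n + 1) ω = y} = ℙ.real {ω | Y n ω = x} * P x y := by
  have hZ : ∀ q : Fin n → X, MeasurableSet {ω | (fun k : Fin n => Y k ω) = q} := fun q => by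
    simp only [funext_iff, Set.ofPred_forall]
    exact MeasurableSet.iInter fun k => h.1 k (q k)
  rw [← sum_measureReal_inter_fiber hZ {ω | Y n ω = x},
    ← sum_measureReal_inter_fiber hZ {ω | Y n ω = x ∧ Y (n + 1) ω = y}, Finset.sum_mul]
  refine Finset.sum_congr rfl fun q _ => ?_
  -- The path with past `q`, then `x`, then `y`; its values after time `n + 1` do not matter.
  let p : ℕ → X := fun k => if hk : k < n then q ⟨k, hk⟩ else if k = n then x else y
  have hpn : p n = x := by simp [p]
  have hpn1 : p (n + 1) = y := by simp [p]
  have hpk : ∀ k : Fin n, p k = q k := fun k => by simp [p]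
  have h1 : {ω | Y n ω = x} ∩ {ω | (fun k : Fin n => Y k ω) = q} =
      {ω | ∀ k ≤ n, Y k ω = p k} := by
    ext ω
    simp only [Set.mem_inter_iff, Set.mem_ofPred_eq, funext_iff]
    constructor
    · rintro ⟨hx, hq⟩ k hk
      rcases hk.lt_or_eq with hk | rfl
      · exact (hq ⟨k, hk⟩).trans (hpk ⟨k, hk⟩).symm
      · exact hx.trans hpn.symm
    · intro hk
      exact ⟨(hk n le_rfl).trans hpn, fun k => (hk k k.2.le).trans (hpk k)⟩
  have h2 : {ω | Y n ω = x ∧ Y (n + 1) ω = y} ∩ {ω | (fun k : Fin n => Y k ω) = q} =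
      {ω | ∀ k ≤ n + 1, Y k ω = p k} := by
    ext ω
    have := Set.ext_iff.1 h1 ω
    simp only [Set.mem_inter_iff, Set.mem_ofPred_eq] at this ⊢
    constructor
    · rintro ⟨⟨hx, hy⟩, hq⟩ k hk
      rcases hk.lt_or_eq with hk | rfl
      · exact this.1 ⟨hx, hq⟩ k (Nat.lt_succ_iff.1 hk)
      · exact hy.trans hpn1.symm
    · intro hk
      have h3 := this.2 fun k hk' => hk k (hk'.trans n.le_succ)
      exact ⟨⟨h3.1, (hk _ le_rfl).trans hpn1⟩, h3.2⟩
  rw [h1, h2, h.2, h.2, Finset.prod_range_succ, hpn, hpn1, mul_assoc]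

theorem IsMarkovChain.measureReal_eq (h : IsMarkovChain P ℙ Y) (n : ℕ) (y : X) :
    ℙ.real {ω | Y n ω = y} = ((fun x => ℙ.real {ω | Y 0 ω = x}) ᵥ* P ^ n) y := by
  induction n generalizing y with
  | zero => simp
  | succ n ih =>
    rw [pow_succ, ← vecMul_vecMul, ← sum_measureReal_inter_fiber (fun q => h.1 n q)
      {ω | Y (n + 1) ω = y}]
    simp only [vecMul, dotProduct] at ih ⊢
    refine Finset.sum_congr rfl fun x _ => ?_
    rw [← ih, ← h.measureReal_step, Set.inter_comm]
    rfl

/-- The probability of never visiting `S` is at most that of being outside `S` at time `k`, which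
tends to `0`; and almost surely no absorbing state is ever left. -/
theorem IsMarkovChain.ae_eventually_eq (hP : P ∈ rowStochastic ℝ X) {S : Set X}
    (hS : ∀ x ∈ S, P x x = 1) (hacc : ∀ y, ∃ k, ∃ x ∈ S, 0 < (P ^ k) y x)
    (h : IsMarkovChain P ℙ Y) : ∀ᵐ ω ∂ℙ, ∃ x ∈ S, ∀ᶠ k in atTop, Y k ω = x := by
  classical
  set μ : X → ℝ := fun x => ℙ.real {ω | Y 0 ω = x} with hμdef
  have hμ : μ ∈ stdSimplex ℝ X := by
    refine ⟨fun x => measureReal_nonneg, ?_⟩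
    have := sum_measureReal_inter_fiber (fun q => h.1 0 q) (ℙ := ℙ) Set.univ
    simpa using this
  have hprob : ∀ k, probAt μ P k S = ℙ.real {ω | Y k ω ∈ S} := fun k => by
    rw [← sum_measureReal_inter_fiber (fun q => h.1 k q) {ω | Y k ω ∈ S}, probAt]
    refine Finset.sum_congr rfl fun x _ => ?_
    by_cases hx : x ∈ S
    · rw [Set.indicator_of_mem hx, ← h.measureReal_eq]
      congr 1
      ext ω
      simp only [Set.mem_ofPred_eq, Set.mem_inter_iff]
      exact ⟨fun e => ⟨e ▸ hx, e⟩, fun e => e.2⟩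
    · rw [Set.indicator_of_notMem hx]
      have : {ω | Y k ω ∈ S} ∩ {ω | Y k ω = x} = ∅ := by
        ext ω
        simp only [Set.mem_ofPred_eq, Set.mem_inter_iff, Set.mem_empty_iff_false, iff_false]
        rintro ⟨h1, h2⟩
        exact hx (h2 ▸ h1)
      rw [this, measureReal_empty]
  have hmeas : ∀ k, MeasurableSet {ω | Y k ω ∈ S} := fun k => by
    have : {ω | Y k ω ∈ S} = ⋃ x ∈ S, {ω | Y k ω = x} := by ext ω; simp
    rw [this]
    exact S.toFinite.measurableSet_biUnion fun x _ => h.1 k x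
  have hnever : ∀ᵐ ω ∂ℙ, ∃ k, Y k ω ∈ S := by
    have hle : ∀ k, ℙ.real {ω | ¬ ∃ k, Y k ω ∈ S} ≤ 1 - probAt μ P k S := fun k => by
      rw [hprob, ← probReal_compl_eq_one_sub (hmeas k)]
      refine measureReal_mono fun ω hω => ?_
      exact fun hk => hω ⟨k, hk⟩
    have hlim := (tendsto_probAt_absorbing hP hS hacc hμ).const_sub 1
    have h0 := ge_of_tendsto' hlim hle
    rw [sub_self] at h0
    rw [ae_iff, ← measureReal_eq_zero_iff]
    exact le_antisymm h0 measureReal_nonneg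
  have hstay : ∀ᵐ ω ∂ℙ, ∀ k, ∀ x ∈ S, Y k ω = x → Y (k + 1) ω = x := by
    refine ae_all_iff.2 fun k => (ae_ball_iff S.to_countable).2 fun x hx => ?_
    have hy : ∀ y, y ≠ x → ∀ᵐ ω ∂ℙ, ¬ (Y k ω = x ∧ Y (k + 1) ω = y) := fun y hyx => by
      rw [ae_iff, ← measureReal_eq_zero_iff]
      simp only [not_not]
      rw [h.measureReal_step]
      have hsum := sum_row_of_mem_rowStochastic hP x
      have h2 := Finset.add_le_sum (s := Finset.univ) (f := P x)
        (fun z _ => nonneg_of_mem_rowStochastic hP) (Finset.mem_univ y) (Finset.mem_univ x) hyx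
      rw [hsum, hS x hx] at h2
      have h3 : P x y = 0 := le_antisymm (by linarith) (nonneg_of_mem_rowStochastic hP)
      rw [h3, mul_zero]
    have hall : ∀ᵐ ω ∂ℙ, ∀ y, y ≠ x → ¬ (Y k ω = x ∧ Y (k + 1) ω = y) :=
      ae_all_iff.2 fun y => by
        by_cases hyx : y = x
        · exact Eventually.of_forall fun ω hne => absurd hyx hne
        · filter_upwards [hy y hyx] with ω hω _ using hω
    filter_upwards [hall] with ω hω hk
    by_contra hne
    exact hω _ hne ⟨hk, rfl⟩
  filter_upwards [hnever, hstay] with ω h1 h2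
  obtain ⟨k, hk⟩ := h1
  refine ⟨Y k ω, hk, eventually_atTop.2 ⟨k, fun m hm => ?_⟩⟩
  induction m, hm using Nat.le_induction with
  | base => rfl
  | succ m _ ih => exact h2 m _ hk ih

end Absorption

/-! ### Stochastic stability -/

/-- Accessible absorbing states are the stochastically stable states. -/
theorem isStochasticallyStableSet_of_absorbing {P : ℝ → Matrix X X ℝ} {S : Set X}
    (hP : ∀ ε ∈ Set.Ioo (0 : ℝ) 1, P ε ∈ rowStochastic ℝ X)
    (hS : ∀ ε ∈ Set.Ioo (0 : ℝ) 1, ∀ x ∈ S, P ε x x = 1)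
    (hacc : ∀ ε ∈ Set.Ioo (0 : ℝ) 1, ∀ y, ∃ k, ∃ x ∈ S, 0 < (P ε ^ k) y x) :
    IsStochasticallyStableSet P S := by
  have hev : ∀ᶠ ε in 𝓝[>] (0 : ℝ), ε ∈ Set.Ioo (0 : ℝ) 1 := Ioo_mem_nhdsGT zero_lt_one
  constructor
  · intro μ hμ
    refine tendsto_const_nhds.congr' ?_
    filter_upwards [hev] with ε hε
    exact (tendsto_probAt_absorbing (hP ε hε) (hS ε hε) (hacc ε hε) (hμ ε)).liminf_eq.symm
  · intro T hT x hx
    by_contra hxT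
    -- For minimality, start the chain at `x`: it never moves, so a capturing set must contain `x`.
    have hμ : (Pi.single x 1 : X → ℝ) ∈ stdSimplex ℝ X := single_mem_stdSimplex ℝ x
    have h1 := hT (fun _ => Pi.single x 1) fun _ => hμ
    have h2 : ∀ᶠ ε in 𝓝[>] (0 : ℝ),
        liminf (fun k : ℕ => probAt (Pi.single x 1) (P ε) k T) atTop = 0 := by
      filter_upwards [hev] with ε hε
      have hle : ∀ k, probAt (Pi.single x 1) (P ε) k T = 0 := fun k => by
        have hrow : ∀ y, y ≠ x → (P ε ^ k) x y = 0 := by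
          induction k with
          | zero => intro y hy; simp [one_apply, hy.symm]
          | succ k ih =>
            intro y hy
            rw [pow_succ, mul_apply]
            refine Finset.sum_eq_zero fun z _ => ?_
            by_cases hz : z = x
            · have h2 := Finset.add_le_sum (s := Finset.univ) (f := P ε x)
                (fun z _ => nonneg_of_mem_rowStochastic (hP ε hε)) (Finset.mem_univ y)
                (Finset.mem_univ x) hy
              rw [sum_row_of_mem_rowStochastic (hP ε hε), hS ε hε x hx] at h2
              have h3 : P ε x y = 0 :=
                le_antisymm (by linarith) (nonneg_of_mem_rowStochastic (hP ε hε))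
              rw [hz, h3, mul_zero]
            · rw [ih z hz, zero_mul]
        refine Finset.sum_eq_zero fun y _ => ?_
        by_cases hy : y ∈ T
        · rw [Set.indicator_of_mem hy, single_one_vecMul]
          exact hrow y fun e => hxT (e ▸ hy)
        · rw [Set.indicator_of_notMem hy]
      simp only [hle]
      exact tendsto_const_nhds.liminf_eq
    have h3 := (tendsto_congr' h2).1 h1
    exact zero_ne_one (tendsto_nhds_unique tendsto_const_nhds h3)

/-- If the stationary weights of the states `al a` are of order `ε ^ (- w a)` relative to some
reference weight, and the other states are negligible, then the stochastically stable states are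
those that maximize `w`. -/
theorem isStochasticallyStableSet_of_weights {Q : Type*} [Finite Q] [Nonempty Q]
    {P : ℝ → Matrix X X ℝ} {al : Q → X} {w : Q → ℝ} (hw : ∀ a, 0 < w a) {r : ℝ}
    (hr : 0 < r) {π : ℝ → X → ℝ} {p : ℝ → ℝ}
    (hπ : ∀ ε ∈ Set.Ioc 0 r, π ε ∈ stdSimplex ℝ X ∧ π ε ᵥ* P ε = π ε ∧
      ∀ μ ∈ stdSimplex ℝ X, ∀ S : Set X,
        Tendsto (fun k => probAt μ (P ε) k S) atTop (𝓝 (∑ x, S.indicator (π ε) x)))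
    (hp : ∀ ε ∈ Set.Ioc 0 r, 0 ≤ p ε) {c C : ℝ} (hc : 0 < c)
    (hlo : ∀ ε ∈ Set.Ioc 0 r, ∀ a, c * p ε ≤ ε ^ w a * π ε (al a))
    (hhi : ∀ ε ∈ Set.Ioc 0 r, ∀ a, ε ^ w a * π ε (al a) ≤ C * p ε)
    (hrest : ∀ ε ∈ Set.Ioc 0 r, ∀ x ∉ Set.range al, π ε x ≤ C * (ε + p ε)) :
    IsStochasticallyStableSet P {x | ∃ a, x = al a ∧ ∀ b, w b ≤ w a} := by
  have hC : ∀ ε ∈ Set.Ioc 0 r, ∀ b a, π ε (al b) ≤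
      max C 0 / c * ε ^ (w a - w b) * π ε (al a) := by
    intro ε hε b a
    have h1 := hhi ε hε b
    have h2 := hlo ε hε a
    have hb := Real.rpow_pos_of_pos hε.1 (w b)
    rw [Real.rpow_sub hε.1, ← mul_le_mul_iff_right₀ hb]
    calc ε ^ w b * π ε (al b) ≤ max C 0 * p ε :=
          h1.trans (mul_le_mul_of_nonneg_right (le_max_left _ _) (hp ε hε))
      _ ≤ max C 0 * (ε ^ w a * π ε (al a) / c) :=
          mul_le_mul_of_nonneg_left ((le_div_iff₀ hc).2 (by linarith)) (le_max_right _ _)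
      _ = _ := by field_simp
  have hev : ∀ᶠ ε in 𝓝[>] (0 : ℝ), ε ∈ Set.Ioc 0 r := Ioc_mem_nhdsGT hr
  have hpow : ∀ t : ℝ, 0 < t → Tendsto (fun ε : ℝ => ε ^ t) (𝓝[>] 0) (𝓝 0) := fun t ht => by
    have := (Real.continuousAt_rpow_const 0 t (Or.inr ht.le)).tendsto
    rw [Real.zero_rpow ht.ne'] at this
    exact this.mono_left nhdsWithin_le_nhds
  have hle1 : ∀ ε ∈ Set.Ioc 0 r, ∀ x, π ε x ≤ 1 := fun ε hε x =>
    (hπ ε hε).1.2 ▸ Finset.single_le_sum (fun y _ => (hπ ε hε).1.1 y) (Finset.mem_univ x)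
  -- The reference weight vanishes because `c * p ε ≤ ε ^ w a`; this is where positivity of `w`
  -- enters.
  have hp0 : Tendsto p (𝓝[>] 0) (𝓝 0) := by
    obtain ⟨a⟩ := ‹Nonempty Q›
    have hlim := (hpow (w a) (hw a)).div_const c
    rw [zero_div] at hlim
    refine tendsto_of_tendsto_of_tendsto_of_le_of_le' tendsto_const_nhds hlim
      (hev.mono hp) ?_
    filter_upwards [hev] with ε hε
    rw [le_div_iff₀ hc, mul_comm]
    exact (hlo ε hε a).trans (mul_le_of_le_one_right
      (Real.rpow_nonneg hε.1.le _) (hle1 ε hε _))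
  have hout : ∀ x ∉ Set.range al, Tendsto (fun ε => π ε x) (𝓝[>] 0) (𝓝 0) := fun x hx => by
    have hid : Tendsto (fun ε : ℝ => ε) (𝓝[>] 0) (𝓝 0) := nhdsWithin_le_nhds
    have hlim := (hid.add hp0).const_mul C
    rw [add_zero, mul_zero] at hlim
    refine tendsto_of_tendsto_of_tendsto_of_le_of_le' tendsto_const_nhds hlim ?_ ?_
    · filter_upwards [hev] with ε hε using (hπ ε hε).1.1 x
    · filter_upwards [hev] with ε hε using hrest ε hε x hx
  set S : Set X := {x | ∃ a, x = al a ∧ ∀ b, w b ≤ w a} with hSdef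
  have hnon : ∀ x ∉ S, Tendsto (fun ε => π ε x) (𝓝[>] 0) (𝓝 0) := fun x hx => by
    by_cases hxr : x ∈ Set.range al
    · obtain ⟨b, rfl⟩ := hxr
      have hb : ∃ a, w b < w a := by
        by_contra hcon
        exact hx ⟨b, rfl, fun a => not_lt.1 fun h => hcon ⟨a, h⟩⟩
      obtain ⟨a, hab⟩ := hb
      have hlim := (hpow _ (sub_pos.2 hab)).const_mul (max C 0 / c)
      rw [mul_zero] at hlim
      refine tendsto_of_tendsto_of_tendsto_of_le_of_le' tendsto_const_nhds hlim ?_ ?_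
      · filter_upwards [hev] with ε hε using (hπ ε hε).1.1 _
      · filter_upwards [hev] with ε hε
        exact (hC ε hε b a).trans (mul_le_of_le_one_right
          (mul_nonneg (div_nonneg (le_max_right _ _) hc.le) (Real.rpow_nonneg hε.1.le _))
          (hle1 ε hε _))
    · exact hout x hxr
  constructor
  · intro μ hμ
    have hlim : Tendsto (fun ε => 1 - ∑ x, Sᶜ.indicator (π ε) x) (𝓝[>] 0) (𝓝 1) := by
      have : Tendsto (fun ε => ∑ x, Sᶜ.indicator (π ε) x) (𝓝[>] 0) (𝓝 (∑ _x : X, 0)) := by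
        refine tendsto_finsetSum _ fun x _ => ?_
        by_cases hx : x ∈ S
        · simp [hx]
        · simpa [hx] using hnon x hx
      simpa using this.const_sub 1
    refine hlim.congr' ?_
    filter_upwards [hev] with ε hε
    rw [((hπ ε hε).2.2 (μ ε) (hμ ε) S).liminf_eq, ← (hπ ε hε).1.2]
    simp [Set.indicator_compl]
  · rintro T hT x ⟨a, rfl, ha⟩
    by_contra hxT
    have hmain : Tendsto (fun ε => ∑ y, T.indicator (π ε) y) (𝓝[>] 0) (𝓝 1) := by
      classical
      -- Initial laws may depend on `ε`: the stationary law is used where it is available, and a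
      -- point mass serves as a default value elsewhere.
      have h1 := hT (fun ε => if ε ∈ Set.Ioc 0 r then π ε else Pi.single (al a) 1) fun ε => by
        split_ifs with hε
        · exact (hπ ε hε).1
        · exact single_mem_stdSimplex ℝ _
      refine h1.congr' ?_
      filter_upwards [hev] with ε hε
      rw [if_pos hε]
      exact ((hπ ε hε).2.2 _ (hπ ε hε).1 T).liminf_eq
    have hx0 : Tendsto (fun ε => π ε (al a)) (𝓝[>] 0) (𝓝 0) := by
      have hlim := hmain.const_sub 1
      rw [sub_self] at hlim
      refine tendsto_of_tendsto_of_tendsto_of_le_of_le' tendsto_const_nhds hlim ?_ ?_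
      · filter_upwards [hev] with ε hε using (hπ ε hε).1.1 _
      · filter_upwards [hev] with ε hε
        have h1 : Tᶜ.indicator (π ε) (al a) ≤ ∑ y, Tᶜ.indicator (π ε) y :=
          Finset.single_le_sum (fun y _ => Set.indicator_nonneg
            (fun z _ => (hπ ε hε).1.1 z) y) (Finset.mem_univ _)
        rw [Set.indicator_of_mem (Set.mem_compl hxT)] at h1
        simp only [Set.indicator_compl, Pi.sub_apply, Finset.sum_sub_distrib,
          (hπ ε hε).1.2] at h1
        exact h1
    have hev1 : ∀ᶠ ε in 𝓝[>] (0 : ℝ), ε ∈ Set.Ioc (0 : ℝ) 1 := Ioc_mem_nhdsGT one_pos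
    -- The maximizer `al a` dominates every `al b` up to a constant, so if its weight vanished all
    -- weights would, contradicting total mass `1`.
    have hall : ∀ y, Tendsto (fun ε => π ε y) (𝓝[>] 0) (𝓝 0) := fun y => by
      by_cases hy : y ∈ Set.range al
      · obtain ⟨b, rfl⟩ := hy
        have hlim := hx0.const_mul (max C 0 / c)
        rw [mul_zero] at hlim
        refine tendsto_of_tendsto_of_tendsto_of_le_of_le' tendsto_const_nhds hlim ?_ ?_
        · filter_upwards [hev] with ε hε using (hπ ε hε).1.1 _
        · filter_upwards [hev, hev1] with ε hε hε1
          refine (hC ε hε b a).trans (mul_le_mul_of_nonneg_right ?_ ((hπ ε hε).1.1 _))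
          exact mul_le_of_le_one_right (div_nonneg (le_max_right _ _) hc.le)
            (Real.rpow_le_one hε.1.le hε1.2 (sub_nonneg.2 (ha b)))
      · exact hout y hy
    have hsum : Tendsto (fun ε => ∑ y, π ε y) (𝓝[>] 0) (𝓝 (∑ _y : X, 0)) :=
      tendsto_finsetSum _ fun y _ => hall y
    have hone : Tendsto (fun ε => ∑ y, π ε y) (𝓝[>] 0) (𝓝 1) := by
      refine tendsto_const_nhds.congr' ?_
      filter_upwards [hev] with ε hε using (hπ ε hε).1.2.symm
    have := tendsto_nhds_unique hsum hone
    simp at this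

end Chain

/-! ### One agent -/

namespace AgentState

variable {α : Type*} {R : Set ℝ}

/-- The benchmark action, or `d` for a discontent agent. -/
def act : AgentState α R → α → α
  | discontent, d => d
  | content a _, _ => a
  | hopeful a _, _ => a
  | watchful a _, _ => a

/-- The benchmark utility, or `0` for a discontent agent. -/
def util : AgentState α R → ℝ
  | discontent => 0
  | content _ u => u
  | hopeful _ u => u
  | watchful _ u => u

/-- The resistance `F` of the benchmark utility, or `0` for a discontent agent. -/
def pot (F : ℝ → ℝ) : AgentState α R → ℝ
  | discontent => 0
  | content _ u => F u
  | hopeful _ u => F u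
  | watchful _ u => F u

open Classical in
/-- The update of an agent that observes `u` after playing its benchmark action; a discontent agent
stays discontent. -/
noncomputable def next : AgentState α R → R → AgentState α R
  | discontent, _ => discontent
  | content a u₀, u =>
      if (u₀ : ℝ) < u then hopeful a u₀ else if u = u₀ then content a u₀ else watchful a u₀
  | hopeful a u₀, u =>
      if (u₀ : ℝ) < u then content a u else if u = u₀ then content a u₀ else watchful a u₀
  | watchful a u₀, u =>
      if (u₀ : ℝ) < u then hopeful a u₀ else if u = u₀ then content a u₀ else discontent

open Classical in
/-- The number of observations of `u` after which an agent is content with benchmark utility `u`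
or discontent. -/
noncomputable def rank : AgentState α R → R → ℕ
  | discontent, _ => 0
  | content _ u₀, u => if u = u₀ then 0 else 2
  | hopeful _ u₀, u => if (u₀ : ℝ) ≤ u then 1 else 2
  | watchful _ u₀, u => if (u₀ : ℝ) < u then 2 else 1

theorem rank_le_two (s : AgentState α R) (u : R) : rank s u ≤ 2 := by
  cases s <;> simp only [rank] <;> first | omega | (split_ifs <;> omega)

/-- Under a constant observation the moods move steadily towards content or discontent; the
truncated subtraction covers the states that have already settled. -/
theorem rank_next (s : AgentState α R) (u : R) : rank (next s u) u = rank s u - 1 := by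
  rcases s with _ | ⟨a, v⟩ | ⟨a, v⟩ | ⟨a, v⟩
  · simp [next, rank]
  all_goals
    rcases lt_trichotomy (v : ℝ) u with h | h | h
    · have h1 : u ≠ v := fun e => h.ne (by rw [e])
      simp [next, rank, h, h1, h.le]
    · obtain rfl : v = u := Subtype.ext h
      simp [next, rank]
    · have h1 : u ≠ v := fun e => h.ne (by rw [e])
      simp [next, rank, h1, h.not_ge, h.not_gt]

theorem eq_content_of_rank_eq_zero {s : AgentState α R} {u : R} (hs : s ≠ discontent)
    (h : rank s u = 0) (d : α) : s = content (s.act d) u := by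
  rcases s with _ | ⟨a, v⟩ | ⟨a, v⟩ | ⟨a, v⟩ <;> simp only [rank, act] at h ⊢
  · exact absurd rfl hs
  all_goals split_ifs at h <;> simp_all

theorem act_next {s : AgentState α R} {u : R} (h : next s u ≠ discontent) (d : α) :
    (next s u).act d = s.act d := by
  rcases s with _ | ⟨a, v⟩ | ⟨a, v⟩ | ⟨a, v⟩ <;> simp only [next] at h ⊢
  all_goals split_ifs at h ⊢ <;> simp_all [act]

theorem act_of_ne_discontent {s : AgentState α R} (hs : s ≠ discontent) (d d' : α) :
    s.act d = s.act d' := by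
  cases s <;> simp_all [act]

/-- Two equal observations settle an agent in any mood: above the benchmark even a watchful agent
becomes hopeful and then accepts. The next lemma is the counterpart below the benchmark. -/
theorem next_next_of_lt {s : AgentState α R} (hs : s ≠ discontent) {u : R} (h : s.util < u)
    (d : α) : next (next s u) u = content (s.act d) u := by
  rcases s with _ | ⟨a, v⟩ | ⟨a, v⟩ | ⟨a, v⟩ <;> simp_all [next, util, act]

theorem next_next_of_gt {s : AgentState α R} (hs : s ≠ discontent) {u : R} (h : (u : ℝ) < s.util) :
    next (next s u) u = discontent := by
  rcases s with _ | ⟨a, v⟩ | ⟨a, v⟩ | ⟨a, v⟩ <;> simp only [util] at h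
  · exact absurd rfl hs
  all_goals
    have h1 : u ≠ v := fun e => h.ne (by rw [e])
    simp [next, h.not_gt, h1]

/-! #### Action policy -/

section Action

variable [Fintype α] {ε : ℝ}

theorem actionProb_nonneg (hε : ε ∈ Set.Ioo (0 : ℝ) 1) (s : AgentState α R) (a : α) :
    0 ≤ actionProb ε s a := by
  have h1 : 0 ≤ 1 - ε := by linarith [hε.2]
  have h2 : (1 : ℝ) ≤ Fintype.card α := by
    exact_mod_cast Fintype.card_pos_iff.2 ⟨a⟩
  cases s <;> simp only [actionProb] <;> try split_ifs
  all_goals first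
    | positivity
    | exact h1
    | exact div_nonneg hε.1.le (by linarith)

theorem sum_actionProb [Nonempty α] (ε : ℝ) (s : AgentState α R) :
    ∑ a, actionProb ε s a = 1 := by
  have h2 : (Fintype.card α : ℝ) ≠ 0 := by exact_mod_cast Fintype.card_ne_zero
  rcases s with _ | ⟨a₀, v⟩ | ⟨a₀, v⟩ | ⟨a₀, v⟩ <;> simp only [actionProb]
  · simp [h2]
  · split_ifs with h
    · classical
      have h3 : (1 : ℝ) < Fintype.card α := by
        exact_mod_cast Fintype.one_lt_card_iff_nontrivial.2 h.2
      rw [← Finset.add_sum_erase _ _ (Finset.mem_univ a₀)]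
      rw [Finset.sum_congr rfl (g := fun _ => ε / ((Fintype.card α : ℝ) - 1))]
      · rw [Finset.sum_const, Finset.card_erase_of_mem (Finset.mem_univ _), Finset.card_univ]
        rw [nsmul_eq_mul, Nat.cast_sub Fintype.card_pos]
        have : (Fintype.card α : ℝ) - 1 ≠ 0 := by linarith
        simp only [if_true, Nat.cast_one]
        field_simp
        ring
      · intro x hx
        rw [if_neg (Finset.ne_of_mem_erase hx)]
    · simp only [Finset.sum_boole]
      exact_mod_cast Finset.card_eq_one.2 ⟨a₀, by ext; simp⟩
  all_goals
    simp only [Finset.sum_boole]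
    exact_mod_cast Finset.card_eq_one.2 ⟨a₀, by ext; simp⟩

theorem actionProb_le_one [Nonempty α] (hε : ε ∈ Set.Ioo (0 : ℝ) 1) (s : AgentState α R)
    (a : α) : actionProb ε s a ≤ 1 :=
  sum_actionProb ε s ▸ Finset.single_le_sum (f := actionProb ε s)
    (fun b _ => actionProb_nonneg hε s b) (Finset.mem_univ a)

theorem one_sub_le_actionProb_act (hε : ε ∈ Set.Ioo (0 : ℝ) 1) {s : AgentState α R}
    (hs : s ≠ discontent) (d : α) : 1 - ε ≤ actionProb ε s (s.act d) := by
  have h1 := hε.1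
  rcases s with _ | ⟨a₀, v⟩ | ⟨a₀, v⟩ | ⟨a₀, v⟩ <;> simp only [actionProb, act]
  · exact absurd rfl hs
  · split_ifs <;> simp_all [le_of_lt]
  all_goals simp [h1.le]

theorem le_actionProb_act (hε : ε ∈ Set.Ioo (0 : ℝ) 1) (s : AgentState α R) (d : α) :
    (1 - ε) / Fintype.card α ≤ actionProb ε s (s.act d) := by
  have h2 : (1 : ℝ) ≤ Fintype.card α := by exact_mod_cast Fintype.card_pos_iff.2 ⟨d⟩
  by_cases hs : s = discontent
  · subst hs
    simp only [actionProb]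
    gcongr
    linarith [hε.1]
  · exact (div_le_self (by linarith [hε.2]) h2).trans (one_sub_le_actionProb_act hε hs d)

theorem actionProb_content_le (hε : ε ∈ Set.Ioo (0 : ℝ) 1) {a₀ a : α} (u : R) (h : a ≠ a₀) :
    actionProb ε (content a₀ u) a ≤ ε := by
  simp only [actionProb, if_neg h]
  split_ifs with h1
  · have h2 : (2 : ℝ) ≤ Fintype.card α := by
      exact_mod_cast Fintype.one_lt_card_iff_nontrivial.2 h1.2
    exact div_le_self hε.1.le (by linarith)
  · exact hε.1.le

theorem le_actionProb_content (hε : ε ∈ Set.Ioo (0 : ℝ) 1) {a₀ a : α} {u : R} (h : a ≠ a₀)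
    (hu : (u : ℝ) < 1) : ε / Fintype.card α ≤ actionProb ε (content a₀ u) a := by
  have hn : Nontrivial α := ⟨a, a₀, h⟩
  have h2 : (1 : ℝ) < Fintype.card α := by
    exact_mod_cast Fintype.one_lt_card_iff_nontrivial.2 hn
  have h0 := hε.1
  simp only [actionProb, if_neg h, if_pos (And.intro hu hn)]
  exact div_le_div_of_nonneg_left h0.le (by linarith) (by linarith)

end Action

/-! #### Update policy -/

section Update

variable {F : ℝ → ℝ} {G : ℝ → ℝ → ℝ} {c ε : ℝ}

theorem mix_nonneg {p : ℝ} (h0 : 0 ≤ p) (h1 : p ≤ 1) (s t r : AgentState α R) :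
    0 ≤ mix p s t r := by
  simp only [mix, Pi.add_apply, Pi.smul_apply, smul_eq_mul, Pi.single_apply]
  have : 0 ≤ 1 - p := by linarith
  split_ifs <;> simp [h0, this]

theorem sum_mix [Fintype (AgentState α R)] (p : ℝ) (s t : AgentState α R) :
    ∑ r, mix p s t r = 1 := by
  simp [mix, Finset.sum_add_distrib, ← Finset.mul_sum]

theorem sum_single [Fintype (AgentState α R)] (s : AgentState α R) :
    ∑ r, (Pi.single s 1 : AgentState α R → ℝ) r = 1 := by
  simp

theorem single_nonneg (s r : AgentState α R) : 0 ≤ (Pi.single s 1 : AgentState α R → ℝ) r := by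
  rw [Pi.single_apply]; split_ifs <;> norm_num

theorem min_rpow_mem (hc : c ∈ Set.Ioo (0 : ℝ) 1) (hε : ε ∈ Set.Ioo (0 : ℝ) 1) (t : ℝ) :
    min (ε ^ t) c ∈ Set.Ioo (0 : ℝ) 1 :=
  ⟨lt_min (Real.rpow_pos_of_pos hε.1 _) hc.1, (min_le_right _ _).trans_lt hc.2⟩

theorem updateLaw_nonneg (hc : c ∈ Set.Ioo (0 : ℝ) 1) (hε : ε ∈ Set.Ioo (0 : ℝ) 1)
    (hG : ∀ u v : R, (u : ℝ) < v → 0 ≤ G u v) (s : AgentState α R) (a : α) (u : R)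
    (t : AgentState α R) : 0 ≤ updateLaw F G c ε s a u t := by
  rcases s with _ | ⟨a₀, v⟩ | ⟨a₀, v⟩ | ⟨a₀, v⟩ <;> simp only [updateLaw]
  · have h := min_rpow_mem hc hε (F u)
    exact mix_nonneg h.1.le h.2.le _ _ _
  · split_ifs with h1 h2
    · exact mix_nonneg (Real.rpow_nonneg hε.1.le _)
        (Real.rpow_le_one hε.1.le hε.2.le (hG v u h2)) _ _ _
    all_goals exact single_nonneg _ _
  all_goals split_ifs <;> exact single_nonneg _ _

theorem sum_updateLaw [Fintype (AgentState α R)] (s : AgentState α R) (a : α) (u : R) :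
    ∑ t, updateLaw F G c ε s a u t = 1 := by
  rcases s with _ | ⟨a₀, v⟩ | ⟨a₀, v⟩ | ⟨a₀, v⟩ <;> simp only [updateLaw]
  · exact sum_mix _ _ _
  · split_ifs <;> first | exact sum_mix _ _ _ | exact sum_single _
  all_goals split_ifs <;> exact sum_single _

theorem updateLaw_le_one [Finite α] [Finite R] (hc : c ∈ Set.Ioo (0 : ℝ) 1)
    (hε : ε ∈ Set.Ioo (0 : ℝ) 1) (hG : ∀ u v : R, (u : ℝ) < v → 0 ≤ G u v)
    (s : AgentState α R) (a : α) (u : R) (t : AgentState α R) :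
    updateLaw F G c ε s a u t ≤ 1 :=
  sum_updateLaw (F := F) (G := G) (c := c) (ε := ε) s a u ▸
    Finset.single_le_sum (f := updateLaw F G c ε s a u)
      (fun r _ => updateLaw_nonneg hc hε hG s a u r) (Finset.mem_univ t)

theorem mix_apply_left {p : ℝ} {s t : AgentState α R} (h : s ≠ t) : mix p s t s = p := by
  simp [mix, h]

theorem mix_apply_right {p : ℝ} {s t : AgentState α R} (h : s ≠ t) : mix p s t t = 1 - p := by
  simp [mix, h.symm]

theorem mix_apply_of_ne {p : ℝ} {s t r : AgentState α R} (h : r ≠ s) (h' : r ≠ t) :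
    mix p s t r = 0 := by
  simp [mix, h, h']

theorem single_ne_zero {s r : AgentState α R}
    (h : (Pi.single s 1 : AgentState α R → ℝ) r ≠ 0) : r = s := by
  by_contra hr
  exact h (Pi.single_eq_of_ne hr 1)

theorem updateLaw_next {s : AgentState α R} (hs : s ≠ discontent) (d : α) (u : R) :
    updateLaw F G c ε s (s.act d) u (next s u) = 1 := by
  rcases s with _ | ⟨a₀, v⟩ | ⟨a₀, v⟩ | ⟨a₀, v⟩
  · exact absurd rfl hs
  · change updateLaw F G c ε (content a₀ v) a₀ u _ = 1
    simp only [updateLaw, next, ne_eq, not_true_eq_false, if_false]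
    split_ifs <;> simp
  all_goals
    simp only [updateLaw, next, act]
    split_ifs <;> simp

theorem le_updateLaw_next (hc : c ∈ Set.Ioo (0 : ℝ) 1) (s : AgentState α R)
    (d : α) (u : R) : 1 - c ≤ updateLaw F G c ε s (s.act d) u (next s u) := by
  by_cases hs : s = discontent
  · subst hs
    simp only [updateLaw, next, act]
    rw [mix_apply_right (by simp)]
    linarith [min_le_right (ε ^ F u) c]
  · rw [updateLaw_next hs]
    linarith [hc.1]

/-- What can happen to a content agent. -/
theorem updateLaw_content_ne_zero {a₀ a : α} {v u : R} {t : AgentState α R}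
    (h : updateLaw F G c ε (content a₀ v) a u t ≠ 0) :
    (a ≠ a₀ ∧ (v : ℝ) < u ∧ t = content a u ∧
      updateLaw F G c ε (content a₀ v) a u t = ε ^ G v u) ∨
    (a ≠ a₀ ∧ t = content a₀ v) ∨ (a = a₀ ∧ t = next (content a₀ v) u) := by
  by_cases ha : a = a₀
  · subst ha
    refine Or.inr (Or.inr ⟨rfl, ?_⟩)
    simp only [updateLaw, next, ne_eq, not_true_eq_false, if_false] at h ⊢
    split_ifs at h ⊢ <;> exact single_ne_zero h
  · by_cases ht : t = content a₀ v
    · exact Or.inr (Or.inl ⟨ha, ht⟩)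
    · refine Or.inl ⟨ha, ?_⟩
      simp only [updateLaw, ne_eq, ha, not_false_eq_true, if_true] at h ⊢
      by_cases huv : (v : ℝ) < u
      · simp only [if_pos huv] at h ⊢
        by_cases ht' : t = content a u
        · subst ht'
          exact ⟨huv, rfl, mix_apply_left (Ne.symm (by simp [Ne.symm ha]))⟩
        · exact absurd (mix_apply_of_ne ht' ht) h
      · simp only [if_neg huv] at h
        exact absurd (single_ne_zero h) ht

/-- Benchmark utilities of agents that are not discontent do not decrease. -/
theorem util_le_of_updateLaw_ne_zero {s t : AgentState α R} {a : α} {u : R}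
    (h : updateLaw F G c ε s a u t ≠ 0) (hs : s ≠ discontent) (ht : t ≠ discontent) :
    s.util ≤ t.util := by
  rcases s with _ | ⟨a₀, v⟩ | ⟨a₀, v⟩ | ⟨a₀, v⟩
  · exact absurd rfl hs
  · rcases updateLaw_content_ne_zero h with ⟨_, h1, rfl, _⟩ | ⟨_, rfl⟩ | ⟨_, rfl⟩
    · exact h1.le
    · exact le_rfl
    · simp only [next]
      split_ifs <;> exact le_rfl
  all_goals
    simp only [updateLaw] at h
    split_ifs at h <;> rw [single_ne_zero h] at ht ⊢ <;>
      simp_all [util, le_of_lt]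

theorem exists_util (s : AgentState α R) (hs : s ≠ discontent) :
    ∃ u : R, s.util = u ∧ s.pot F = F u := by
  rcases s with _ | ⟨a₀, v⟩ | ⟨a₀, v⟩ | ⟨a₀, v⟩
  · exact absurd rfl hs
  all_goals exact ⟨v, rfl, rfl⟩

theorem pot_nonneg (hF : ∀ u : R, 0 ≤ F u) (s : AgentState α R) : 0 ≤ s.pot F := by
  cases s <;> simp [pot, hF]

theorem pot_le_pot (hF' : ∀ u v : R, (u : ℝ) ≤ v → F v ≤ F u) {s t : AgentState α R}
    (hs : s ≠ discontent) (ht : t ≠ discontent) (h : s.util ≤ t.util) : t.pot F ≤ s.pot F := by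
  obtain ⟨u, hu, hu'⟩ := exists_util (F := F) s hs
  obtain ⟨v, hv, hv'⟩ := exists_util (F := F) t ht
  rw [hu', hv']
  exact hF' u v (by rwa [← hu, ← hv])

theorem pot_le_of_updateLaw_ne_zero (hF : ∀ u : R, 0 ≤ F u)
    (hF' : ∀ u v : R, (u : ℝ) ≤ v → F v ≤ F u) {s t : AgentState α R} {a : α} {u : R}
    (h : updateLaw F G c ε s a u t ≠ 0) (hs : s ≠ discontent) : t.pot F ≤ s.pot F := by
  by_cases ht : t = discontent
  · rw [ht]; exact pot_nonneg hF s
  · exact pot_le_pot hF' hs ht (util_le_of_updateLaw_ne_zero h hs ht)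

/-- The potential of an agent increases only when a discontent agent accepts, at the price `ε ^ F
u`. In all other cases the exponent is nonpositive and the bound is at least `1`. -/
theorem updateLaw_le_rpow [Finite α] [Finite R] (hc : c ∈ Set.Ioo (0 : ℝ) 1)
    (hε : ε ∈ Set.Ioo (0 : ℝ) 1) (hG : ∀ u v : R, (u : ℝ) < v → 0 ≤ G u v)
    (hF : ∀ u : R, 0 ≤ F u) (hF' : ∀ u v : R, (u : ℝ) ≤ v → F v ≤ F u)
    (s : AgentState α R) (a : α) (u : R) (t : AgentState α R) :
    updateLaw F G c ε s a u t ≤ ε ^ (t.pot F - s.pot F) := by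
  have hpos := Real.rpow_pos_of_pos hε.1 (t.pot F - s.pot F)
  by_cases h : updateLaw F G c ε s a u t = 0
  · rw [h]; exact hpos.le
  by_cases hs : s = discontent
  · subst hs
    simp only [updateLaw] at h ⊢
    by_cases ht : t = discontent
    · subst ht
      rw [mix_apply_right (by simp)]
      simp only [pot, sub_self, Real.rpow_zero]
      linarith [(min_rpow_mem hc hε (F u)).1]
    · by_cases ht' : t = content a u
      · subst ht'
        rw [mix_apply_left (by simp)]
        simp only [pot, sub_zero]
        exact min_le_left _ _
      · exact absurd (mix_apply_of_ne ht' ht) h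
  · refine (updateLaw_le_one hc hε hG s a u t).trans ?_
    exact Real.one_le_rpow_of_pos_of_le_one_of_nonpos hε.1 hε.2.le
      (sub_nonpos.2 (pot_le_of_updateLaw_ne_zero hF hF' h hs))

theorem le_updateLaw_accept (hc : c ∈ Set.Ioo (0 : ℝ) 1) (hε : ε ∈ Set.Ioo (0 : ℝ) 1)
    (a : α) {u : R} (hF : 0 ≤ F u) :
    c * ε ^ F u ≤ updateLaw F G c ε discontent a u (content a u) := by
  simp only [updateLaw]
  rw [mix_apply_left (by simp)]
  have h1 := Real.rpow_pos_of_pos hε.1 (F u)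
  have h2 := Real.rpow_le_one hε.1.le hε.2.le hF
  refine le_min ?_ ?_
  · nlinarith [hc.2]
  · nlinarith [hc.1]

theorem updateLaw_content_accept {a₀ a : α} {v u : R} (ha : a ≠ a₀) (h : (v : ℝ) < u) :
    updateLaw F G c ε (content a₀ v) a u (content a u) = ε ^ G v u := by
  simp only [updateLaw, ne_eq, ha, not_false_eq_true, if_true, if_pos h]
  exact mix_apply_left (by simp [ha])

theorem updateLaw_content_reject {a₀ a : α} {v u : R} (ha : a ≠ a₀) (h : (u : ℝ) ≤ v) :
    updateLaw F G c ε (content a₀ v) a u (content a₀ v) = 1 := by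
  simp [updateLaw, ha, h.not_gt]

end Update

end AgentState

/-! ### Joint dynamics -/

section Dynamics

open AgentState Matrix

variable {I : Type*} {A : I → Type*} {U : I → (∀ j, A j) → ℝ} {F : ℝ → ℝ} {G : ℝ → ℝ → ℝ}
  {c ε : ℝ}

/-- The observation of agent `i` when `a` is played. -/
def obs (U : I → (∀ j, A j) → ℝ) (a : ∀ j, A j) (i : I) : Set.range (U i) :=
  ⟨U i a, Set.mem_range_self a⟩

/-- The action profile in which discontent agents follow `a` and the others play their benchmark
actions. -/
def play (y : State U) (a : ∀ j, A j) : ∀ j, A j := fun i => (y i).act (a i)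

/-- The next state if discontent agents play according to `a` and remain discontent, and the others
do not explore. -/
noncomputable def quiet (y : State U) (a : ∀ j, A j) : State U :=
  fun i => (y i).next (obs U (play y a) i)

/-- The state in which everybody is discontent. -/
def allDiscontent (U : I → (∀ j, A j) → ℝ) : State U := fun _ => discontent

/-- Some agent is discontent. -/
def HasDiscontent (y : State U) : Prop := ∃ i, y i = discontent

/-- A transition without exploration or acceptance. -/
def QuietStep (y z : State U) : Prop := ∃ a, z = quiet y a

theorem quiet_apply_of_discontent {y : State U} {i : I} (h : y i = discontent) (a : ∀ j, A j) :
    quiet y a i = discontent := by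
  simp [quiet, h, next]

theorem play_quiet {y : State U} {a b : ∀ j, A j}
    (h : ∀ k, y k ≠ discontent → quiet y a k ≠ discontent) : play (quiet y a) b = play y b := by
  funext k
  by_cases hk : y k = discontent
  · simp [play, hk, quiet_apply_of_discontent hk]
  · exact act_next (h k hk) _

/-- If nobody becomes discontent in two quiet steps with the same actions, then every agent has made
the same observation twice. -/
theorem quiet_quiet_apply {y : State U} {a : ∀ j, A j}
    (h : ∀ k, y k ≠ discontent → quiet (quiet y a) a k ≠ discontent) (i : I) :
    quiet (quiet y a) a i = ((y i).next (obs U (play y a) i)).next (obs U (play y a) i) := by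
  have h1 : ∀ k, y k ≠ discontent → quiet y a k ≠ discontent := fun k hk hk' =>
    h k hk (quiet_apply_of_discontent hk' a)
  change (quiet y a i).next (obs U (play (quiet y a) a) i) = _
  rw [play_quiet h1]
  rfl

/-- If nobody became discontent, the same profile would be played twice, so `i` would be
disappointed twice in a row and become discontent after all. -/
theorem exists_new_discontent_of_lt {y : State U} {a : ∀ j, A j} {i : I}
    (hi : y i ≠ discontent) (hlt : U i (play y a) < (y i).util) :
    ∃ k, y k ≠ discontent ∧ quiet (quiet y a) a k = discontent := by
  by_contra hcon
  have h : ∀ k, y k ≠ discontent → quiet (quiet y a) a k ≠ discontent := fun k hk hk' =>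
    hcon ⟨k, hk, hk'⟩
  refine h i hi ?_
  rw [quiet_quiet_apply h]
  exact next_next_of_gt hi hlt

theorem reflTransGen_quiet_quiet (y : State U) (a : ∀ j, A j) :
    Relation.ReflTransGen QuietStep y (quiet (quiet y a) a) :=
  (Relation.ReflTransGen.single ⟨a, rfl⟩).tail ⟨a, rfl⟩

/-- By interdependence the discontent agents can produce two different utilities for some other
agent `i`. If the lower one is below the benchmark of `i`, it is played twice. Otherwise the higher
one exceeds the benchmark; playing it twice makes `i` adopt it, and then the lower one is a
disappointment. -/
theorem exists_new_discontent [Finite I] [DecidableEq I] [∀ i, Nonempty (A i)]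
    (hinter : Interdependent U)
    {y : State U} (hy : HasDiscontent y) (hy' : ∃ i, y i ≠ discontent) :
    ∃ z, Relation.ReflTransGen QuietStep y z ∧ (∀ k, y k = discontent → z k = discontent) ∧
      ∃ k, y k ≠ discontent ∧ z k = discontent := by
  classical
  have := Fintype.ofFinite I
  have hD : ∀ (y : State U) a k, y k = discontent → quiet (quiet y a) a k = discontent :=
    fun y a k hk => quiet_apply_of_discontent (quiet_apply_of_discontent hk a) a
  let a₀ : ∀ j, A j := fun j => Classical.arbitrary _
  let J : Finset I := Finset.univ.filter fun i => y i = discontent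
  have hJ : J.Nonempty := hy.imp fun i hi => by simpa [J] using hi
  obtain ⟨i, hiJ, b, hb⟩ := hinter (play y a₀) J hJ (hy'.imp fun i hi => by simpa [J] using hi)
  have hi : y i ≠ discontent := by simpa [J] using hiJ
  -- Changing the actions of `J` in a play is again a play, since the agents outside `J` keep their
  -- benchmark actions.
  have hpb : J.piecewise b (play y a₀) = play y b := by
    funext k
    by_cases hk : y k = discontent
    · rw [Finset.piecewise_eq_of_mem _ _ _ (by simpa [J] using hk)]
      simp [play, hk, act]
    · rw [Finset.piecewise_eq_of_notMem _ _ _ (by simpa [J] using hk)]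
      exact act_of_ne_discontent hk _ _
  rw [hpb] at hb
  obtain ⟨d₁, d₂, hd⟩ : ∃ d₁ d₂, U i (play y d₁) < U i (play y d₂) := by
    rcases lt_or_gt_of_ne hb with h | h
    · exact ⟨_, _, h⟩
    · exact ⟨_, _, h⟩
  by_cases h1 : U i (play y d₁) < (y i).util
  · exact ⟨_, reflTransGen_quiet_quiet y d₁, hD y d₁, exists_new_discontent_of_lt hi h1⟩
  · set z := quiet (quiet y d₂) d₂ with hz
    by_cases h2 : ∃ k, y k ≠ discontent ∧ z k = discontent
    · exact ⟨z, reflTransGen_quiet_quiet y d₂, hD y d₂, h2⟩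
    · have h : ∀ k, y k ≠ discontent → z k ≠ discontent := fun k hk hk' => h2 ⟨k, hk, hk'⟩
      have hzi : z i = content ((y i).act (d₂ i)) (obs U (play y d₂) i) := by
        rw [hz, quiet_quiet_apply h]
        exact next_next_of_lt hi ((not_lt.1 h1).trans_lt hd) _
      have hyq : ∀ k, y k ≠ discontent → quiet y d₂ k ≠ discontent := fun k hk hk' =>
        h k hk (quiet_apply_of_discontent hk' d₂)
      have hplay : play z d₁ = play y d₁ := by
        rw [hz, play_quiet, play_quiet hyq]
        intro k hk
        exact h k fun e => hk (quiet_apply_of_discontent e d₂)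
      obtain ⟨k, hk, hk'⟩ := exists_new_discontent_of_lt (y := z) (a := d₁) (h i hi)
        (by rw [hplay, hzi]; exact hd)
      exact ⟨_, (reflTransGen_quiet_quiet y d₂).trans (reflTransGen_quiet_quiet z d₁),
        fun l hl => hD z d₁ l (hD y d₂ l hl), k, fun e => hk (hD y d₂ k e), hk'⟩

/-- Discontent spreads to all agents of an interdependent game. -/
theorem reflTransGen_allDiscontent [Finite I] [DecidableEq I] [∀ i, Nonempty (A i)]
    (hinter : Interdependent U)
    {y : State U} (hy : HasDiscontent y) :
    Relation.ReflTransGen QuietStep y (allDiscontent U) := by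
  classical
  have := Fintype.ofFinite I
  induction hn : (Finset.univ.filter fun i => y i ≠ discontent).card using
    Nat.strong_induction_on generalizing y with
  | _ n ih =>
    by_cases hy' : ∃ i, y i ≠ discontent
    · obtain ⟨z, hyz, hD, k, hk, hk'⟩ := exists_new_discontent hinter hy hy'
      refine hyz.trans (ih _ ?_ (hy.imp hD) rfl)
      rw [← hn]
      refine Finset.card_lt_card (Finset.ssubset_iff_of_subset ?_ |>.2 ⟨k, ?_, ?_⟩)
      · intro i
        simp only [Finset.mem_filter, Finset.mem_univ, true_and]
        exact mt (hD i)
      · simpa using hk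
      · simpa using hk'
    · have : y = allDiscontent U := funext fun i => not_not.1 fun h => hy' ⟨i, h⟩
      rw [this]

/-- The total rank of a state: zero exactly at aligned states if nobody is discontent. -/
noncomputable def totalRank [Fintype I] (y : State U) (a : ∀ j, A j) : ℕ :=
  ∑ i, (y i).rank (obs U (play y a) i)

theorem totalRank_le [Fintype I] (y : State U) (a : ∀ j, A j) :
    totalRank y a ≤ 2 * Fintype.card I := by
  refine (Finset.sum_le_card_nsmul _ _ 2 fun i _ => rank_le_two _ _).trans_eq ?_
  simp [mul_comm]

theorem eq_alignedState_of_totalRank_eq_zero [Fintype I] {y : State U} {a : ∀ j, A j}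
    (hy : ¬ HasDiscontent y) (h : totalRank y a = 0) : y = alignedState U (play y a) := by
  funext i
  exact eq_content_of_rank_eq_zero (fun e => hy ⟨i, e⟩)
    (Finset.sum_eq_zero_iff.1 h i (Finset.mem_univ i)) (a i)

theorem totalRank_quiet_lt [Fintype I] {y : State U} {a : ∀ j, A j}
    (hy : ¬ HasDiscontent (quiet y a)) (h : totalRank y a ≠ 0) :
    totalRank (quiet y a) a < totalRank y a := by
  have hp : play (quiet y a) a = play y a := play_quiet fun k _ e => hy ⟨k, e⟩
  have hr : ∀ i, (quiet y a i).rank (obs U (play (quiet y a) a) i) =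
      (y i).rank (obs U (play y a) i) - 1 := fun i => by
    rw [hp]; exact rank_next _ _
  obtain ⟨i, -, hi⟩ := Finset.exists_ne_zero_of_sum_ne_zero h
  refine Finset.sum_lt_sum (fun j _ => ?_) ⟨i, Finset.mem_univ i, ?_⟩
  · rw [hr]; exact Nat.sub_le _ _
  · rw [hr]; omega

theorem totalRank_quiet_le [Fintype I] {y : State U} {a : ∀ j, A j}
    (hy : ¬ HasDiscontent (quiet y a)) : totalRank (quiet y a) a ≤ totalRank y a := by
  have hp : play (quiet y a) a = play y a := play_quiet fun k _ e => hy ⟨k, e⟩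
  refine Finset.sum_le_sum fun i _ => ?_
  rw [hp]
  exact (rank_next _ _).trans_le (Nat.sub_le _ _)

theorem AgentState.util_le_util_next {α : Type*} {R : Set ℝ} {s : AgentState α R} {u : R}
    (h : next s u ≠ discontent) (d : α) : s.util ≤ (next s u).util := by
  have hs : s ≠ discontent := fun e => h (by rw [e]; rfl)
  -- The undisturbed update has probability `1` whatever the parameters, so dummy values suffice.
  exact util_le_of_updateLaw_ne_zero (F := 0) (G := 0) (c := 0) (ε := 0)
    (by rw [updateLaw_next hs d]; exact one_ne_zero) hs h

/-- Repeating quiet steps lowers the total rank until someone is discontent or the state is aligned.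
The bound on utilities lets this step be used inside an induction on increasing benchmarks. -/
theorem exists_reflTransGen_aligned [Finite I] [∀ i, Nonempty (A i)] (y : State U) :
    ∃ z, Relation.ReflTransGen QuietStep y z ∧
      (HasDiscontent z ∨ ∃ a, z = alignedState U a ∧ ∀ i, (y i).util ≤ (z i).util) := by
  have := Fintype.ofFinite I
  let a : ∀ j, A j := fun j => Classical.arbitrary _
  induction hn : totalRank y a using Nat.strong_induction_on generalizing y with
  | _ n ih =>
    by_cases hy : HasDiscontent y
    · exact ⟨y, .refl, Or.inl hy⟩
    by_cases h0 : totalRank y a = 0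
    · exact ⟨y, .refl, Or.inr ⟨_, eq_alignedState_of_totalRank_eq_zero hy h0, fun i => le_rfl⟩⟩
    by_cases hq : HasDiscontent (quiet y a)
    · exact ⟨_, .single ⟨a, rfl⟩, Or.inl hq⟩
    obtain ⟨z, hz, h⟩ := ih _ (hn ▸ totalRank_quiet_lt hq h0) (quiet y a) rfl
    refine ⟨z, .head ⟨a, rfl⟩ hz, h.imp id ?_⟩
    rintro ⟨b, rfl, hb⟩
    exact ⟨b, rfl, fun i => (util_le_util_next (fun e => hq ⟨i, e⟩) (a i)).trans (hb i)⟩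

end Dynamics

/-! ### Bounds on transition probabilities -/

section Transition

open AgentState Matrix

variable {I : Type*} {A : I → Type*} {U : I → (∀ j, A j) → ℝ} {F : ℝ → ℝ} {G : ℝ → ℝ → ℝ}
  {c ε : ℝ}

/-- The properties of the parameters used in the estimates of transition probabilities. -/
structure Admissible (U : I → (∀ j, A j) → ℝ) (F : ℝ → ℝ) (G : ℝ → ℝ → ℝ) (c : ℝ) : Prop where
  c_mem : c ∈ Set.Ioo (0 : ℝ) 1
  F_nonneg : ∀ i (u : Set.range (U i)), 0 ≤ F u
  F_anti : ∀ i (u v : Set.range (U i)), (u : ℝ) ≤ v → F v ≤ F u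
  G_nonneg : ∀ i (u v : Set.range (U i)), (u : ℝ) < v → 0 ≤ G u v

/-- The sum of the resistances `F` of all benchmark utilities. -/
def potential [Fintype I] (F : ℝ → ℝ) (y : State U) : ℝ := ∑ i, (y i).pot F

theorem potential_nonneg [Fintype I] (h : Admissible U F G c) (x : State U) : 0 ≤ potential F x :=
  Finset.sum_nonneg fun i _ => pot_nonneg (h.F_nonneg i) _

variable [∀ i, Fintype (A i)]

theorem factor_nonneg (h : Admissible U F G c) (hε : ε ∈ Set.Ioo (0 : ℝ) 1) (x : State U)
    (a : ∀ j, A j) (y : State U) (i : I) :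
    0 ≤ (x i).actionProb ε (a i) * (x i).updateLaw F G c ε (a i) (obs U a i) (y i) :=
  mul_nonneg (actionProb_nonneg hε _ _) (updateLaw_nonneg h.c_mem hε (h.G_nonneg i) _ _ _ _)

theorem factor_le_one [Finite I] (h : Admissible U F G c) (hε : ε ∈ Set.Ioo (0 : ℝ) 1) (x : State U)
    (a : ∀ j, A j) (y : State U) (i : I) :
    (x i).actionProb ε (a i) * (x i).updateLaw F G c ε (a i) (obs U a i) (y i) ≤ 1 := by
  have : Nonempty (A i) := ⟨a i⟩
  exact mul_le_one₀ (actionProb_le_one hε _ _) (updateLaw_nonneg h.c_mem hε (h.G_nonneg i) _ _ _ _)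
    (updateLaw_le_one h.c_mem hε (h.G_nonneg i) _ _ _ _)

/-- A uniform lower bound for the probability of quiet transitions. -/
noncomputable def quietBound [Fintype I] (A : I → Type*) [∀ i, Fintype (A i)] (c ε : ℝ) : ℝ :=
  ∏ i, ((1 - ε) / Fintype.card (A i) * (1 - c))

theorem quietBound_pos [Fintype I] [∀ i, Nonempty (A i)] (hc : c ∈ Set.Ioo (0 : ℝ) 1)
    (hε : ε ∈ Set.Ioo (0 : ℝ) 1) : 0 < quietBound A c ε := by
  have h1 : 0 < 1 - ε := by linarith [hε.2]
  have h2 : 0 < 1 - c := by linarith [hc.2]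
  exact Finset.prod_pos fun i _ =>
    mul_pos (div_pos h1 (by exact_mod_cast Fintype.card_pos)) h2

theorem quietBound_anti [Fintype I] (hc : c ∈ Set.Ioo (0 : ℝ) 1) {ε' : ℝ} (h1 : ε ≤ ε')
    (h2 : ε' ≤ 1) :
    quietBound A c ε' ≤ quietBound A c ε := by
  have h3 : 0 ≤ 1 - c := by linarith [hc.2]
  have h4 : 0 ≤ 1 - ε' := by linarith
  refine Finset.prod_le_prod (fun i _ => by positivity) fun i _ => ?_
  gcongr

/-- The probability that the joint state `x` leads to `y` through the action profile `a`. -/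
noncomputable def pathProb [Fintype I] (F : ℝ → ℝ) (G : ℝ → ℝ → ℝ) (c ε : ℝ)
    (x : State U) (a : ∀ j, A j) (y : State U) : ℝ :=
  ∏ i, ((x i).actionProb ε (a i) * (x i).updateLaw F G c ε (a i) (obs U a i) (y i))

theorem pathProb_nonneg [Fintype I] (h : Admissible U F G c) (hε : ε ∈ Set.Ioo (0 : ℝ) 1)
    (x : State U) (a : ∀ j, A j) (y : State U) : 0 ≤ pathProb F G c ε x a y :=
  Finset.prod_nonneg fun i _ => factor_nonneg h hε x a y i

variable [Fintype I] [DecidableEq I]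

theorem transition_eq_sum (x y : State U) :
    transition U F G c ε x y = ∑ a, pathProb F G c ε x a y := rfl

theorem pathProb_le_transition (h : Admissible U F G c) (hε : ε ∈ Set.Ioo (0 : ℝ) 1)
    (x : State U) (a : ∀ j, A j) (y : State U) :
    pathProb F G c ε x a y ≤ transition U F G c ε x y :=
  Finset.single_le_sum (f := fun a => pathProb F G c ε x a y)
    (fun b _ => pathProb_nonneg h hε x b y) (Finset.mem_univ a)

theorem prod_le_transition (h : Admissible U F G c) (hε : ε ∈ Set.Ioo (0 : ℝ) 1)
    (x : State U) (a : ∀ j, A j) (y : State U) {b : I → ℝ} (hb0 : ∀ i, 0 ≤ b i)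
    (hb : ∀ i, b i ≤ (x i).actionProb ε (a i) *
      (x i).updateLaw F G c ε (a i) (obs U a i) (y i)) :
    ∏ i, b i ≤ transition U F G c ε x y :=
  (Finset.prod_le_prod (fun i _ => hb0 i) fun i _ => hb i).trans
    (pathProb_le_transition h hε x a y)

theorem transition_le_of_forall {x y : State U} {b : ℝ}
    (hb : ∀ a, pathProb F G c ε x a y ≤ b) :
    transition U F G c ε x y ≤ Fintype.card (∀ j, A j) * b := by
  refine (Finset.sum_le_card_nsmul _ _ b fun a _ => hb a).trans_eq ?_
  rw [nsmul_eq_mul]; rfl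

theorem transition_nonneg (h : Admissible U F G c) (hε : ε ∈ Set.Ioo (0 : ℝ) 1) (x y : State U) :
    0 ≤ transition U F G c ε x y :=
  Finset.sum_nonneg fun a _ => pathProb_nonneg h hε x a y

theorem sum_pathProb (x : State U) (a : ∀ j, A j) :
    ∑ y, pathProb F G c ε x a y = ∏ i, (x i).actionProb ε (a i) := by
  simp only [pathProb]
  rw [← Fintype.piFinset_univ, ← Finset.prod_univ_sum (fun _ => Finset.univ) fun i t =>
    (x i).actionProb ε (a i) * (x i).updateLaw F G c ε (a i) (obs U a i) t]
  refine Finset.prod_congr rfl fun i _ => ?_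
  rw [← Finset.mul_sum, sum_updateLaw, mul_one]

theorem transition_mem_rowStochastic [∀ i, Nonempty (A i)] (h : Admissible U F G c)
    (hε : ε ∈ Set.Ioo (0 : ℝ) 1) : transition U F G c ε ∈ rowStochastic ℝ (State U) := by
  refine mem_rowStochastic_iff_sum.2 ⟨transition_nonneg h hε, fun x => ?_⟩
  simp only [transition_eq_sum]
  rw [Finset.sum_comm]
  simp only [sum_pathProb]
  rw [← Fintype.piFinset_univ, ← Finset.prod_univ_sum]
  exact Finset.prod_eq_one fun i _ => sum_actionProb ε (x i)

theorem exists_of_transition_ne_zero {x y : State U} (hxy : transition U F G c ε x y ≠ 0) :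
    ∃ a : ∀ j, A j, ∀ i, (x i).updateLaw F G c ε (a i) (obs U a i) (y i) ≠ 0 := by
  obtain ⟨a, -, ha⟩ := Finset.exists_ne_zero_of_sum_ne_zero hxy
  exact ⟨a, fun i => right_ne_zero_of_mul (Finset.prod_ne_zero_iff.1 ha i (Finset.mem_univ i))⟩

theorem util_le_of_transition_ne_zero {x y : State U} (hxy : transition U F G c ε x y ≠ 0) {i : I}
    (hx : x i ≠ discontent) (hy : y i ≠ discontent) : (x i).util ≤ (y i).util := by
  obtain ⟨a, ha⟩ := exists_of_transition_ne_zero hxy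
  exact util_le_of_updateLaw_ne_zero (ha i) hx hy

theorem potential_le_of_transition_ne_zero (h : Admissible U F G c) {x y : State U}
    (hxy : transition U F G c ε x y ≠ 0) (hx : ¬ HasDiscontent x) :
    potential F y ≤ potential F x := by
  obtain ⟨a, ha⟩ := exists_of_transition_ne_zero hxy
  exact Finset.sum_le_sum fun i _ =>
    pot_le_of_updateLaw_ne_zero (h.F_nonneg i) (h.F_anti i) (ha i) fun e => hx ⟨i, e⟩

/-- The price of raising the potential: the bounds for single agents multiply, and their exponents
add up to the change of potential. -/
theorem transition_le_rpow (h : Admissible U F G c) (hε : ε ∈ Set.Ioo (0 : ℝ) 1) (x y : State U) :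
    transition U F G c ε x y ≤
      Fintype.card (∀ j, A j) * ε ^ (potential F y - potential F x) := by
  refine transition_le_of_forall fun a => ?_
  rw [potential, potential, ← Finset.sum_sub_distrib,
    Real.rpow_sum_of_pos hε.1]
  refine Finset.prod_le_prod (fun i _ => factor_nonneg h hε x a y i) fun i _ => ?_
  have : Nonempty (A i) := ⟨a i⟩
  have hu := updateLaw_le_rpow h.c_mem hε (h.G_nonneg i) (h.F_nonneg i) (h.F_anti i)
    (x i) (a i) (obs U a i) (y i)
  exact (mul_le_of_le_one_left (updateLaw_nonneg h.c_mem hε (h.G_nonneg i) _ _ _ _)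
    (actionProb_le_one hε _ _)).trans hu

theorem quietBound_le_transition (h : Admissible U F G c) (hε : ε ∈ Set.Ioo (0 : ℝ) 1)
    {y z : State U} (hyz : QuietStep y z) : quietBound A c ε ≤ transition U F G c ε y z := by
  obtain ⟨a, rfl⟩ := hyz
  have h1 : 0 ≤ 1 - ε := by linarith [hε.2]
  have h2 : 0 ≤ 1 - c := by linarith [h.c_mem.2]
  refine prod_le_transition h hε y (play y a) _ (fun i => by positivity) fun i => ?_
  exact mul_le_mul (le_actionProb_act hε _ _) (le_updateLaw_next h.c_mem _ _ _) h2
    (actionProb_nonneg hε _ _)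

/-- Without discontent agents the update is deterministic once nobody explores, which has
probability at least `(1 - ε) ^ n` for `n` agents; then Bernoulli's inequality applies. -/
theorem one_sub_mul_le_transition_quiet (h : Admissible U F G c) (hε : ε ∈ Set.Ioo (0 : ℝ) 1)
    {y : State U} (hy : ¬ HasDiscontent y) (a : ∀ j, A j) :
    1 - Fintype.card I * ε ≤ transition U F G c ε y (quiet y a) := by
  have h1 : 0 ≤ 1 - ε := by linarith [hε.2]
  have hy' : ∀ i, y i ≠ discontent := fun i e => hy ⟨i, e⟩
  have h2 : ∏ _i : I, (1 - ε) ≤ transition U F G c ε y (quiet y a) := by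
    refine prod_le_transition h hε y (play y a) _ (fun i => h1) fun i => ?_
    have h3 := updateLaw_next (F := F) (G := G) (c := c) (ε := ε) (hy' i) (a i)
      (obs U (play y a) i)
    have h4 := one_sub_le_actionProb_act hε (hy' i) (a i)
    calc 1 - ε ≤ (y i).actionProb ε (play y a i) * 1 := by rw [mul_one]; exact h4
      _ = _ := by rw [← h3]; rfl
  refine le_trans ?_ h2
  rw [Finset.prod_const, Finset.card_univ]
  have := one_add_mul_le_pow (a := -ε) (by linarith [hε.2]) (Fintype.card I)
  calc 1 - (Fintype.card I : ℝ) * ε = 1 + Fintype.card I * -ε := by ring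
    _ ≤ _ := this
    _ = _ := by rw [← sub_eq_add_neg]

theorem transition_pos_of_reflTransGen [∀ i, Nonempty (A i)] (h : Admissible U F G c)
    (hε : ε ∈ Set.Ioo (0 : ℝ) 1) {y z : State U} (hyz : Relation.ReflTransGen QuietStep y z) :
    Relation.ReflTransGen (fun x y => 0 < transition U F G c ε x y) y z :=
  Relation.ReflTransGen.mono (fun _ _ h' =>
    (quietBound_pos h.c_mem hε).trans_le (quietBound_le_transition h hε h'))
    _ _ hyz

/-- From a state with a discontent agent, everybody becomes discontent within a fixed number of
steps, with a probability bounded below as `ε → 0`. -/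
theorem exists_le_pow_allDiscontent [∀ i, Nonempty (A i)] (h : Admissible U F G c)
    (hinter : Interdependent U) :
    ∃ K : ℕ, ∃ κ > 0, ∀ ε ∈ Set.Ioc (0 : ℝ) (1 / 2), ∀ y : State U, HasDiscontent y →
      κ ≤ (transition U F G c ε ^ K) y (allDiscontent U) := by
  set κ := quietBound A c (1 / 2)
  have hκ : 0 < κ := quietBound_pos h.c_mem (by norm_num)
  have hIoo : ∀ ε ∈ Set.Ioc (0 : ℝ) (1 / 2), ε ∈ Set.Ioo (0 : ℝ) 1 := fun ε hε =>
    ⟨hε.1, by linarith [hε.2]⟩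
  have hstep : ∀ ε ∈ Set.Ioc (0 : ℝ) (1 / 2), ∀ y z : State U, QuietStep y z →
      κ ≤ transition U F G c ε y z := fun ε hε y z hyz =>
    (quietBound_anti h.c_mem hε.2 (by norm_num)).trans
      (quietBound_le_transition h (hIoo ε hε) hyz)
  have hpad : ∀ ε ∈ Set.Ioc (0 : ℝ) (1 / 2), ∀ m (y z : State U), QuietStep y z →
      κ ^ m ≤ (transition U F G c ε ^ m) z (allDiscontent U) →
      κ ^ (m + 1) ≤ (transition U F G c ε ^ (m + 1)) y (allDiscontent U) := by
    intro ε hε m y z hyz hm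
    refine le_trans ?_ (mul_le_pow_succ_apply
      (transition_mem_rowStochastic h (hIoo ε hε)) m y z _)
    rw [pow_succ']
    exact mul_le_mul (hstep ε hε y z hyz) hm (by positivity)
      (transition_nonneg h (hIoo ε hε) y z)
  -- Universal discontent can persist by quiet steps, so paths can be padded: the bound holds for
  -- all lengths from some point on, and a common length serves all states.
  have hreach : ∀ y : State U, Relation.ReflTransGen QuietStep y (allDiscontent U) →
      ∃ k : ℕ, ∀ m ≥ k, ∀ ε ∈ Set.Ioc (0 : ℝ) (1 / 2),
        κ ^ m ≤ (transition U F G c ε ^ m) y (allDiscontent U) := by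
    intro y hy
    induction hy using Relation.ReflTransGen.head_induction_on with
    | refl =>
      refine ⟨0, fun m _ ε hε => ?_⟩
      induction m with
      | zero => simp
      | succ m ih =>
        exact hpad ε hε m _ _ ⟨fun _ => Classical.arbitrary _, rfl⟩ (ih (Nat.zero_le m))
    | @head y z hyz _ ih =>
      obtain ⟨k, hk⟩ := ih
      refine ⟨k + 1, fun m hm ε hε => ?_⟩
      obtain ⟨m, rfl⟩ := Nat.exists_eq_add_of_le' hm
      exact hpad ε hε (m + k) y z hyz (hk _ (Nat.le_add_left k m) ε hε)
  have hex : ∀ y : State U, ∃ k : ℕ, HasDiscontent y → ∀ m ≥ k, ∀ ε ∈ Set.Ioc (0 : ℝ) (1 / 2),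
        κ ^ m ≤ (transition U F G c ε ^ m) y (allDiscontent U) := fun y => by
    by_cases hy : HasDiscontent y
    · exact (hreach y (reflTransGen_allDiscontent hinter hy)).imp fun k hk _ => hk
    · exact ⟨0, fun hy' => absurd hy' hy⟩
  choose k hk using hex
  exact ⟨Finset.univ.sup k, κ ^ Finset.univ.sup k, by positivity, fun ε hε y hy =>
    hk y hy _ (Finset.le_sup (Finset.mem_univ y)) ε hε⟩

end Transition

/-! ### Leaving aligned states -/

section Aligned

open AgentState Matrix

variable {I : Type*} {A : I → Type*} {U : I → (∀ j, A j) → ℝ} {F : ℝ → ℝ} {G : ℝ → ℝ → ℝ}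
  {c ε : ℝ}

theorem alignedState_apply (a : ∀ j, A j) (i : I) :
    alignedState U a i = content (a i) (obs U a i) := rfl

theorem not_hasDiscontent_alignedState (a : ∀ j, A j) : ¬ HasDiscontent (alignedState U a) := by
  rintro ⟨i, hi⟩
  simp [alignedState] at hi

theorem potential_alignedState [Fintype I] (a : ∀ j, A j) :
    potential F (alignedState U a) = ∑ i, F (U i a) := rfl

theorem potential_allDiscontent [Fintype I] : potential F (allDiscontent U) = 0 :=
  Finset.sum_eq_zero fun _ _ => rfl

/-- One unusual observation makes a content agent at most hopeful or watchful, and seeing the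
benchmark utility again undoes this. Hence isolated explorations are harmless. -/
theorem AgentState.next_content {α : Type*} {R : Set ℝ} (a₀ : α) (v u : R) :
    next (content a₀ v) u ≠ discontent ∧ (∀ d, (next (content a₀ v) u).act d = a₀) ∧
      next (next (content a₀ v) u) v = content a₀ v ∧
      (next (content a₀ v) u).util = v := by
  simp only [next]
  split_ifs <;> simp [act, util]

/-- States that return to the aligned state of `a` in one quiet step. -/
def basin (U : I → (∀ j, A j) → ℝ) (a : ∀ j, A j) : Set (State U) :=
  {y | ¬ HasDiscontent y ∧ ∀ b, quiet y b = alignedState U a}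

theorem mem_basin {a : ∀ j, A j} {y : State U}
    (h : ∀ k, ∃ u, y k = next (content (a k) (obs U a k)) u) : y ∈ basin U a := by
  have hact : ∀ b, play y b = a := fun b => funext fun k => by
    obtain ⟨u, hu⟩ := h k
    simp only [play, hu]
    exact (next_content _ _ _).2.1 _
  refine ⟨?_, fun b => funext fun k => ?_⟩
  · rintro ⟨k, hk⟩
    obtain ⟨u, hu⟩ := h k
    exact (next_content _ _ _).1 (hu.symm.trans hk)
  · obtain ⟨u, hu⟩ := h k
    simp only [quiet, hact, hu]
    exact (next_content _ _ _).2.2.1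

theorem content_eq_next {α : Type*} {R : Set ℝ} (a₀ : α) (v : R) :
    content a₀ v = next (content a₀ v) v := by
  simp [next]

open Classical in
/-- The order in `ε` of the probability to leave the aligned state of `a`. -/
noncomputable def exitCost [DecidableEq I] (U : I → (∀ j, A j) → ℝ) (G : ℝ → ℝ → ℝ)
    (a : ∀ j, A j) : ℝ :=
  if IsEquilibrium U a then 2 else 2 - virtualStability U G a

/-- The resistances of the profitable deviations from `a`. -/
def deviationCosts [DecidableEq I] (U : I → (∀ j, A j) → ℝ) (G : ℝ → ℝ → ℝ)
    (a : ∀ j, A j) : Set ℝ :=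
  {g | ∃ (i : I) (b : A i), b ≠ a i ∧ U i a < U i (Function.update a i b) ∧
    g = G (U i a) (U i (Function.update a i b))}

theorem finite_deviationCosts [Finite I] [DecidableEq I] [∀ i, Finite (A i)] (a : ∀ j, A j) :
    (deviationCosts U G a).Finite := by
  refine (Set.finite_range fun p : (Σ i, A i) =>
    G (U p.1 a) (U p.1 (Function.update a p.1 p.2))).subset ?_
  rintro g ⟨i, b, -, -, rfl⟩
  exact ⟨⟨i, b⟩, rfl⟩

theorem deviationCosts_nonempty [DecidableEq I] {a : ∀ j, A j} (ha : ¬ IsEquilibrium U a) :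
    (deviationCosts U G a).Nonempty := by
  simp only [IsEquilibrium, not_forall, not_le] at ha
  obtain ⟨i, b, hb, hlt⟩ := ha
  exact ⟨_, i, b, hb, hlt, rfl⟩

theorem exitCost_of_not_isEquilibrium [DecidableEq I] {a : ∀ j, A j}
    (ha : ¬ IsEquilibrium U a) : exitCost U G a = 1 + sInf (deviationCosts U G a) := by
  rw [exitCost, if_neg ha, virtualStability, deviationCosts]
  ring

theorem exists_exitCost_eq [Finite I] [DecidableEq I] [∀ i, Finite (A i)] {a : ∀ j, A j}
    (ha : ¬ IsEquilibrium U a) : ∃ (i : I) (b : A i), b ≠ a i ∧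
      U i a < U i (Function.update a i b) ∧
      exitCost U G a = 1 + G (U i a) (U i (Function.update a i b)) := by
  obtain ⟨i, b, hb, hlt, hg⟩ :=
    (deviationCosts_nonempty (G := G) ha).csInf_mem (finite_deviationCosts a)
  exact ⟨i, b, hb, hlt, by rw [exitCost_of_not_isEquilibrium ha, hg]⟩

theorem exitCost_le [Finite I] [DecidableEq I] [∀ i, Finite (A i)] {a : ∀ j, A j} {i : I}
    {b : A i} (hb : b ≠ a i) (hlt : U i a < U i (Function.update a i b)) :
    exitCost U G a ≤ 1 + G (U i a) (U i (Function.update a i b)) := by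
  have ha : ¬ IsEquilibrium U a := fun h => (h i b hb).not_gt hlt
  rw [exitCost_of_not_isEquilibrium ha]
  exact add_le_add le_rfl (csInf_le (finite_deviationCosts a).bddBelow ⟨i, b, hb, hlt, rfl⟩)

theorem factor_aligned_le [∀ i, Fintype (A i)] (h : Admissible U F G c)
    (hε : ε ∈ Set.Ioo (0 : ℝ) 1) {a b : ∀ j, A j} {y : State U} {i : I} (hi : b i ≠ a i) :
    (alignedState U a i).actionProb ε (b i) *
      (alignedState U a i).updateLaw F G c ε (b i) (obs U b i) (y i) ≤
    ε * (alignedState U a i).updateLaw F G c ε (b i) (obs U b i) (y i) :=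
  mul_le_mul_of_nonneg_right (actionProb_content_le hε _ hi)
    (updateLaw_nonneg h.c_mem hε (h.G_nonneg i) _ _ _ _)

variable [Fintype I] [DecidableEq I] [∀ i, Fintype (A i)]

theorem pathProb_le_factor (h : Admissible U F G c) (hε : ε ∈ Set.Ioo (0 : ℝ) 1)
    (x : State U) (a : ∀ j, A j) (y : State U) (i : I) :
    pathProb F G c ε x a y ≤
      (x i).actionProb ε (a i) * (x i).updateLaw F G c ε (a i) (obs U a i) (y i) := by
  rw [pathProb, ← Finset.mul_prod_erase _ _ (Finset.mem_univ i)]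
  exact mul_le_of_le_one_right (factor_nonneg h hε x a y i)
    (Finset.prod_le_one (fun j _ => factor_nonneg h hε x a y j)
      fun j _ => factor_le_one h hε x a y j)

theorem pathProb_le_mul_factor (h : Admissible U F G c) (hε : ε ∈ Set.Ioo (0 : ℝ) 1)
    (x : State U) (a : ∀ j, A j) (y : State U) {i j : I} (hij : j ≠ i) :
    pathProb F G c ε x a y ≤
      ((x i).actionProb ε (a i) * (x i).updateLaw F G c ε (a i) (obs U a i) (y i)) *
      ((x j).actionProb ε (a j) * (x j).updateLaw F G c ε (a j) (obs U a j) (y j)) := by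
  rw [pathProb, ← Finset.mul_prod_erase _ _ (Finset.mem_univ i)]
  refine mul_le_mul_of_nonneg_left ?_ (factor_nonneg h hε x a y i)
  rw [← Finset.mul_prod_erase _ _ (Finset.mem_erase.2 ⟨hij, Finset.mem_univ j⟩)]
  exact mul_le_of_le_one_right (factor_nonneg h hε x a y j)
    (Finset.prod_le_one (fun j _ => factor_nonneg h hε x a y j)
      fun j _ => factor_le_one h hε x a y j)

/-- Leaving the basin of an aligned state takes two explorations or a profitable deviation. -/
theorem transition_aligned_le_of_notMem_basin (h : Admissible U F G c)
    (hε : ε ∈ Set.Ioo (0 : ℝ) 1) {a : ∀ j, A j} (hexit : exitCost U G a ≤ 2) {y : State U}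
    (hy : y ∉ basin U a) :
    transition U F G c ε (alignedState U a) y ≤
      Fintype.card (∀ j, A j) * ε ^ exitCost U G a := by
  refine transition_le_of_forall fun b => ?_
  have hpos := Real.rpow_pos_of_pos hε.1 (exitCost U G a)
  by_cases h0 : pathProb F G c ε (alignedState U a) b y = 0
  · rw [h0]; exact hpos.le
  have hu : ∀ i, updateLaw F G c ε (content (a i) (obs U a i)) (b i) (obs U b i) (y i) ≠ 0 :=
    fun i => right_ne_zero_of_mul (Finset.prod_ne_zero_iff.1 h0 i (Finset.mem_univ i))
  have hstay : ∀ k, b k = a k → ∃ u, y k = next (content (a k) (obs U a k)) u := fun k hk => by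
    rcases updateLaw_content_ne_zero (hu k) with h1 | h1 | h1
    · exact absurd hk h1.1
    · exact absurd hk h1.1
    · exact ⟨_, h1.2⟩
  -- Outside the basin, the new state of some agent `i` is not the effect of a mere observation, so
  -- `i` has explored.
  obtain ⟨i, hi⟩ : ∃ i, ¬ ∃ u, y i = next (content (a i) (obs U a i)) u := by
    by_contra hcon
    exact hy (mem_basin fun k => not_not.1 fun hk => hcon ⟨k, hk⟩)
  have hbi : b i ≠ a i := fun e => hi (hstay i e)
  -- A second explorer gives the factor `ε ^ 2`. If `i` explores alone, it must have accepted, and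
  -- its deviation is one of those over which `exitCost` is minimized.
  by_cases hj : ∃ j, j ≠ i ∧ b j ≠ a j
  · obtain ⟨j, hji, hbj⟩ := hj
    have hle : ∀ k, b k ≠ a k → (alignedState U a k).actionProb ε (b k) *
        (alignedState U a k).updateLaw F G c ε (b k) (obs U b k) (y k) ≤ ε := fun k hk =>
      (factor_aligned_le h hε hk).trans (mul_le_of_le_one_right hε.1.le
        (updateLaw_le_one h.c_mem hε (h.G_nonneg k) _ _ _ _))
    calc pathProb F G c ε (alignedState U a) b y ≤ ε * ε :=
          (pathProb_le_mul_factor h hε _ b y hji).trans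
            (mul_le_mul (hle i hbi) (hle j hbj) (factor_nonneg h hε _ b y j) hε.1.le)
      _ = ε ^ (2 : ℝ) := by rw [Real.rpow_two, sq]
      _ ≤ _ := Real.rpow_le_rpow_of_exponent_ge hε.1 hε.2.le hexit
  · have hb : b = Function.update a i (b i) := by
      funext k
      by_cases hk : k = i
      · subst hk; simp
      · rw [Function.update_of_ne hk]
        exact not_not.1 fun e => hj ⟨k, hk, e⟩
    rcases updateLaw_content_ne_zero (hu i) with ⟨_, hlt, _, heq⟩ | ⟨_, h1⟩ | ⟨h1, _⟩
    · calc pathProb F G c ε (alignedState U a) b y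
          ≤ ε * ε ^ G (obs U a i) (obs U b i) :=
            (pathProb_le_factor h hε _ b y i).trans
              ((factor_aligned_le h hε hbi).trans_eq (by rw [alignedState_apply, heq]))
        _ = ε ^ (1 + G (obs U a i) (obs U b i)) := by
            rw [Real.rpow_add hε.1, Real.rpow_one]
        _ ≤ _ := by
            refine Real.rpow_le_rpow_of_exponent_ge hε.1 hε.2.le ?_
            have := exitCost_le (G := G) (U := U) hbi (by rw [← hb]; exact hlt)
            rwa [← hb] at this
    · exact absurd ⟨_, h1.trans (content_eq_next _ _)⟩ hi
    · exact absurd h1 hbi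

/-- Without exploration an aligned state reproduces itself, so any move contains a factor at most
`ε`. -/
theorem transition_aligned_le_of_ne (h : Admissible U F G c) (hε : ε ∈ Set.Ioo (0 : ℝ) 1)
    {a : ∀ j, A j} {y : State U} (hy : y ≠ alignedState U a) :
    transition U F G c ε (alignedState U a) y ≤ Fintype.card (∀ j, A j) * ε := by
  refine transition_le_of_forall fun b => ?_
  by_cases h0 : pathProb F G c ε (alignedState U a) b y = 0
  · rw [h0]; exact hε.1.le
  have hu : ∀ i, updateLaw F G c ε (content (a i) (obs U a i)) (b i) (obs U b i) (y i) ≠ 0 :=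
    fun i => right_ne_zero_of_mul (Finset.prod_ne_zero_iff.1 h0 i (Finset.mem_univ i))
  obtain ⟨i, hi⟩ : ∃ i, b i ≠ a i := by
    by_contra hcon
    have hb : b = a := funext fun i => not_not.1 fun hi => hcon ⟨i, hi⟩
    refine hy (funext fun i => ?_)
    rcases updateLaw_content_ne_zero (hu i) with h1 | h1 | h1
    · exact absurd (congrFun hb i) h1.1
    · exact absurd (congrFun hb i) h1.1
    · rw [h1.2, hb]; exact (content_eq_next _ _).symm
  exact (pathProb_le_factor h hε _ b y i).trans ((factor_aligned_le h hε hi).trans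
    (mul_le_of_le_one_right hε.1.le (updateLaw_le_one h.c_mem hε (h.G_nonneg i) _ _ _ _)))

/-- The state of universal discontent leads to every aligned state. -/
theorem le_transition_allDiscontent (h : Admissible U F G c) (hε : ε ∈ Set.Ioo (0 : ℝ) 1)
    (a : ∀ j, A j) :
    (∏ i, c / Fintype.card (A i)) * ε ^ potential F (alignedState U a) ≤
      transition U F G c ε (allDiscontent U) (alignedState U a) := by
  have hc := h.c_mem.1
  rw [potential, Real.rpow_sum_of_pos hε.1, ← Finset.prod_mul_distrib]
  refine prod_le_transition h hε _ a _ (fun i => ?_) fun i => ?_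
  · exact mul_nonneg (by positivity) (Real.rpow_nonneg hε.1.le _)
  · have := le_updateLaw_accept (G := G) h.c_mem hε (a i) (h.F_nonneg i (obs U a i))
    calc c / Fintype.card (A i) * ε ^ (alignedState U a i).pot F
        = 1 / Fintype.card (A i) * (c * ε ^ F (obs U a i)) := by
          simp only [alignedState_apply, pot]; ring
      _ ≤ _ := mul_le_mul_of_nonneg_left this (by positivity)

/-- A transition in which exactly agent `i` explores. -/
theorem explore_le_transition (h : Admissible U F G c) (hε : ε ∈ Set.Ioo (0 : ℝ) 1)
    {y z : State U} {a : ∀ j, A j} {i : I} {b : A i} {v : Set.range (U i)} {ρ : ℝ}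
    (hb : b ≠ a i) (hyi : y i = content (a i) v) (hv : (v : ℝ) < 1)
    (hy : ∀ k, k ≠ i → y k ≠ discontent ∧ ∀ d, (y k).act d = a k)
    (hz : ∀ k, k ≠ i → z k = (y k).next (obs U (Function.update a i b) k))
    (hρ0 : 0 ≤ ρ)
    (hρ : ρ ≤ updateLaw F G c ε (content (a i) v) b (obs U (Function.update a i b) i) (z i)) :
    (1 - ε) ^ Fintype.card I * (ε / Fintype.card (A i) * ρ) ≤ transition U F G c ε y z := by
  have h1 : 0 ≤ 1 - ε := by linarith [hε.2]
  have h0 := hε.1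
  have hnn : 0 ≤ ε / Fintype.card (A i) * ρ := by positivity
  have hprod : ∏ k, ((1 - ε) * if k = i then ε / Fintype.card (A i) * ρ else 1) =
      (1 - ε) ^ Fintype.card I * (ε / Fintype.card (A i) * ρ) := by
    rw [Finset.prod_mul_distrib, Finset.prod_const, Finset.card_univ, Finset.prod_ite_eq']
    simp
  rw [← hprod]
  refine prod_le_transition h hε y (Function.update a i b) z (fun k => ?_) fun k => ?_
  · refine mul_nonneg h1 ?_
    split_ifs
    exacts [hnn, zero_le_one]
  · by_cases hk : k = i
    · subst hk
      rw [if_pos rfl, hyi, Function.update_self]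
      refine (mul_le_of_le_one_left hnn (by linarith)).trans ?_
      exact mul_le_mul (le_actionProb_content hε hb hv) hρ hρ0 (actionProb_nonneg hε _ _)
    · obtain ⟨hk1, hk2⟩ := hy k hk
      rw [if_neg hk, Function.update_of_ne hk, hz k hk]
      have h3 := updateLaw_next (F := F) (G := G) (c := c) (ε := ε) hk1 (a k)
        (obs U (Function.update a i b) k)
      have h4 := one_sub_le_actionProb_act hε hk1 (a k)
      rw [hk2] at h3 h4
      rw [h3]
      exact mul_le_mul_of_nonneg_right h4 zero_le_one

end Aligned

/-! ### Escape from aligned states, and accessibility of universal discontent or an optimal state -/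

section Escape

open AgentState Matrix

variable {I : Type*} {A : I → Type*} {U : I → (∀ j, A j) → ℝ} {F : ℝ → ℝ} {G : ℝ → ℝ → ℝ}
  {c ε : ℝ} [Fintype I] [DecidableEq I] [∀ i, Fintype (A i)]

/-- From an aligned state that is not an equilibrium, a profitable deviation is accepted with a
probability of order `ε ^ exitCost U G a`. -/
theorem exists_escape_of_not_isEquilibrium (h : Admissible U F G c)
    (hU : ∀ i a, U i a ∈ Set.Icc (0 : ℝ) 1) {a : ∀ j, A j} (ha : ¬ IsEquilibrium U a) :
    ∃ y : State U, (∃ i, U i a < (y i).util) ∧ (∀ i, U i a ≤ (y i).util) ∧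
      ∃ κ > 0, ∀ ε ∈ Set.Ioo (0 : ℝ) 1, κ * (1 - ε) ^ Fintype.card I * ε ^ exitCost U G a ≤
        transition U F G c ε (alignedState U a) y := by
  obtain ⟨i, b, hb, hlt, hcost⟩ := exists_exitCost_eq (G := G) ha
  set b' := Function.update a i b with hb'
  -- Agent `i` accepts its deviation; the others merely register the observation and keep their
  -- benchmarks.
  let y : State U := Function.update
    (fun k => (alignedState U a k).next (obs U b' k)) i (content b (obs U b' i))
  have hyi : y i = content b (obs U b' i) := Function.update_self ..
  have hyk : ∀ k, k ≠ i → y k = (alignedState U a k).next (obs U b' k) := fun k hk =>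
    Function.update_of_ne hk ..
  have hutil : U i a < (y i).util := by rw [hyi]; exact hlt
  refine ⟨y, ⟨i, hutil⟩, fun k => ?_, 1 / Fintype.card (A i), ?_, fun ε hε => ?_⟩
  · by_cases hk : k = i
    · subst hk; exact hutil.le
    · rw [hyk k hk]; exact (next_content (a k) (obs U a k) (obs U b' k)).2.2.2.ge
  · have : Nonempty (A i) := ⟨b⟩
    have : (0 : ℝ) < Fintype.card (A i) := by exact_mod_cast Fintype.card_pos
    positivity
  · have := explore_le_transition (y := alignedState U a) (z := y) (a := a) (v := obs U a i)
      (ρ := ε ^ G (obs U a i) (obs U b' i)) h hε hb rfl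
      (lt_of_lt_of_le hlt (hU i _).2)
      (fun k _ => ⟨fun e => not_hasDiscontent_alignedState a ⟨k, e⟩, fun d => rfl⟩) hyk
      (Real.rpow_nonneg hε.1.le _)
      (by rw [hyi]; exact (updateLaw_content_accept hb hlt).ge)
    refine le_trans (le_of_eq ?_) this
    rw [hcost, Real.rpow_add hε.1, Real.rpow_one]
    simp only [obs]
    ring

/-- From a suboptimal aligned equilibrium state, exploring twice makes an agent discontent or
raises a benchmark utility. -/
theorem exists_escape_of_isEquilibrium [∀ i, Nonempty (A i)] [Nontrivial I]
    (h : Admissible U F G c)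
    (hinter : Interdependent U) {a : ∀ j, A j} (ha : IsEquilibrium U a) {i : I}
    (hi : U i a < 1) :
    ∃ y : State U, (HasDiscontent y ∨ (∃ i, U i a < (y i).util) ∧ ∀ i, U i a ≤ (y i).util) ∧
      ∃ κ > 0, ∀ ε ∈ Set.Ioo (0 : ℝ) 1,
        κ * (1 - ε) ^ (Fintype.card I * 2) * ε ^ exitCost U G a ≤
          (transition U F G c ε ^ 2) (alignedState U a) y := by
  -- By interdependence some deviation of `i` alone changes the utility of another agent `j`. At an
  -- equilibrium `i` rejects it and can repeat it, so `j` makes the same unusual observation twice: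
  -- it becomes discontent, or adopts a higher benchmark unless it is discontent. The two
  -- explorations cost `ε ^ 2`.
  obtain ⟨l, hl⟩ := exists_ne i
  obtain ⟨j, hj, b₀, hb₀⟩ := hinter a {i} (Finset.singleton_nonempty i) ⟨l, by simpa using hl⟩
  rw [Finset.piecewise_singleton] at hb₀
  have hji : j ≠ i := by simpa using hj
  set b := b₀ i
  have hb : b ≠ a i := fun e => hb₀ (by rw [e, Function.update_eq_self])
  set b' := Function.update a i b with hb'
  let y : State U := Function.update
    (fun k => (alignedState U a k).next (obs U b' k)) i (alignedState U a i)
  let z : State U := Function.update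
    (fun k => (y k).next (obs U b' k)) i (alignedState U a i)
  have hyi : y i = alignedState U a i := Function.update_self ..
  have hyk : ∀ k, k ≠ i → y k = (alignedState U a k).next (obs U b' k) := fun k hk =>
    Function.update_of_ne hk ..
  have hzi : z i = alignedState U a i := Function.update_self ..
  have hzk : ∀ k, k ≠ i → z k = (y k).next (obs U b' k) := fun k hk =>
    Function.update_of_ne hk ..
  have hyu : ∀ k, (y k).util = U k a := fun k => by
    by_cases hk : k = i
    · subst hk; rw [hyi]; rfl
    · rw [hyk k hk]; exact (next_content _ _ _).2.2.2
  refine ⟨z, ?_, 1 / Fintype.card (A i) * (1 / Fintype.card (A i)), ?_, fun ε hε => ?_⟩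
  · by_cases hD : HasDiscontent z
    · exact Or.inl hD
    refine Or.inr ⟨⟨j, ?_⟩, fun k => ?_⟩
    · rw [hzk j hji, hyk j hji]
      rcases lt_or_gt_of_ne hb₀ with h1 | h1
      · refine absurd ⟨j, ?_⟩ hD
        rw [hzk j hji, hyk j hji]
        exact next_next_of_gt (not_hasDiscontent_alignedState a ⟨j, ·⟩) h1
      · rw [next_next_of_lt (s := alignedState U a j) (u := obs U b' j)
          (not_hasDiscontent_alignedState a ⟨j, ·⟩) h1 (a j)]
        exact h1
    · by_cases hk : k = i
      · subst hk; rw [hzi]; exact le_rfl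
      · have h1 : (y k).next (obs U b' k) ≠ discontent := fun e =>
          hD ⟨k, (hzk k hk).trans e⟩
        rw [hzk k hk, ← hyu k]
        exact util_le_util_next h1 (a k)
  · have : (0 : ℝ) < Fintype.card (A i) := by exact_mod_cast Fintype.card_pos
    positivity
  · have hrej : 1 ≤ updateLaw F G c ε (content (a i) (obs U a i)) b (obs U b' i)
        (content (a i) (obs U a i)) := (updateLaw_content_reject hb (ha i b hb)).ge
    have h1 := explore_le_transition (y := alignedState U a) (z := y) (a := a) (v := obs U a i)
      (ρ := 1) h hε hb rfl hi
      (fun k _ => ⟨fun e => not_hasDiscontent_alignedState a ⟨k, e⟩, fun d => rfl⟩) hyk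
      zero_le_one (by rw [hyi]; exact hrej)
    have h2 := explore_le_transition (y := y) (z := z) (a := a) (v := obs U a i)
      (ρ := 1) h hε hb hyi hi
      (fun k hk => by
        rw [hyk k hk]
        exact ⟨(next_content _ _ _).1, (next_content _ _ _).2.1⟩) hzk
      zero_le_one (by rw [hzi]; exact hrej)
    have h3 := mul_le_pow_succ_apply (transition_mem_rowStochastic h hε) 1 (alignedState U a) y z
    rw [pow_one] at h3
    have h4 : 0 ≤ 1 - ε := by linarith [hε.2]
    have h5 := hε.1
    have h6 := mul_le_mul h1 h2 (by positivity) (transition_nonneg h hε _ _)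
    refine le_trans (le_of_eq ?_) (h6.trans h3)
    rw [exitCost, if_pos ha, Real.rpow_two]
    ring

theorem exists_escape [∀ i, Nonempty (A i)] [Nontrivial I] (h : Admissible U F G c)
    (hU : ∀ i a, U i a ∈ Set.Icc (0 : ℝ) 1) (hinter : Interdependent U) {a : ∀ j, A j}
    (ha : ¬ ∀ i, U i a = 1) :
    ∃ y : State U, (HasDiscontent y ∨ (∃ i, U i a < (y i).util) ∧ ∀ i, U i a ≤ (y i).util) ∧
      ∃ κ > 0, ∃ m k : ℕ, ∀ ε ∈ Set.Ioo (0 : ℝ) 1,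
        κ * (1 - ε) ^ m * ε ^ exitCost U G a ≤
          (transition U F G c ε ^ k) (alignedState U a) y := by
  by_cases heq : IsEquilibrium U a
  · obtain ⟨i, hi⟩ := not_forall.1 ha
    obtain ⟨y, hy, κ, hκ, hle⟩ := exists_escape_of_isEquilibrium h hinter heq
      (lt_of_le_of_ne (hU i a).2 hi)
    exact ⟨y, hy, κ, hκ, _, 2, hle⟩
  · obtain ⟨y, hy1, hy2, κ, hκ, hle⟩ := exists_escape_of_not_isEquilibrium h hU heq
    exact ⟨y, Or.inr ⟨hy1, hy2⟩, κ, hκ, _, 1, by simpa using hle⟩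

theorem reflTransGen_of_pow_pos {X : Type*} [Fintype X] [DecidableEq X] {P : Matrix X X ℝ}
    (hP : P ∈ rowStochastic ℝ X) {k : ℕ} {x y : X} (hk : 0 < (P ^ k) x y) :
    Relation.ReflTransGen (fun x y => 0 < P x y) x y := by
  induction k generalizing y with
  | zero =>
    have : x = y := by
      by_contra hne
      simp [one_apply, hne] at hk
    rw [this]
  | succ k ih =>
    rw [pow_succ, mul_apply] at hk
    obtain ⟨z, -, hz⟩ := Finset.exists_ne_zero_of_sum_ne_zero hk.ne'
    have h1 := (nonneg_of_mem_rowStochastic (pow_mem hP k)).lt_of_ne' (left_ne_zero_of_mul hz)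
    have h2 := (nonneg_of_mem_rowStochastic hP).lt_of_ne' (right_ne_zero_of_mul hz)
    exact (ih h1).tail h2

/-- Every state leads to universal discontent or to an optimal state. -/
theorem exists_reflTransGen_allDiscontent_or_optimal [∀ i, Nonempty (A i)] [Nontrivial I]
    (h : Admissible U F G c) (hε : ε ∈ Set.Ioo (0 : ℝ) 1)
    (hU : ∀ i a, U i a ∈ Set.Icc (0 : ℝ) 1) (hinter : Interdependent U) (y : State U) :
    ∃ z, Relation.ReflTransGen (fun x y => 0 < transition U F G c ε x y) y z ∧
      (z = allDiscontent U ∨ z ∈ optimalStates U) := by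
  have hP := transition_mem_rowStochastic h hε
  have hD : ∀ y : State U, HasDiscontent y →
      Relation.ReflTransGen (fun x y => 0 < transition U F G c ε x y) y (allDiscontent U) :=
    fun y hy => transition_pos_of_reflTransGen h hε (reflTransGen_allDiscontent hinter hy)
  -- Induction on the sum of benchmark utilities, which takes finitely many values: every escape
  -- that creates no discontent raises it.
  let r : State U → State U → Prop := fun x y => ∑ i, (y i).util < ∑ i, (x i).util
  have : IsTrans (State U) r := ⟨fun _ _ _ h1 h2 => lt_trans h2 h1⟩
  have : Std.Irrefl r := ⟨fun _ => lt_irrefl _⟩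
  have hwf : WellFounded r := Finite.wellFounded_of_trans_of_irrefl r
  induction y using hwf.induction with
  | _ y ih =>
    obtain ⟨z, hyz, hz⟩ := exists_reflTransGen_aligned y
    have hyz' := transition_pos_of_reflTransGen h hε hyz
    rcases hz with hz | ⟨a, rfl, hle⟩
    · exact ⟨_, hyz'.trans (hD z hz), Or.inl rfl⟩
    by_cases hopt : ∀ i, U i a = 1
    · exact ⟨_, hyz', Or.inr ⟨a, rfl, hopt⟩⟩
    obtain ⟨w, hw, κ, hκ, m, k, hk⟩ := exists_escape h hU hinter hopt
    have hpos : 0 < (transition U F G c ε ^ k) (alignedState U a) w := by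
      refine lt_of_lt_of_le ?_ (hk ε hε)
      have h1 : 0 < 1 - ε := by linarith [hε.2]
      have h2 := Real.rpow_pos_of_pos hε.1 (exitCost U G a)
      positivity
    have hyw := hyz'.trans (reflTransGen_of_pow_pos hP hpos)
    rcases hw with hw | ⟨⟨i, hi⟩, hw⟩
    · exact ⟨_, hyw.trans (hD w hw), Or.inl rfl⟩
    · obtain ⟨z, hz, h'⟩ := ih w (Finset.sum_lt_sum (fun j _ => (hle j).trans (hw j))
        ⟨i, Finset.mem_univ i, (hle i).trans_lt hi⟩)
      exact ⟨z, hyw.trans hz, h'⟩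

/-- Content agents with benchmark utility `1` do not explore, and at an aligned state they observe
exactly their benchmark. -/
theorem transition_optimal (h : Admissible U F G c) [∀ i, Nonempty (A i)]
    (hε : ε ∈ Set.Ioo (0 : ℝ) 1) {x : State U} (hx : x ∈ optimalStates U) :
    transition U F G c ε x x = 1 := by
  obtain ⟨a, rfl, ha⟩ := hx
  have hP := transition_mem_rowStochastic h hε
  refine le_antisymm (le_one_of_mem_rowStochastic hP) (le_trans ?_
    (pathProb_le_transition h hε (alignedState U a) a _))
  refine (Finset.prod_eq_one fun i _ => ?_).ge
  have h1 : updateLaw F G c ε (content (a i) (obs U a i)) (a i) (obs U a i)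
      (content (a i) (obs U a i)) = 1 := by
    simp [updateLaw]
  have h2 : actionProb ε (content (a i) (obs U a i)) (a i) = 1 := by
    simp [actionProb, obs, ha i]
  rw [alignedState_apply, h1, h2, one_mul]

end Escape

/-! ### Estimates of stationary laws -/

section Stationary

open AgentState Matrix

variable {I : Type*} {A : I → Type*} {U : I → (∀ j, A j) → ℝ} {F : ℝ → ℝ} {G : ℝ → ℝ → ℝ}
  {c ε : ℝ}

/-- States without discontent whose benchmark utilities are at most those of `a`. -/
def below (U : I → (∀ j, A j) → ℝ) (a : ∀ j, A j) : Set (State U) :=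
  {y | ∀ i, y i ≠ discontent ∧ (y i).util ≤ U i a}

variable [Fintype I] [DecidableEq I] [∀ i, Fintype (A i)]

/-- `π` is a stationary law of the process with perturbation `ε`. -/
def IsStationaryLaw (F : ℝ → ℝ) (G : ℝ → ℝ → ℝ) (c ε : ℝ) (π : State U → ℝ) : Prop :=
  π ∈ stdSimplex ℝ (State U) ∧ π ᵥ* transition U F G c ε = π

theorem mem_Ioo_of_mem_Ioc (hε : ε ∈ Set.Ioc (0 : ℝ) (1 / 2)) : ε ∈ Set.Ioo (0 : ℝ) 1 :=
  ⟨hε.1, by linarith [hε.2]⟩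

/-- The escape from an aligned state, seen by a test function that is close to `1` on its basin. -/
theorem one_sub_le_mulVec_basin (h : Admissible U F G c) [∀ i, Nonempty (A i)]
    (hε : ε ∈ Set.Ioo (0 : ℝ) 1) {a : ∀ j, A j} (hexit : exitCost U G a ≤ 2) {f : State U → ℝ}
    (hx : f (alignedState U a) = 1) (hf0 : ∀ y, 0 ≤ f y)
    (hfb : ∀ y ∈ basin U a, 1 - Fintype.card I * ε ≤ f y) :
    1 - Fintype.card (State U) * (Fintype.card (∀ j, A j) * (Fintype.card I + 1)) *
        ε ^ exitCost U G a ≤ (transition U F G c ε *ᵥ f) (alignedState U a) := by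
  set x := alignedState U a
  set N := (Fintype.card (∀ j, A j) : ℝ)
  set n := (Fintype.card I : ℝ)
  have hP := transition_mem_rowStochastic h hε
  have hN : 0 ≤ N := Nat.cast_nonneg _
  have hn : 0 ≤ n := Nat.cast_nonneg _
  have hpos := Real.rpow_pos_of_pos hε.1 (exitCost U G a)
  have hsq : ε * ε ≤ ε ^ exitCost U G a := by
    rw [← sq, ← Real.rpow_two]
    exact Real.rpow_le_rpow_of_exponent_ge hε.1 hε.2.le hexit
  -- Inside the basin the loss is at most a constant times `ε` for getting there, times `n * ε` for
  -- the defect of `f`; outside it is bounded by the probability of a lasting exit. Both are of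
  -- order `ε ^ exitCost U G a`.
  have hterm : ∀ y, transition U F G c ε x y * (1 - f y) ≤
      N * (n + 1) * ε ^ exitCost U G a := fun y => by
    have hnn := transition_nonneg h hε x y
    by_cases hyb : y ∈ basin U a
    · by_cases hyx : y = x
      · rw [hyx, hx, sub_self, mul_zero]; positivity
      · have h1 := transition_aligned_le_of_ne h hε hyx
        have h2 := hfb y hyb
        calc transition U F G c ε x y * (1 - f y)
            ≤ transition U F G c ε x y * (n * ε) := by gcongr; linarith
          _ ≤ (N * ε) * (n * ε) := by
              have := hε.1
              gcongr
          _ = N * n * (ε * ε) := by ring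
          _ ≤ N * n * ε ^ exitCost U G a := by gcongr
          _ ≤ _ := by gcongr; linarith
    · have h1 := transition_aligned_le_of_notMem_basin h hε hexit hyb
      calc transition U F G c ε x y * (1 - f y)
          ≤ transition U F G c ε x y * 1 := by
            gcongr; linarith [hf0 y]
        _ ≤ N * 1 * ε ^ exitCost U G a := by rw [mul_one, mul_one]; exact h1
        _ ≤ _ := by gcongr; linarith
  have hsum := Finset.sum_le_card_nsmul Finset.univ _ _ fun y _ => hterm y
  simp only [mul_sub, mul_one, Finset.sum_sub_distrib, sum_row_of_mem_rowStochastic hP,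
    nsmul_eq_mul, Finset.card_univ] at hsum
  change 1 - (transition U F G c ε *ᵥ f) x ≤ _ at hsum
  linarith

/-- Balance against a bump function `f` at `x = alignedState U a`. Off `x` the function satisfies `f
≤ P f`; at `x` the drop is at most of order `ε ^ exitCost U G a`; at universal discontent the gain
is at least of order `ε ^ potential F x`. Since the weighted drops and gains cancel, the claim
follows. -/
theorem exists_le_stationary_aligned [Nonempty I] [∀ i, Nonempty (A i)] (h : Admissible U F G c)
    (hexit : ∀ a, exitCost U G a ≤ 2) :
    ∃ κ > 0, ∀ ε ∈ Set.Ioo (0 : ℝ) 1, ∀ π : State U → ℝ, IsStationaryLaw F G c ε π →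
      ∀ a, κ * π (allDiscontent U) ≤
        ε ^ (exitCost U G a - potential F (alignedState U a)) * π (alignedState U a) := by
  classical
  set C := (Fintype.card (State U) * (Fintype.card (∀ j, A j) * (Fintype.card I + 1)) : ℝ)
    with hCdef
  set κ : ℝ := ∏ i, c / Fintype.card (A i) with hκdef
  have hκ : 0 < κ := Finset.prod_pos fun i _ =>
    div_pos h.c_mem.1 (by exact_mod_cast Fintype.card_pos)
  have hC : 0 < C := by
    have h1 : (0 : ℝ) < Fintype.card (State U) :=
      by exact_mod_cast Fintype.card_pos_iff.2 ⟨allDiscontent U⟩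
    have h2 : (0 : ℝ) < Fintype.card (∀ j, A j) := by exact_mod_cast Fintype.card_pos
    positivity
  refine ⟨κ / C, by positivity, fun ε hε π hπ a => ?_⟩
  set x := alignedState U a
  set D := allDiscontent U
  set P := transition U F G c ε
  have hP : P ∈ rowStochastic ℝ (State U) := transition_mem_rowStochastic h hε
  set θ : ℝ := max 0 (1 - Fintype.card I * ε)
  have hθ0 : 0 ≤ θ := le_max_left _ _
  -- On the basin, `f` is a lower bound for the probability of returning to `x` in one step; the
  -- maximum with `0` keeps it nonnegative when `ε` is not small.
  let f : State U → ℝ := fun y => if y = x then 1 else if y ∈ basin U a then θ else 0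
  have hf0 : ∀ y, 0 ≤ f y := fun y => by
    simp only [f]; split_ifs
    exacts [zero_le_one, hθ0, le_rfl]
  have hfx : f x = 1 := if_pos rfl
  have hDD : HasDiscontent D := ⟨Classical.arbitrary I, rfl⟩
  have hDx : D ≠ x := fun e => not_hasDiscontent_alignedState a (e ▸ hDD)
  have hfD : f D = 0 := by
    simp only [f]
    rw [if_neg hDx, if_neg fun hb => hb.1 hDD]
  have hle : ∀ y z, P y z * f z ≤ (P *ᵥ f) y := fun y z =>
    Finset.single_le_sum (f := fun z => P y z * f z)
      (fun w _ => mul_nonneg (transition_nonneg h hε y w) (hf0 w)) (Finset.mem_univ z)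
  have hx1 : 1 - C * ε ^ exitCost U G a ≤ (P *ᵥ f) x := by
    refine one_sub_le_mulVec_basin h hε (hexit a) hfx hf0 fun y hy => ?_
    have h0 : 0 ≤ Fintype.card I * ε := mul_nonneg (Nat.cast_nonneg _) hε.1.le
    simp only [f]
    split_ifs
    · linarith
    · exact le_max_right _ _
  have hD1 : κ * ε ^ potential F x ≤ (P *ᵥ f) D := by
    have := hle D x
    rw [hfx, mul_one] at this
    exact (le_transition_allDiscontent h hε a).trans this
  have hy1 : ∀ y, y ≠ x → f y ≤ (P *ᵥ f) y := fun y hyx => by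
    by_cases hyb : y ∈ basin U a
    · have hfy : f y = θ := by simp only [f]; rw [if_neg hyx, if_pos hyb]
      have h1 := one_sub_mul_le_transition_quiet h hε hyb.1 a
      rw [hyb.2 a] at h1
      have h2 := hle y x
      rw [hfx, mul_one] at h2
      rw [hfy]
      exact (max_le (transition_nonneg h hε y x) h1).trans h2
    · have hfy : f y = 0 := by simp only [f]; rw [if_neg hyx, if_neg hyb]
      rw [hfy]
      exact le_mulVec_of_rowStochastic hP hf0 y
  have hterm : ∀ y, (if y = D then π D * (κ * ε ^ potential F x) else 0) -
      (if y = x then π x * (C * ε ^ exitCost U G a) else 0) ≤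
      π y * (P *ᵥ f) y - π y * f y := fun y => by
    rw [← mul_sub]
    by_cases hyx : y = x
    · subst hyx
      rw [if_neg hDx.symm, if_pos rfl, zero_sub, ← mul_neg]
      refine mul_le_mul_of_nonneg_left ?_ (hπ.1.1 _)
      rw [hfx]; linarith
    · rw [if_neg hyx, sub_zero]
      by_cases hyD : y = D
      · rw [if_pos hyD, hyD, hfD, sub_zero]
        exact mul_le_mul_of_nonneg_left hD1 (hπ.1.1 _)
      · rw [if_neg hyD]
        exact mul_nonneg (hπ.1.1 _) (sub_nonneg.2 (hy1 y hyx))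
  have hsum := Finset.sum_le_sum fun y (_ : y ∈ Finset.univ) => hterm y
  rw [Finset.sum_sub_distrib, Finset.sum_sub_distrib, Finset.sum_ite_eq', Finset.sum_ite_eq',
    sum_mul_mulVec_of_stationary hπ.2, sub_self] at hsum
  simp only [Finset.mem_univ, if_true] at hsum
  have hpp := Real.rpow_pos_of_pos hε.1 (potential F x)
  rw [Real.rpow_sub hε.1, div_mul_eq_mul_div, div_mul_eq_mul_div, div_le_div_iff₀ hC hpp]
  linarith

/-- Bound for the flow into a set that can only be entered from states with discontent agents. -/
theorem flow_le (h : Admissible U F G c) (hε : ε ∈ Set.Ioo (0 : ℝ) 1) {π : State U → ℝ}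
    {E : Set (State U)} {t C p : ℝ} (hp : 0 ≤ p) (hC : 0 ≤ C)
    (ht : ∀ w ∈ E, t ≤ potential F w)
    (hE : ∀ z ∉ E, ¬ HasDiscontent z → ∀ w ∈ E, transition U F G c ε z w = 0)
    (hπ : ∀ z ∉ E, HasDiscontent z → π z ≤ C * ε ^ potential F z * p) :
    flow π (transition U F G c ε) Eᶜ E ≤
      Fintype.card (State U) * (Fintype.card (State U) * Fintype.card (∀ j, A j) * C) *
        ε ^ t * p := by
  set X := (Fintype.card (State U) : ℝ)
  set N := (Fintype.card (∀ j, A j) : ℝ)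
  have hX : 0 ≤ X := Nat.cast_nonneg _
  have hN : 0 ≤ N := Nat.cast_nonneg _
  have hpt := Real.rpow_pos_of_pos hε.1 t
  have hterm : ∀ z, Eᶜ.indicator π z * (transition U F G c ε *ᵥ E.indicator 1) z ≤
      X * N * C * ε ^ t * p := fun z => by
    by_cases hz : z ∈ E
    · rw [Set.indicator_of_notMem (by simpa using hz), zero_mul]
      positivity
    rw [Set.indicator_of_mem (Set.mem_compl hz)]
    by_cases hzD : HasDiscontent z
    · have hpz := Real.rpow_pos_of_pos hε.1 (potential F z)
      -- Entering `E` from `z` costs `ε ^ (t - potential F z)`, and the assumed weight of `z`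
      -- supplies the missing factor `ε ^ potential F z`.
      have hsum : (transition U F G c ε *ᵥ E.indicator 1) z ≤
          X * (N * ε ^ (t - potential F z)) := by
        refine (Finset.sum_le_card_nsmul _ _ (N * ε ^ (t - potential F z))
          fun w _ => ?_).trans_eq (by rw [nsmul_eq_mul]; rfl)
        by_cases hw : w ∈ E
        · rw [Set.indicator_of_mem hw, Pi.one_apply, mul_one]
          refine (transition_le_rpow h hε z w).trans (mul_le_mul_of_nonneg_left ?_ hN)
          exact Real.rpow_le_rpow_of_exponent_ge hε.1 hε.2.le (by linarith [ht w hw])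
        · rw [Set.indicator_of_notMem hw, mul_zero]
          exact mul_nonneg hN (Real.rpow_nonneg hε.1.le _)
      have hnn : 0 ≤ (transition U F G c ε *ᵥ E.indicator 1) z :=
        Finset.sum_nonneg fun w _ => mul_nonneg (transition_nonneg h hε z w)
          (Set.indicator_nonneg (fun _ _ => zero_le_one) w)
      calc π z * (transition U F G c ε *ᵥ E.indicator 1) z
          ≤ (C * ε ^ potential F z * p) * (X * (N * ε ^ (t - potential F z))) :=
            mul_le_mul (hπ z hz hzD) hsum hnn (by positivity)
        _ = _ := by
            rw [Real.rpow_sub hε.1]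
            field_simp
    · have : (transition U F G c ε *ᵥ E.indicator 1) z = 0 :=
        Finset.sum_eq_zero fun w _ => by
          by_cases hw : w ∈ E
          · exact mul_eq_zero_of_left (hE z hz hzD w hw) _
          · rw [Set.indicator_of_notMem hw, mul_zero]
      rw [this, mul_zero]
      positivity
  refine (Finset.sum_le_card_nsmul _ _ _ fun z _ => hterm z).trans_eq ?_
  rw [nsmul_eq_mul, Finset.card_univ]
  ring

/-- Induction on the potential. At potential `0` it suffices that `y` leads to universal discontent
with probability at least `κ`. Otherwise the flow into the states of potential at least that of `y`
is compared with the flow out: entry is possible only from discontent states of smaller potential,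
controlled by induction, and from `y` the set is left within `K` steps with probability at least
`κ`. -/
theorem exists_stationary_discontent_le [∀ i, Nonempty (A i)] (h : Admissible U F G c)
    (hinter : Interdependent U) :
    ∃ C : ℝ, 0 ≤ C ∧ ∀ y : State U, HasDiscontent y → ∀ ε ∈ Set.Ioc (0 : ℝ) (1 / 2),
      ∀ π : State U → ℝ, IsStationaryLaw F G c ε π →
        π y ≤ C * ε ^ potential F y * π (allDiscontent U) := by
  obtain ⟨K, κ, hκ, hK⟩ := exists_le_pow_allDiscontent h hinter
  have key : ∀ y : State U, ∃ C : ℝ, 0 ≤ C ∧ (HasDiscontent y →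
      ∀ ε ∈ Set.Ioc (0 : ℝ) (1 / 2), ∀ π : State U → ℝ, IsStationaryLaw F G c ε π →
        π y ≤ C * ε ^ potential F y * π (allDiscontent U)) := by
    intro y
    let r : State U → State U → Prop := fun x y => potential F x < potential F y
    have : IsTrans (State U) r := ⟨fun _ _ _ h1 h2 => lt_trans h1 h2⟩
    have : Std.Irrefl r := ⟨fun _ => lt_irrefl _⟩
    have hwf : WellFounded r := Finite.wellFounded_of_trans_of_irrefl r
    induction y using hwf.induction with
    | _ y ih =>
      by_cases hy0 : potential F y = 0
      · refine ⟨κ⁻¹, by positivity, fun hy ε hε π hπ => ?_⟩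
        have hIoo := mem_Ioo_of_mem_Ioc hε
        have hP := transition_mem_rowStochastic h hIoo
        have h1 : π y * (transition U F G c ε ^ K) y (allDiscontent U) ≤
            (π ᵥ* transition U F G c ε ^ K) (allDiscontent U) :=
          Finset.single_le_sum
            (f := fun z => π z * (transition U F G c ε ^ K) z (allDiscontent U))
            (fun z _ => mul_nonneg (hπ.1.1 z) (nonneg_of_mem_rowStochastic (pow_mem hP K)))
            (Finset.mem_univ y)
        rw [vecMul_pow_of_stationary hπ.2] at h1
        have h2 := mul_le_mul_of_nonneg_left (hK ε hε y hy) (hπ.1.1 y)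
        rw [hy0, Real.rpow_zero, mul_one, inv_mul_eq_div, le_div_iff₀ hκ]
        exact h2.trans h1
      · have hypos : 0 < potential F y := lt_of_le_of_ne (potential_nonneg h y) (Ne.symm hy0)
        -- The default constant `0` makes the choice of constants total, so that they can be summed
        -- over all states.
        have ih' : ∀ z, ∃ C : ℝ, 0 ≤ C ∧ (potential F z < potential F y → HasDiscontent z →
            ∀ ε ∈ Set.Ioc (0 : ℝ) (1 / 2), ∀ π : State U → ℝ, IsStationaryLaw F G c ε π →
              π z ≤ C * ε ^ potential F z * π (allDiscontent U)) := fun z => by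
          by_cases hz : potential F z < potential F y
          · obtain ⟨C, hC, hC'⟩ := ih z hz
            exact ⟨C, hC, fun _ => hC'⟩
          · exact ⟨0, le_rfl, fun h => absurd h hz⟩
        choose C hC hC' using ih'
        set C₀ := ∑ z, C z with hC₀def
        have hC₀ : 0 ≤ C₀ := Finset.sum_nonneg fun z _ => hC z
        have hle : ∀ z, C z ≤ C₀ := fun z =>
          Finset.single_le_sum (fun w _ => hC w) (Finset.mem_univ z)
        refine ⟨K * (Fintype.card (State U) * (Fintype.card (State U) *
          Fintype.card (∀ j, A j) * C₀)) / κ, by positivity, fun hy ε hε π hπ => ?_⟩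
        have hIoo := mem_Ioo_of_mem_Ioc hε
        have hP := transition_mem_rowStochastic h hIoo
        let E : Set (State U) := {z | potential F y ≤ potential F z}
        have hfl := flow_le h hIoo (π := π) (E := E) (t := potential F y) (C := C₀)
          (p := π (allDiscontent U)) (hπ.1.1 _) hC₀ (fun w hw => hw)
          (fun z hz hzD w hw => by
            by_contra hne
            exact hz (le_trans hw (potential_le_of_transition_ne_zero h hne hzD)))
          (fun z hz hzD => by
            refine (hC' z (not_le.1 hz) hzD ε hε π hπ).trans ?_
            have := Real.rpow_nonneg hIoo.1.le (potential F z)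
            have := hπ.1.1 (allDiscontent U)
            gcongr
            exact hle z)
        have h1 := mul_pow_apply_le_flow hP hπ.1.1 hπ.2 (E := E) (x := y)
          (z := allDiscontent U) (show potential F y ≤ potential F y from le_rfl)
          (by
            change ¬ potential F y ≤ potential F (allDiscontent U)
            rw [potential_allDiscontent]; exact not_le.2 hypos) K
        have h2 := mul_le_mul_of_nonneg_left (hK ε hε y hy) (hπ.1.1 y)
        have h3 := h2.trans (h1.trans (mul_le_mul_of_nonneg_left hfl (Nat.cast_nonneg K)))
        rw [← le_div_iff₀ hκ] at h3
        refine h3.trans_eq ?_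
        ring
  choose C hC hC' using key
  refine ⟨∑ z, C z, Finset.sum_nonneg fun z _ => hC z, fun y hy ε hε π hπ =>
    (hC' y hy ε hε π hπ).trans ?_⟩
  have := Real.rpow_nonneg hε.1.le (potential F y)
  have := hπ.1.1 (allDiscontent U)
  gcongr
  exact Finset.single_le_sum (f := C) (fun w _ => hC w) (Finset.mem_univ y)

/-- Flow through the boundary of `below U a`. As benchmarks do not decrease without discontent, this
set can be entered only from states with discontent agents; its states have potential at least that
of `alignedState U a`, so the inflow is of order at most `ε ^ potential` times the weight of
universal discontent. An escape of probability of order `ε ^ exitCost U G a` leads out of the set.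
-/
theorem exists_stationary_aligned_le [∀ i, Nonempty (A i)] [Nontrivial I]
    (h : Admissible U F G c) (hU : ∀ i a, U i a ∈ Set.Icc (0 : ℝ) 1)
    (hinter : Interdependent U) (hopt : optimalStates U = ∅) :
    ∃ C : ℝ, 0 ≤ C ∧ ∀ ε ∈ Set.Ioc (0 : ℝ) (1 / 2), ∀ π : State U → ℝ,
      IsStationaryLaw F G c ε π → ∀ a,
        ε ^ (exitCost U G a - potential F (alignedState U a)) * π (alignedState U a) ≤
          C * π (allDiscontent U) := by
  obtain ⟨C, hC, hdisc⟩ := exists_stationary_discontent_le h hinter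
  have key : ∀ a, ∃ B : ℝ, 0 ≤ B ∧ ∀ ε ∈ Set.Ioc (0 : ℝ) (1 / 2), ∀ π : State U → ℝ,
      IsStationaryLaw F G c ε π →
        ε ^ (exitCost U G a - potential F (alignedState U a)) * π (alignedState U a) ≤
          B * π (allDiscontent U) := by
    intro a
    have ha : ¬ ∀ i, U i a = 1 := fun ha =>
      (Set.ext_iff.1 hopt (alignedState U a)).1 ⟨a, rfl, ha⟩
    obtain ⟨y, hy, κ, hκ, m, k, hle⟩ := exists_escape (G := G) h hU hinter ha
    have hyE : y ∉ below U a := fun hyE => by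
      rcases hy with ⟨i, hi⟩ | ⟨⟨i, hi⟩, -⟩
      · exact (hyE i).1 hi
      · exact (hyE i).2.not_gt hi
    refine ⟨k * (Fintype.card (State U) * (Fintype.card (State U) *
          Fintype.card (∀ j, A j) * C)) / (κ * (1 / 2) ^ m), by positivity,
      fun ε hε π hπ => ?_⟩
    have hIoo := mem_Ioo_of_mem_Ioc hε
    have hP := transition_mem_rowStochastic h hIoo
    have hfl := flow_le h hIoo (π := π) (E := below U a)
      (t := potential F (alignedState U a)) (C := C)
      (p := π (allDiscontent U)) (hπ.1.1 _) hC
      (fun w hw => Finset.sum_le_sum fun i _ => pot_le_pot (h.F_anti i) (hw i).1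
        (fun e => not_hasDiscontent_alignedState a ⟨i, e⟩) (hw i).2)
      (fun z hz hzD w hw => by
        by_contra hne
        refine hz fun i => ?_
        have hzi : z i ≠ discontent := fun e => hzD ⟨i, e⟩
        exact ⟨hzi, (util_le_of_transition_ne_zero hne hzi (hw i).1).trans (hw i).2⟩)
      (fun z _ hzD => hdisc z hzD ε hε π hπ)
    have h1 := mul_pow_apply_le_flow hP hπ.1.1 hπ.2 (E := below U a) (x := alignedState U a)
      (z := y) (fun i => ⟨fun e => not_hasDiscontent_alignedState a ⟨i, e⟩, le_rfl⟩) hyE k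
    have hpe := Real.rpow_pos_of_pos hε.1 (exitCost U G a)
    have hpp := Real.rpow_pos_of_pos hε.1 (potential F (alignedState U a))
    -- For `ε ≤ 1 / 2` the factor `(1 - ε) ^ m` is bounded below.
    have h0 : κ * (1 / 2) ^ m * ε ^ exitCost U G a ≤
        (transition U F G c ε ^ k) (alignedState U a) y := by
      refine le_trans ?_ (hle ε hIoo)
      gcongr
      linarith [hε.2]
    have h2 := mul_le_mul_of_nonneg_left h0 (hπ.1.1 (alignedState U a))
    have h3 := h2.trans (h1.trans (mul_le_mul_of_nonneg_left hfl (Nat.cast_nonneg k)))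
    rw [Real.rpow_sub hε.1, div_mul_eq_mul_div, div_mul_eq_mul_div,
      div_le_div_iff₀ hpp (by positivity)]
    linarith
  choose B hB hB' using key
  refine ⟨∑ a, B a, Finset.sum_nonneg fun a _ => hB a, fun ε hε π hπ a =>
    (hB' a ε hε π hπ).trans ?_⟩
  have := hπ.1.1 (allDiscontent U)
  gcongr
  exact Finset.single_le_sum (f := B) (fun w _ => hB w) (Finset.mem_univ a)

/-- The total rank is a Lyapunov function: away from discontent it does not increase in quiet steps
and drops by at least `1` at the non-aligned state `x`. In the balance this drop, of weight `π x`,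
is paid for by explorations, of order `ε`, and by discontent states, whose weight is controlled by
that of universal discontent. -/
theorem exists_stationary_rest_le [∀ i, Nonempty (A i)] (h : Admissible U F G c)
    (hinter : Interdependent U) :
    ∃ C : ℝ, 0 ≤ C ∧ ∀ ε ∈ Set.Ioc (0 : ℝ) (1 / 2), ∀ π : State U → ℝ,
      IsStationaryLaw F G c ε π → ∀ x ∉ Set.range (alignedState U),
        π x ≤ C * (ε + π (allDiscontent U)) := by
  classical
  obtain ⟨C, hC, hdisc⟩ := exists_stationary_discontent_le h hinter
  have hdisc' : ∀ y : State U, HasDiscontent y → ∀ ε ∈ Set.Ioc (0 : ℝ) (1 / 2),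
      ∀ π : State U → ℝ, IsStationaryLaw F G c ε π → π y ≤ C * π (allDiscontent U) := by
    intro y hy ε hε π hπ
    refine (hdisc y hy ε hε π hπ).trans (mul_le_mul_of_nonneg_right ?_ (hπ.1.1 _))
    exact mul_le_of_le_one_right hC (Real.rpow_le_one hε.1.le
      (mem_Ioo_of_mem_Ioc hε).2.le (potential_nonneg h y))
  set n := (Fintype.card I : ℝ)
  have hn : 0 ≤ n := Nat.cast_nonneg _
  set X := (Fintype.card (State U) : ℝ)
  have hX : 0 ≤ X := Nat.cast_nonneg _
  refine ⟨C + (2 * n * n + X * (2 * n * C)), by positivity, fun ε hε π hπ x hx => ?_⟩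
  have hp := hπ.1.1 (allDiscontent U)
  have hε0 := hε.1
  by_cases hxD : HasDiscontent x
  · refine (hdisc' x hxD ε hε π hπ).trans ?_
    gcongr
    · have : 0 ≤ 2 * n * n + X * (2 * n * C) := by positivity
      linarith
    · linarith
  have hIoo := mem_Ioo_of_mem_Ioc hε
  set P := transition U F G c ε
  have hP : P ∈ rowStochastic ℝ (State U) := transition_mem_rowStochastic h hIoo
  let a : ∀ j, A j := fun j => Classical.arbitrary _
  -- The value `0` at discontent states keeps the drift estimate valid when a quiet step creates
  -- discontent.
  let g : State U → ℝ := fun y => if HasDiscontent y then 0 else totalRank y a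
  have hg0 : ∀ y, 0 ≤ g y := fun y => by
    simp only [g]; split_ifs
    exacts [le_rfl, Nat.cast_nonneg _]
  have hg2 : ∀ y, g y ≤ 2 * n := fun y => by
    simp only [g]; split_ifs
    · positivity
    · have : (totalRank y a : ℝ) ≤ (2 * Fintype.card I : ℕ) := Nat.cast_le.2 (totalRank_le y a)
      simpa using this
  have hgx : 1 ≤ g x := by
    simp only [g, if_neg hxD]
    exact_mod_cast Nat.one_le_iff_ne_zero.2 fun h0 =>
      hx ⟨_, (eq_alignedState_of_totalRank_eq_zero hxD h0).symm⟩
  have hgq : ∀ y, ¬ HasDiscontent y → g (quiet y a) ≤ g y - if y = x then 1 else 0 := by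
    intro y hy
    by_cases hq : HasDiscontent (quiet y a)
    · have : g (quiet y a) = 0 := if_pos hq
      rw [this]
      split_ifs with hyx
      · rw [hyx]; linarith
      · simpa using hg0 y
    · simp only [g, if_neg hq, if_neg hy]
      split_ifs with hyx
      · have h0 : totalRank y a ≠ 0 := fun h0 =>
          hx ⟨_, hyx ▸ (eq_alignedState_of_totalRank_eq_zero hy h0).symm⟩
        have := totalRank_quiet_lt hq h0
        have : (totalRank (quiet y a) a : ℝ) + 1 ≤ totalRank y a := by exact_mod_cast this
        linarith
      · rw [sub_zero]; exact_mod_cast totalRank_quiet_le hq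
  have hPg : ∀ y, ¬ HasDiscontent y → (P *ᵥ g) y ≤ g (quiet y a) + 2 * n * (n * ε) := by
    intro y hy
    have h1 := one_sub_mul_le_transition_quiet h hIoo hy a
    have h2 : (P *ᵥ g) y ≤ P y (quiet y a) * g (quiet y a) + (1 - P y (quiet y a)) * (2 * n) := by
      have h3 : 1 - P y (quiet y a) = ∑ z ∈ Finset.univ.erase (quiet y a), P y z := by
        rw [← sum_row_of_mem_rowStochastic hP y,
          ← Finset.add_sum_erase _ _ (Finset.mem_univ (quiet y a))]
        ring
      rw [h3, Finset.sum_mul]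
      change ∑ z, P y z * g z ≤ _
      rw [← Finset.add_sum_erase _ _ (Finset.mem_univ (quiet y a))]
      gcongr with z _
      · exact transition_nonneg h hIoo y z
      · exact hg2 z
    have h4 : P y (quiet y a) * g (quiet y a) ≤ g (quiet y a) :=
      mul_le_of_le_one_left (hg0 _) (le_one_of_mem_rowStochastic hP)
    have h5 : (1 - P y (quiet y a)) * (2 * n) ≤ n * ε * (2 * n) := by
      refine mul_le_mul_of_nonneg_right ?_ (by positivity)
      linarith
    linarith
  have hterm : ∀ y, π y * (P *ᵥ g) y - π y * g y ≤
      π y * (2 * n * (n * ε)) + 2 * n * (C * π (allDiscontent U)) -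
        if y = x then π x else 0 := by
    intro y
    have hπy := hπ.1.1 y
    rw [← mul_sub]
    by_cases hy : HasDiscontent y
    · have hyx : y ≠ x := fun e => hxD (e ▸ hy)
      rw [if_neg hyx, sub_zero]
      have h1 : (P *ᵥ g) y - g y ≤ 2 * n := by
        have := mulVec_le_of_rowStochastic hP hg2 y
        linarith [hg0 y]
      have h2 := mul_le_mul_of_nonneg_left h1 hπy
      have h3 := mul_le_mul_of_nonneg_right (hdisc' y hy ε hε π hπ)
        (show 0 ≤ 2 * n by positivity)
      have h4 : 0 ≤ π y * (2 * n * (n * ε)) := by positivity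
      linarith
    · have h1 := hPg y hy
      have h2 := hgq y hy
      have h3 : 0 ≤ 2 * n * (C * π (allDiscontent U)) := by positivity
      have h4 : (P *ᵥ g) y - g y ≤ 2 * n * (n * ε) - if y = x then 1 else 0 := by linarith
      have h5 := mul_le_mul_of_nonneg_left h4 hπy
      rw [mul_sub] at h5
      have h6 : (π y * if y = x then (1 : ℝ) else 0) = if y = x then π x else 0 := by
        split_ifs with hyx
        · rw [hyx, mul_one]
        · rw [mul_zero]
      linarith
  have hsum := Finset.sum_le_sum fun y (_ : y ∈ Finset.univ) => hterm y
  rw [Finset.sum_sub_distrib, Finset.sum_sub_distrib, Finset.sum_add_distrib,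
    Finset.sum_ite_eq', sum_mul_mulVec_of_stationary hπ.2, sub_self, ← Finset.sum_mul, hπ.1.2,
    Finset.sum_const, nsmul_eq_mul, Finset.card_univ] at hsum
  simp only [Finset.mem_univ, if_true] at hsum
  have h7 : π x ≤ 2 * n * n * ε + X * (2 * n * C) * π (allDiscontent U) := by linarith
  have h8 : 0 ≤ C * ε + C * π (allDiscontent U) + 2 * n * n * π (allDiscontent U) +
      X * (2 * n * C) * ε := by positivity
  linarith

end Stationary

/-! ### Stable sets with several agents and with at most one agent -/

section Main

open AgentState Matrix

/-- The loop at `d` allows waiting there, so a common number of steps serves all starting states. -/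
theorem exists_forall_le_pow {X : Type*} [Fintype X] [DecidableEq X] {P : Matrix X X ℝ}
    (hP : P ∈ rowStochastic ℝ X) {d : X} (hd : 0 < P d d) (hacc : ∀ y, ∃ k, 0 < (P ^ k) y d) :
    ∃ K : ℕ, ∃ δ > 0, ∀ y, δ ≤ (P ^ K) y d := by
  have hpad : ∀ y, ∃ k, ∀ m ≥ k, 0 < (P ^ m) y d := fun y => by
    obtain ⟨k, hk⟩ := hacc y
    refine ⟨k, fun m hm => ?_⟩
    induction m, hm using Nat.le_induction with
    | base => exact hk
    | succ m _ ih =>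
      rw [pow_succ, mul_apply]
      exact (mul_pos ih hd).trans_le (Finset.single_le_sum (f := fun w => (P ^ m) y w * P w d)
        (fun w _ => mul_nonneg (nonneg_of_mem_rowStochastic (pow_mem hP m))
          (nonneg_of_mem_rowStochastic hP)) (Finset.mem_univ d))
  choose k hk using hpad
  have : Nonempty X := ⟨d⟩
  obtain ⟨y, hy⟩ := Finite.exists_min fun y => (P ^ Finset.univ.sup k) y d
  exact ⟨Finset.univ.sup k, _, hk y _ (Finset.le_sup (Finset.mem_univ y)), hy⟩

theorem isEquilibrium_of_optimal {I : Type*} {A : I → Type*} {U : I → (∀ j, A j) → ℝ}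
    [DecidableEq I] (hU : ∀ i a, U i a ∈ Set.Icc (0 : ℝ) 1) {a : ∀ j, A j}
    (ha : ∀ i, U i a = 1) : IsEquilibrium U a := fun i b _ => by
  rw [ha i]; exact (hU i _).2

variable {I : Type*} {A : I → Type*} {U : I → (∀ j, A j) → ℝ} {F : ℝ → ℝ} {G : ℝ → ℝ → ℝ}
  {c ε : ℝ} [Fintype I] [DecidableEq I] [∀ i, Fintype (A i)] [∀ i, Nonempty (A i)]

/-! ### At least two agents -/

/-- In the absence of optimal states everything leads to universal discontent, which gives the
stationary law; its weights are then sandwiched relative to that of universal discontent. -/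
theorem isStochasticallyStableSet_exitCost [Nontrivial I] (h : Admissible U F G c)
    (hU : ∀ i a, U i a ∈ Set.Icc (0 : ℝ) 1) (hinter : Interdependent U)
    (hopt : optimalStates U = ∅) (hexit : ∀ a, exitCost U G a ≤ 2)
    (hpos : ∀ a, 0 < exitCost U G a - potential F (alignedState U a)) :
    IsStochasticallyStableSet (transition U F G c) {x | ∃ a, x = alignedState U a ∧
      ∀ b, exitCost U G b - potential F (alignedState U b) ≤
        exitCost U G a - potential F (alignedState U a)} := by
  have hstat : ∀ ε : ℝ, ∃ π : State U → ℝ, ε ∈ Set.Ioc (0 : ℝ) (1 / 2) →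
      π ∈ stdSimplex ℝ (State U) ∧ π ᵥ* transition U F G c ε = π ∧
        ∀ μ ∈ stdSimplex ℝ (State U), ∀ S : Set (State U),
          Tendsto (fun k => probAt μ (transition U F G c ε) k S) atTop
            (𝓝 (∑ x, S.indicator π x)) := by
    intro ε
    by_cases hε : ε ∈ Set.Ioc (0 : ℝ) (1 / 2)
    · have hIoo := mem_Ioo_of_mem_Ioc hε
      have hP := transition_mem_rowStochastic h hIoo
      obtain ⟨K, δ, hδ, hK⟩ := exists_forall_le_pow hP (d := allDiscontent U)
        ((quietBound_pos h.c_mem hIoo).trans_le (quietBound_le_transition h hIoo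
          ⟨fun _ => Classical.arbitrary _, rfl⟩)) (fun y => by
          obtain ⟨z, hyz, rfl | hz⟩ :=
            exists_reflTransGen_allDiscontent_or_optimal h hIoo hU hinter y
          · exact pow_apply_pos_of_reflTransGen hP hyz
          · rw [hopt] at hz
            exact absurd hz (Set.notMem_empty z))
      obtain ⟨π, hπ1, hπ2, hπ3⟩ := exists_stationary hP hδ hK
      exact ⟨π, fun _ => ⟨hπ1, hπ2, hπ3⟩⟩
    · exact ⟨0, fun h => absurd h hε⟩
  choose π hπ using hstat
  obtain ⟨κ, hκ, hlo⟩ := exists_le_stationary_aligned h hexit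
  obtain ⟨C, hC, hhi⟩ := exists_stationary_aligned_le h hU hinter hopt
  obtain ⟨C', hC', hrest⟩ := exists_stationary_rest_le h hinter
  have hlaw : ∀ ε ∈ Set.Ioc (0 : ℝ) (1 / 2), IsStationaryLaw F G c ε (π ε) := fun ε hε =>
    ⟨(hπ ε hε).1, (hπ ε hε).2.1⟩
  have hp : ∀ ε ∈ Set.Ioc (0 : ℝ) (1 / 2), 0 ≤ π ε (allDiscontent U) := fun ε hε =>
    (hπ ε hε).1.1 _
  refine isStochasticallyStableSet_of_weights (al := alignedState U) (π := π)
    (p := fun ε => π ε (allDiscontent U)) (C := C + C') hpos one_half_pos hπ hp hκ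
    (fun ε hε a => hlo ε (mem_Ioo_of_mem_Ioc hε) (π ε) (hlaw ε hε) a) (fun ε hε a => ?_)
    (fun ε hε x hx => ?_)
  · exact (hhi ε hε (π ε) (hlaw ε hε) a).trans
      (mul_le_mul_of_nonneg_right (by linarith) (hp ε hε))
  · exact (hrest ε hε (π ε) (hlaw ε hε) x hx).trans
      (mul_le_mul_of_nonneg_right (by linarith) (by linarith [hp ε hε, hε.1]))

theorem exists_pow_optimal_pos [Nontrivial I] (h : Admissible U F G c)
    (hε : ε ∈ Set.Ioo (0 : ℝ) 1) (hU : ∀ i a, U i a ∈ Set.Icc (0 : ℝ) 1)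
    (hinter : Interdependent U) (hopt : (optimalStates U).Nonempty) (y : State U) :
    ∃ k, ∃ x ∈ optimalStates U, 0 < (transition U F G c ε ^ k) y x := by
  have hP := transition_mem_rowStochastic h hε
  obtain ⟨z, hyz, rfl | hz⟩ := exists_reflTransGen_allDiscontent_or_optimal h hε hU hinter y
  · obtain ⟨x, hx⟩ := hopt
    obtain ⟨a, rfl, -⟩ := id hx
    have hstep : 0 < transition U F G c ε (allDiscontent U) (alignedState U a) := by
      refine lt_of_lt_of_le ?_ (le_transition_allDiscontent h hε a)
      exact mul_pos (Finset.prod_pos fun i _ =>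
        div_pos h.c_mem.1 (by exact_mod_cast Fintype.card_pos)) (Real.rpow_pos_of_pos hε.1 _)
    obtain ⟨k, hk⟩ := pow_apply_pos_of_reflTransGen hP (hyz.tail hstep)
    exact ⟨k, _, hx, hk⟩
  · obtain ⟨k, hk⟩ := pow_apply_pos_of_reflTransGen hP hyz
    exact ⟨k, z, hz, hk⟩

/-! ### At most one agent -/

theorem update_eq_of_subsingleton {I : Type*} {A : I → Type*} [DecidableEq I] [Subsingleton I]
    (a b : ∀ j, A j) (i : I) : Function.update a i (b i) = b := by
  funext k
  obtain rfl := Subsingleton.elim k i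
  simp

theorem IsEquilibrium.le_of_subsingleton {I : Type*} {A : I → Type*}
    {U : I → (∀ j, A j) → ℝ} [DecidableEq I] [Subsingleton I] {a : ∀ j, A j}
    (ha : IsEquilibrium U a) (b : ∀ j, A j) (i : I) : U i b ≤ U i a := by
  by_cases hb : b i = a i
  · have : b = a := by rw [← update_eq_of_subsingleton a b i, hb, Function.update_eq_self]
    rw [this]
  · simpa [update_eq_of_subsingleton] using ha i (b i) hb

/-- Maximizing the sum of utilities treats one agent and no agent at once. -/
theorem exists_isEquilibrium_of_subsingleton [Subsingleton I] (U : I → (∀ j, A j) → ℝ) :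
    ∃ a, IsEquilibrium U a := by
  obtain ⟨a, ha⟩ := Finite.exists_max fun a : ∀ j, A j => ∑ i, U i a
  refine ⟨a, fun i b _ => ?_⟩
  have := ha (Function.update a i b)
  rwa [Fintype.sum_subsingleton _ i, Fintype.sum_subsingleton _ i] at this

/-- A lone agent at its maximum accepts no exploration, and nobody else can disturb it. So even
equilibria with utility below `1` are absorbing, unlike with several agents. -/
theorem transition_equilibrium_of_subsingleton [Subsingleton I] (h : Admissible U F G c)
    (hε : ε ∈ Set.Ioo (0 : ℝ) 1) {x : State U} (hx : x ∈ equilibriumStates U) :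
    transition U F G c ε x x = 1 := by
  obtain ⟨a, rfl, ha⟩ := hx
  rw [← sum_row_of_mem_rowStochastic (transition_mem_rowStochastic h hε) (alignedState U a)]
  refine (Finset.sum_eq_single _ (fun y _ hy => ?_) (by simp)).symm
  by_contra hne
  obtain ⟨b, hb⟩ := exists_of_transition_ne_zero hne
  refine hy (funext fun i => ?_)
  rcases updateLaw_content_ne_zero (hb i) with ⟨_, hlt, _⟩ | ⟨_, h1⟩ | ⟨h1, h2⟩
  · exact absurd hlt (ha.le_of_subsingleton b i).not_gt
  · exact h1
  · have : b = a := by rw [← update_eq_of_subsingleton a b i, h1, Function.update_eq_self]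
    rw [h2, this]
    exact (content_eq_next _ _).symm

/-- A discontent agent can accept an equilibrium action at once, and a content agent below the
maximum can deviate to it directly. -/
theorem exists_pow_equilibrium_pos_of_subsingleton [Subsingleton I] (h : Admissible U F G c)
    (hU : ∀ i a, U i a ∈ Set.Icc (0 : ℝ) 1) (hε : ε ∈ Set.Ioo (0 : ℝ) 1) (y : State U) :
    ∃ k, ∃ x ∈ equilibriumStates U, 0 < (transition U F G c ε ^ k) y x := by
  have hP := transition_mem_rowStochastic h hε
  obtain ⟨e, he⟩ := exists_isEquilibrium_of_subsingleton U
  suffices hs : ∃ x ∈ equilibriumStates U,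
      Relation.ReflTransGen (fun x y => 0 < transition U F G c ε x y) y x by
    obtain ⟨x, hx, hyx⟩ := hs
    obtain ⟨k, hk⟩ := pow_apply_pos_of_reflTransGen hP hyx
    exact ⟨k, x, hx, hk⟩
  obtain ⟨z, hyz, hz⟩ := exists_reflTransGen_aligned y
  have hyz' := transition_pos_of_reflTransGen h hε hyz
  rcases hz with ⟨i, hi⟩ | ⟨a, rfl, -⟩
  · have hzD : z = allDiscontent U := funext fun j => by
      obtain rfl := Subsingleton.elim j i
      exact hi
    refine ⟨_, ⟨e, rfl, he⟩, hyz'.tail ?_⟩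
    rw [hzD]
    refine lt_of_lt_of_le ?_ (le_transition_allDiscontent h hε e)
    exact mul_pos (Finset.prod_pos fun i _ =>
      div_pos h.c_mem.1 (by exact_mod_cast Fintype.card_pos)) (Real.rpow_pos_of_pos hε.1 _)
  · by_cases ha : IsEquilibrium U a
    · exact ⟨_, ⟨a, rfl, ha⟩, hyz'⟩
    refine ⟨_, ⟨e, rfl, he⟩, hyz'.tail ?_⟩
    simp only [IsEquilibrium, not_forall, not_le] at ha
    obtain ⟨i, b, -, hlt⟩ := ha
    have hlt' : U i a < U i e := hlt.trans_le (he.le_of_subsingleton _ i)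
    have hei : e i ≠ a i := fun hei => hlt'.ne (by
      rw [← update_eq_of_subsingleton a e i, hei, Function.update_eq_self])
    have hk : ∀ {p : I → Prop}, ∀ k, k ≠ i → p k := fun k hk =>
      absurd (Subsingleton.elim k i) hk
    refine lt_of_lt_of_le ?_ (explore_le_transition (y := alignedState U a)
      (z := alignedState U e) (a := a) (i := i) (b := e i) (v := obs U a i)
      (ρ := ε ^ G (obs U a i) (obs U e i)) h hε hei rfl
      (hlt'.trans_le (hU i e).2) hk hk (Real.rpow_nonneg hε.1.le _) ?_)
    · have h1 : 0 < 1 - ε := by linarith [hε.2]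
      have h2 := Real.rpow_pos_of_pos hε.1 (G (obs U a i) (obs U e i))
      have h3 : (0 : ℝ) < Fintype.card (A i) := by exact_mod_cast Fintype.card_pos
      have h4 := hε.1
      positivity
    · rw [update_eq_of_subsingleton a e i]
      exact (updateLaw_content_accept hei hlt').ge

end Main

end ITEL

/-! ### The convergence theorem -/

theorem mainTheorem1 {I : Type*} [Fintype I] [DecidableEq I]
    {A : I → Type*} [∀ i, Fintype (A i)] [∀ i, Nonempty (A i)]
    (U : I → (∀ j, A j) → ℝ) (hU : ∀ i a, U i a ∈ Set.Icc (0 : ℝ) 1)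
    (F : ℝ → ℝ) (G : ℝ → ℝ → ℝ) (c : ℝ) (hc : c ∈ Set.Ioo (0 : ℝ) 1)
    (hmono : ITEL.MonotoneResistances (ITEL.utilities U) F G)
    (hinter : ITEL.Interdependent U)
    (hbound : ITEL.BoundedResistances (Fintype.card I) (ITEL.utilities U) F G) :
    ((ITEL.optimalStates U).Nonempty →
      ∀ ε ∈ Set.Ioo (0 : ℝ) 1,
      ∀ {Ω : Type*} [MeasurableSpace Ω] (ℙ : MeasureTheory.Measure Ω)
        [MeasureTheory.IsProbabilityMeasure ℙ] (X : ℕ → Ω → ITEL.State U),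
        ITEL.IsMarkovChain (ITEL.transition U F G c ε) ℙ X →
        ∀ᵐ ω ∂ℙ, ∃ x ∈ ITEL.optimalStates U, ∀ᶠ k in Filter.atTop, X k ω = x) ∧
    (ITEL.optimalStates U = ∅ → (ITEL.equilibriumStates U).Nonempty →
      ITEL.IsStochasticallyStableSet (ITEL.transition U F G c)
        {x | ∃ a, x = ITEL.alignedState U a ∧ ITEL.IsEquilibrium U a ∧
          ∀ b, ITEL.IsEquilibrium U b →
            ITEL.virtualWelfare U F b ≤ ITEL.virtualWelfare U F a}) ∧
    (ITEL.equilibriumStates U = ∅ →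
      ITEL.IsStochasticallyStableSet (ITEL.transition U F G c)
        {x | ∃ a, x = ITEL.alignedState U a ∧
          ∀ b, ITEL.virtualWelfare U F b - ITEL.virtualStability U G b ≤
            ITEL.virtualWelfare U F a - ITEL.virtualStability U G a}) := by
  obtain ⟨F₀, G₀, hF, hG, hFG⟩ := hbound
  have hV : ∀ i (u : Set.range (U i)), (u : ℝ) ∈ ITEL.utilities U := by
    rintro i ⟨_, a, rfl⟩
    exact ⟨i, a, rfl⟩
  have h : ITEL.Admissible U F G c :=
    { c_mem := hc
      F_nonneg := fun i u => (hF u (hV i u)).1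
      F_anti := fun i u v huv => hmono.1 (hV i u) (hV i v) huv
      G_nonneg := fun i u v huv => (hG u (hV i u) v (hV i v) huv).1 }
  rcases subsingleton_or_nontrivial I with hI | hI
  · refine ⟨fun hopt ε hε Ω _ ℙ _ X hX => ?_, fun _ _ => ?_, fun hne => ?_⟩
    · refine hX.ae_eventually_eq (ITEL.transition_mem_rowStochastic h hε)
        (fun x hx => ITEL.transition_optimal h hε hx) fun y => ?_
      obtain ⟨k, x, ⟨a, rfl, ha⟩, hk⟩ :=
        ITEL.exists_pow_equilibrium_pos_of_subsingleton h hU hε y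
      obtain ⟨_, o, -, ho⟩ := hopt
      exact ⟨k, _, ⟨a, rfl, fun i => le_antisymm (hU i a).2
        ((ho i).ge.trans (ha.le_of_subsingleton o i))⟩, hk⟩
    -- All equilibria of a single agent have the same utility, so the maximization of welfare is no
    -- restriction.
    · have hset : {x | ∃ a, x = ITEL.alignedState U a ∧ ITEL.IsEquilibrium U a ∧
          ∀ b, ITEL.IsEquilibrium U b →
            ITEL.virtualWelfare U F b ≤ ITEL.virtualWelfare U F a} =
          ITEL.equilibriumStates U := by
        ext x
        refine ⟨fun ⟨a, hx, ha, _⟩ => ⟨a, hx, ha⟩, fun ⟨a, hx, ha⟩ => ⟨a, hx, ha, fun b hb => ?_⟩⟩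
        have hab : ∀ i, U i b = U i a := fun i =>
          le_antisymm (ha.le_of_subsingleton b i) (hb.le_of_subsingleton a i)
        simp [ITEL.virtualWelfare, hab]
      rw [hset]
      exact ITEL.isStochasticallyStableSet_of_absorbing
        (fun ε hε => ITEL.transition_mem_rowStochastic h hε)
        (fun ε hε x hx => ITEL.transition_equilibrium_of_subsingleton h hε hx)
        (fun ε hε y => ITEL.exists_pow_equilibrium_pos_of_subsingleton h hU hε y)
    · obtain ⟨e, he⟩ := ITEL.exists_isEquilibrium_of_subsingleton U
      exact absurd ((Set.ext_iff.1 hne (ITEL.alignedState U e)).1 ⟨e, rfl, he⟩)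
        (Set.notMem_empty _)
  refine ⟨fun hopt ε hε Ω _ ℙ _ X hX => hX.ae_eventually_eq
    (ITEL.transition_mem_rowStochastic h hε) (fun x hx => ITEL.transition_optimal h hε hx)
    (ITEL.exists_pow_optimal_pos h hε hU hinter hopt), ?_⟩
  have hn : (0 : ℝ) < Fintype.card I := by exact_mod_cast Fintype.card_pos
  obtain ⟨i, l, hil⟩ := exists_pair_ne I
  -- Interdependence provides two different utilities of one agent, and at this pair `0 ≤ G < G₀`.
  -- Hence `F₀ < 1`.
  have hG₀ : 0 < G₀ := by
    obtain ⟨j, -, b, hb⟩ := hinter (fun _ => Classical.arbitrary _) {i}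
      (Finset.singleton_nonempty i) ⟨l, by simpa using hil.symm⟩
    rcases lt_or_gt_of_ne hb with hlt | hlt
    · obtain ⟨h1, h2⟩ := hG _ ⟨j, _, rfl⟩ _ ⟨j, _, rfl⟩ hlt
      linarith
    · obtain ⟨h1, h2⟩ := hG _ ⟨j, _, rfl⟩ _ ⟨j, _, rfl⟩ hlt
      linarith
  have hpot : ∀ a, ITEL.potential F (ITEL.alignedState U a) ≤ F₀ := fun a => by
    rw [ITEL.potential_alignedState]
    refine (Finset.sum_le_card_nsmul _ _ _ fun i _ => (hF _ ⟨i, a, rfl⟩).2).trans_eq ?_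
    rw [nsmul_eq_mul, Finset.card_univ]
    field_simp
  have hpot0 : ∀ a, 0 ≤ ITEL.potential F (ITEL.alignedState U a) := fun a =>
    ITEL.potential_nonneg h _
  have hF₀ : 0 ≤ F₀ := (hpot0 fun _ => Classical.arbitrary _).trans (hpot _)
  have hWpot : ∀ a, ITEL.virtualWelfare U F a =
      1 - ITEL.potential F (ITEL.alignedState U a) := fun a => rfl
  have hne : ∀ a, ¬ ITEL.IsEquilibrium U a →
      1 ≤ ITEL.exitCost U G a ∧ ITEL.exitCost U G a < 1 + G₀ := fun a ha => by
    obtain ⟨i, b, -, hlt, heq⟩ := ITEL.exists_exitCost_eq (G := G) ha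
    obtain ⟨h1, h2⟩ := hG _ ⟨i, _, rfl⟩ _ ⟨i, _, rfl⟩ hlt
    exact ⟨by linarith, by linarith⟩
  have heq : ∀ a, ITEL.IsEquilibrium U a → ITEL.exitCost U G a = 2 := fun a ha => if_pos ha
  have hexit : ∀ a, ITEL.exitCost U G a ≤ 2 := fun a => by
    by_cases ha : ITEL.IsEquilibrium U a
    · exact (heq a ha).le
    · linarith [(hne a ha).2]
  have hpos : ∀ a, 0 < ITEL.exitCost U G a - ITEL.potential F (ITEL.alignedState U a) :=
    fun a => by
      have h1 := hpot a
      by_cases ha : ITEL.IsEquilibrium U a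
      · rw [heq a ha]; linarith
      · linarith [(hne a ha).1]
  refine ⟨fun hopt hex => ?_, fun hnoeq => ?_⟩
  · obtain ⟨_, e, -, he⟩ := hex
    convert ITEL.isStochasticallyStableSet_exitCost h hU hinter hopt hexit hpos using 1
    ext x
    -- An equilibrium has weight exponent at least `2 - F₀ ≥ 1 + G₀`, any other profile less than `1
    -- + G₀`. So the maximizers are equilibria, and among these only the potential matters.
    refine exists_congr fun a => and_congr_right fun _ => ⟨fun ⟨ha, hmax⟩ b => ?_, fun hmax => ?_⟩
    · rw [heq a ha]
      by_cases hb : ITEL.IsEquilibrium U b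
      · have := hmax b hb
        rw [hWpot, hWpot] at this
        rw [heq b hb]; linarith
      · linarith [(hne b hb).2, hpot0 b, hpot a]
    · have ha : ITEL.IsEquilibrium U a := by
        by_contra ha
        have := hmax e
        rw [heq e he] at this
        linarith [(hne a ha).2, hpot0 a, hpot e]
      refine ⟨ha, fun b hb => ?_⟩
      have := hmax b
      rw [heq a ha, heq b hb] at this
      rw [hWpot, hWpot]; linarith
  · have hno : ∀ a, ¬ ITEL.IsEquilibrium U a := fun a ha =>
      (Set.ext_iff.1 hnoeq (ITEL.alignedState U a)).1 ⟨a, rfl, ha⟩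
    have hopt : ITEL.optimalStates U = ∅ := Set.eq_empty_of_forall_notMem fun x hx => by
      obtain ⟨a, -, ha⟩ := hx
      exact hno a (ITEL.isEquilibrium_of_optimal hU ha)
    convert ITEL.isStochasticallyStableSet_exitCost h hU hinter hopt hexit hpos using 1
    ext x
    refine exists_congr fun a => and_congr_right fun _ => forall_congr' fun b => ?_
    -- Without equilibria, virtual welfare minus virtual stability is the weight exponent minus `1`.
    rw [hWpot, hWpot, ITEL.exitCost, ITEL.exitCost, if_neg (hno a), if_neg (hno b)]
    constructor <;> intro _ <;> linarith
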